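/- An instance consists of $n\ge 1$ jobs of common length $p\ge 1$ ($p\in\mathbb N$), job $j$ having an integral release time $r_j$ and an integral deadline $d_j$ (arbitrary, not necessarily agreeable), a batch capacity $B\ge 1$ and a budget of $k\ge 1$ active batches. A feasible schedule assigns to every job $j$ an integral start time $s_j$ with $r_j\le s_j$ and completion time $C_j=s_j+p\le d_j$, such that any two jobs either start at the same time (they are in the same batch) or occupy disjoint intervals $[s_j,s_j+p)$, at most $B$ jobs start at any one time, and there are at most $k$ distinct start times (equivalently, at most $p\cdot k$ time slots are active). Its flow time is $\sum_j (C_j-r_j)$. There is an algorithm that, for every such instance, either correctly reports that no feasible schedule exists or outputs a feasible schedule of minimum flow time, and that runs in time $O(B\cdot k^2\cdot n^7)$ and space $O(B\cdot k\cdot n^5)$. For unit jobs ($p=1$) there is such an algorithm that runs in time $O(B\cdot k^2\cdot n^4)$ and space $O(B\cdot k\cdot n^3)$. The constants in the $O(\cdot)$ are absolute; time is the number of unit-cost operations, and space the number of memory words (including the input), on a RAM whose words hold integers of absolute value polynomially bounded in $n+k+B+p+\max_j\max(|r_j|,|d_j|)$. -/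

import Mathlib

namespace BatchScheduling

/-! ### The scheduling problem -/

/-- An instance: `n` jobs of common length `p`, job `j` having an integral release time and an
integral deadline (in no particular order, and with no agreeability assumption), a batch capacity
`B` and a budget of `k` active batches. -/
structure BatchInstance where
  n : ℕ
  k : ℕ
  B : ℕ
  p : ℕ
  release : Fin n → ℤ
  deadline : Fin n → ℤ
  n_pos : 0 < n
  k_pos : 0 < k
  B_pos : 0 < B
  p_pos : 0 < p

namespace BatchInstance

/-- `s j` is the start time of job `j`, so job `j` occupies `[s j, s j + p)` and completes at
`s j + p`. The jobs of one batch start together, distinct batches do not overlap. -/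
structure Feasible (I : BatchInstance) (s : Fin I.n → ℤ) : Prop where
  release_le : ∀ j, I.release j ≤ s j
  le_deadline : ∀ j, s j + I.p ≤ I.deadline j
  synchronous : ∀ i j, s i < s j → s i + I.p ≤ s j
  capacity : ∀ t : ℤ, (Finset.univ.filter fun j => s j = t).card ≤ I.B
  budget : (Finset.univ.image s).card ≤ I.k

/-- The total flow time: completion time minus release time, summed over the jobs. -/
def flowTime (I : BatchInstance) (s : Fin I.n → ℤ) : ℤ :=
  ∑ j, (s j + I.p - I.release j)

/-- A feasible schedule of minimum total flow time. -/
def IsOptimal (I : BatchInstance) (s : Fin I.n → ℤ) : Prop :=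
  I.Feasible s ∧ ∀ s', I.Feasible s' → I.flowTime s ≤ I.flowTime s'

/-- The order of magnitude of the numbers in the input. -/
def magnitude (I : BatchInstance) : ℕ :=
  I.n + I.k + I.B + I.p +
    Finset.univ.sup fun j => max (I.release j).natAbs (I.deadline j).natAbs

end BatchInstance

/-! ### The machine model: a word RAM with unit-cost operations

A program is a structured program over finitely many integer registers and an integer memory that
is addressed indirectly. The machine is run with `S` memory cells and with words that hold the
integers of absolute value at most `W`; a computation that addresses a cell outside the `S` cells,
or produces a number that is not a word, is stuck. -/

inductive Expr where
  | const (z : ℤ)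
  | reg (x : ℕ)
  | load (a : Expr)
  | add (a b : Expr)
  | sub (a b : Expr)
  | mul (a b : Expr)
  | le (a b : Expr)

inductive Cmd where
  | skip
  | assign (x : ℕ) (e : Expr)
  | store (a e : Expr)
  | seq (c₁ c₂ : Cmd)
  | ite (e : Expr) (c₁ c₂ : Cmd)
  | loop (e : Expr) (c : Cmd)

structure State where
  reg : ℕ → ℤ
  mem : ℕ → ℤ

/-- `z` as a machine word. -/
def toWord (W : ℕ) (z : ℤ) : Option ℤ :=
  if |z| ≤ (W : ℤ) then some z else none

/-- `z` as an address of one of the `S` memory cells. -/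
def toAddress (S : ℕ) (z : ℤ) : Option ℕ :=
  if 0 ≤ z ∧ z < (S : ℤ) then some z.toNat else none

/-- The value of an expression; `le a b` is `1` if `a ≤ b` and `0` otherwise. -/
def Expr.eval (S W : ℕ) (σ : State) : Expr → Option ℤ
  | .const z => toWord W z
  | .reg x => toWord W (σ.reg x)
  | .load a => do
      let z ← a.eval S W σ
      let i ← toAddress S z
      toWord W (σ.mem i)
  | .add a b => do
      let x ← a.eval S W σ
      let y ← b.eval S W σ
      toWord W (x + y)
  | .sub a b => do
      let x ← a.eval S W σ
      let y ← b.eval S W σ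
      toWord W (x - y)
  | .mul a b => do
      let x ← a.eval S W σ
      let y ← b.eval S W σ
      toWord W (x * y)
  | .le a b => do
      let x ← a.eval S W σ
      let y ← b.eval S W σ
      toWord W (if x ≤ y then 1 else 0)

/-- The number of steps needed to evaluate an expression: one for each operation, constant and
register access in it. -/
def Expr.cost : Expr → ℕ
  | .const _ => 1
  | .reg _ => 1
  | .load a => a.cost + 1
  | .add a b => a.cost + b.cost + 1
  | .sub a b => a.cost + b.cost + 1
  | .mul a b => a.cost + b.cost + 1
  | .le a b => a.cost + b.cost + 1

/-- `Exec S W c σ t σ'`: on a machine with `S` memory cells and word bound `W`, the program `c`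
started in state `σ` halts after exactly `t` steps in state `σ'`. -/
inductive Exec (S W : ℕ) : Cmd → State → ℕ → State → Prop
  | skip (σ : State) : Exec S W .skip σ 1 σ
  | assign (σ : State) (x : ℕ) (e : Expr) (v : ℤ) (hv : e.eval S W σ = some v) :
      Exec S W (.assign x e) σ (e.cost + 1) { σ with reg := Function.update σ.reg x v }
  | store (σ : State) (a e : Expr) (z : ℤ) (i : ℕ) (v : ℤ) (hz : a.eval S W σ = some z)
      (hi : toAddress S z = some i) (hv : e.eval S W σ = some v) :
      Exec S W (.store a e) σ (a.cost + e.cost + 1) { σ with mem := Function.update σ.mem i v }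
  | seq (σ σ' σ'' : State) (c₁ c₂ : Cmd) (t₁ t₂ : ℕ) (h₁ : Exec S W c₁ σ t₁ σ')
      (h₂ : Exec S W c₂ σ' t₂ σ'') : Exec S W (.seq c₁ c₂) σ (t₁ + t₂) σ''
  | iteTrue (σ σ' : State) (e : Expr) (v : ℤ) (c₁ c₂ : Cmd) (t : ℕ)
      (hv : e.eval S W σ = some v) (hne : v ≠ 0) (h : Exec S W c₁ σ t σ') :
      Exec S W (.ite e c₁ c₂) σ (e.cost + 1 + t) σ'
  | iteFalse (σ σ' : State) (e : Expr) (c₁ c₂ : Cmd) (t : ℕ)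
      (hv : e.eval S W σ = some 0) (h : Exec S W c₂ σ t σ') :
      Exec S W (.ite e c₁ c₂) σ (e.cost + 1 + t) σ'
  | loopTrue (σ σ' σ'' : State) (e : Expr) (v : ℤ) (c : Cmd) (t₁ t₂ : ℕ)
      (hv : e.eval S W σ = some v) (hne : v ≠ 0) (h₁ : Exec S W c σ t₁ σ')
      (h₂ : Exec S W (.loop e c) σ' t₂ σ'') :
      Exec S W (.loop e c) σ (e.cost + 1 + t₁ + t₂) σ''
  | loopFalse (σ : State) (e : Expr) (c : Cmd) (hv : e.eval S W σ = some 0) :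
      Exec S W (.loop e c) σ (e.cost + 1) σ

/-! ### Input, output, and the resources of a program -/

/-- The initial state: the memory holds `n, k, B, p`, then the `n` release times, then the `n`
deadlines, and is `0` elsewhere; all registers are `0`. -/
def initialState (I : BatchInstance) : State where
  reg := fun _ => 0
  mem := fun i =>
    if i = 0 then I.n
    else if i = 1 then I.k
    else if i = 2 then I.B
    else if i = 3 then I.p
    else if h : i - 4 < I.n then I.release ⟨i - 4, h⟩
    else if h : i - 4 - I.n < I.n then I.deadline ⟨i - 4 - I.n, h⟩
    else 0

/-- The final state reports a correct answer: either cell `0` is `0` and no feasible schedule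
exists, or cell `0` is `1` and the next `n` cells hold the start times of an optimal schedule. -/
def CorrectOutput (I : BatchInstance) (σ : State) : Prop :=
  (σ.mem 0 = 0 ∧ ¬ ∃ s, I.Feasible s) ∨
    (σ.mem 0 = 1 ∧ I.IsOptimal fun j => σ.mem (j + 1))

/-- The program `P` solves the instance `I` in at most `T` steps on a machine with `S` memory
cells (which include those that hold the input) and words of absolute value at most `W`. -/
def SolvesWithin (P : Cmd) (I : BatchInstance) (T S W : ℕ) : Prop :=
  4 + 2 * I.n ≤ S ∧
    ∃ (t : ℕ) (σ : State), t ≤ T ∧ Exec S W P (initialState I) t σ ∧ CorrectOutput I σ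

end BatchScheduling

/-!
The algorithm is a dynamic program over the jobs in order of deadline. A subproblem is given by the
number `i` of jobs considered, two candidate times `L` and `R`, the number `b` of jobs that may
still join a batch at `R`, and the number `c` of other batches allowed: the first `i` jobs that are
released in `(L, R]` are to be scheduled from `L + p` on, completing by `R` or starting at `R`, with
minimum total waiting time. In an optimal solution, the last job `i`, which has the latest deadline,
can be exchanged with any job that is released by its start and starts later
(`Partial.exists_exchanged`). Hence, when it starts at `x < R`, all other jobs that are released by
`x` start by `x`, and the subproblem falls apart at `x` into `(L, x]`, where `B - 1` jobs may join
the batch at `x`, and `(x, R]` (`Partial.cut`, `Partial.join`); when it starts at `R`, one place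
fewer is left there (`Partial.remove_right`, `Partial.join_right`). `DP.Solves.correct` concludes
that a correctly filled table decides the instance and that its references give an optimal schedule.

There are few candidate times, because a batch of an optimal schedule cannot move to an earlier time
unless another batch is in the way (`IsOptimal.exists_blocking`). In general the start times have
the form `release i + l * p` with `l < n`, so that `n ^ 2` candidates suffice
(`IsOptimal.exists_release_add`). For unit jobs `n` of them suffice: the times that result if each
job in turn is parked at the first free time after its release (`IsOptimal.mem_range_parking`). With
`m` candidates, the table has `O(n m² B k)` entries, each of which is computed in time `O(m k)`;
this gives `O(B k² n⁷)` for `m = O(n²)` and `O(B k² n⁴)` for `m = O(n)`.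

The algorithm is written out as a program and verified in a Hoare logic with time bounds, `Runs`,
for states whose registers and cells are bounded by some `V`. Words of absolute value at most
`V ^ 64` then hold all intermediate results of short expressions, so that specifications need only
say that loads are in range and that stored values are bounded by `V`.
-/

namespace BatchScheduling

/-! ### A Hoare logic with time bounds for the word RAM -/

/-- The value of an expression in unbounded arithmetic, a load from a negative address reading
cell `0`. -/
def Expr.val (σ : State) : Expr → ℤ
  | .const z => z
  | .reg x => σ.reg x
  | .load a => σ.mem (a.val σ).toNat
  | .add a b => a.val σ + b.val σ
  | .sub a b => a.val σ - b.val σ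
  | .mul a b => a.val σ * b.val σ
  | .le a b => if a.val σ ≤ b.val σ then 1 else 0

/-- Every load in the expression addresses one of the `S` memory cells. -/
def Expr.Safe (S : ℕ) (σ : State) : Expr → Prop
  | .const _ => True
  | .reg _ => True
  | .load a => a.Safe S σ ∧ 0 ≤ a.val σ ∧ a.val σ < S
  | .add a b => a.Safe S σ ∧ b.Safe S σ
  | .sub a b => a.Safe S σ ∧ b.Safe S σ
  | .mul a b => a.Safe S σ ∧ b.Safe S σ
  | .le a b => a.Safe S σ ∧ b.Safe S σ

/-- An exponent `d` such that the values of the expression and of its subexpressions are at most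
`V ^ d` in any state whose registers and cells are at most `V`. -/
def Expr.deg : Expr → ℕ
  | .const _ => 1
  | .reg _ => 1
  | .load a => a.deg + 1
  | .add a b => a.deg + b.deg + 1
  | .sub a b => a.deg + b.deg + 1
  | .mul a b => a.deg + b.deg + 1
  | .le a b => a.deg + b.deg + 1

/-- Every constant in the expression has absolute value at most `16`. -/
def Expr.smallConsts : Expr → Bool
  | .const z => z.natAbs ≤ 16
  | .reg _ => true
  | .load a => a.smallConsts
  | .add a b => a.smallConsts && b.smallConsts
  | .sub a b => a.smallConsts && b.smallConsts
  | .mul a b => a.smallConsts && b.smallConsts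
  | .le a b => a.smallConsts && b.smallConsts

/-- All registers and memory cells hold integers of absolute value at most `V`. -/
structure Bounded (V : ℕ) (σ : State) : Prop where
  reg : ∀ x, |σ.reg x| ≤ (V : ℤ)
  mem : ∀ i, |σ.mem i| ≤ (V : ℤ)

theorem toWord_of_le {V d D : ℕ} (hV : 1 ≤ V) (hd : d ≤ D) {z : ℤ} (hz : |z| ≤ (V : ℤ) ^ d) :
    toWord (V ^ D) z = some z := by
  have : (V : ℤ) ^ d ≤ (V : ℤ) ^ D := pow_le_pow_right₀ (by exact_mod_cast hV) hd
  simp only [toWord, Nat.cast_pow]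
  rw [if_pos (hz.trans this)]

/-- In a bounded state an expression without out-of-range loads evaluates to its value: words of
absolute value up to a fixed power of the bound hold all intermediate results. -/
theorem Expr.eval_of_safe {S V D : ℕ} {σ : State} (hV : 16 ≤ V) (hb : Bounded V σ) (e : Expr)
    (hc : e.smallConsts = true) (hs : e.Safe S σ) (hd : e.deg ≤ D) :
    e.eval S (V ^ D) σ = some (e.val σ) ∧ |e.val σ| ≤ (V : ℤ) ^ e.deg := by
  have hV1 : 1 ≤ V := by omega
  have hVz : (2 : ℤ) ≤ V := by exact_mod_cast (by omega : 2 ≤ V)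
  have hpos : ∀ d, (1 : ℤ) ≤ (V : ℤ) ^ d := fun d => one_le_pow₀ (by linarith)
  have sum_le : ∀ a b : ℕ, (V : ℤ) ^ a + (V : ℤ) ^ b ≤ (V : ℤ) ^ (a + b + 1) := by
    intro a b
    rw [pow_succ, pow_add]
    nlinarith [hpos a, hpos b, mul_le_mul (hpos a) (hpos b) (by norm_num) (by linarith [hpos a])]
  have word : ∀ (d : ℕ) {z : ℤ}, d ≤ D → |z| ≤ (V : ℤ) ^ d → toWord (V ^ D) z = some z :=
    fun d _ h h' => toWord_of_le hV1 h h'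
  induction e with
  | const z =>
    have h : |z| ≤ (V : ℤ) ^ 1 := by
      simp only [Expr.smallConsts, decide_eq_true_eq] at hc
      rw [pow_one, Int.abs_eq_natAbs]
      exact_mod_cast hc.trans hV
    exact ⟨by simp [Expr.eval, Expr.val, word 1 hd h], h⟩
  | reg x =>
    have h : |σ.reg x| ≤ (V : ℤ) ^ 1 := by simpa using hb.reg x
    exact ⟨by simp [Expr.eval, Expr.val, word 1 hd h], h⟩
  | load a ih =>
    simp only [Expr.deg] at hd
    obtain ⟨h1, h2, h3⟩ := hs
    obtain ⟨i1, -⟩ := ih hc h1 (by omega)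
    have h : |σ.mem (a.val σ).toNat| ≤ (V : ℤ) ^ (a.deg + 1) := by
      rw [pow_succ]
      nlinarith [hb.mem (a.val σ).toNat, hpos a.deg]
    refine ⟨?_, h⟩
    simp only [Expr.eval, i1, Expr.val, toAddress, h2, h3, and_self, if_true,
      Option.bind_eq_bind, Option.bind_some]
    exact word _ hd h
  | add a b iha ihb =>
    simp only [Expr.deg] at hd
    simp only [Expr.smallConsts, Bool.and_eq_true] at hc
    obtain ⟨i1, j1⟩ := iha hc.1 hs.1 (by omega)
    obtain ⟨i2, j2⟩ := ihb hc.2 hs.2 (by omega)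
    have h : |a.val σ + b.val σ| ≤ (V : ℤ) ^ (a.deg + b.deg + 1) :=
      (abs_add_le _ _).trans ((add_le_add j1 j2).trans (sum_le _ _))
    exact ⟨by simp [Expr.eval, i1, i2, Expr.val, word _ hd h], h⟩
  | sub a b iha ihb =>
    simp only [Expr.deg] at hd
    simp only [Expr.smallConsts, Bool.and_eq_true] at hc
    obtain ⟨i1, j1⟩ := iha hc.1 hs.1 (by omega)
    obtain ⟨i2, j2⟩ := ihb hc.2 hs.2 (by omega)
    have h : |a.val σ - b.val σ| ≤ (V : ℤ) ^ (a.deg + b.deg + 1) :=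
      (abs_sub _ _).trans ((add_le_add j1 j2).trans (sum_le _ _))
    exact ⟨by simp [Expr.eval, i1, i2, Expr.val, word _ hd h], h⟩
  | mul a b iha ihb =>
    simp only [Expr.deg] at hd
    simp only [Expr.smallConsts, Bool.and_eq_true] at hc
    obtain ⟨i1, j1⟩ := iha hc.1 hs.1 (by omega)
    obtain ⟨i2, j2⟩ := ihb hc.2 hs.2 (by omega)
    have h : |a.val σ * b.val σ| ≤ (V : ℤ) ^ (a.deg + b.deg + 1) := by
      rw [abs_mul]
      refine (mul_le_mul j1 j2 (abs_nonneg _) (by linarith [hpos a.deg])).trans ?_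
      rw [← pow_add]
      exact pow_le_pow_right₀ (by linarith) (by omega)
    exact ⟨by simp [Expr.eval, i1, i2, Expr.val, word _ hd h], h⟩
  | le a b iha ihb =>
    simp only [Expr.deg] at hd
    simp only [Expr.smallConsts, Bool.and_eq_true] at hc
    obtain ⟨i1, j1⟩ := iha hc.1 hs.1 (by omega)
    obtain ⟨i2, j2⟩ := ihb hc.2 hs.2 (by omega)
    have h : |(if a.val σ ≤ b.val σ then 1 else 0 : ℤ)| ≤ (V : ℤ) ^ (a.deg + b.deg + 1) := by
      split_ifs
      · simpa using hpos _
      · simp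
    exact ⟨by simp [Expr.eval, i1, i2, Expr.val, word _ hd h], h⟩

/-- Overwriting register `x`. -/
def State.set (σ : State) (x : ℕ) (v : ℤ) : State :=
  { σ with reg := Function.update σ.reg x v }

/-- Overwriting memory cell `i`. -/
def State.write (σ : State) (i : ℕ) (v : ℤ) : State :=
  { σ with mem := Function.update σ.mem i v }

@[simp] theorem State.set_reg (σ : State) (x : ℕ) (v : ℤ) (y : ℕ) :
    (σ.set x v).reg y = if y = x then v else σ.reg y := by
  simp [State.set, Function.update_apply]

@[simp] theorem State.set_mem (σ : State) (x : ℕ) (v : ℤ) : (σ.set x v).mem = σ.mem := rfl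

@[simp] theorem State.write_reg (σ : State) (i : ℕ) (v : ℤ) : (σ.write i v).reg = σ.reg := rfl

@[simp] theorem State.write_mem (σ : State) (i : ℕ) (v : ℤ) (y : ℕ) :
    (σ.write i v).mem y = if y = i then v else σ.mem y := by
  simp [State.write, Function.update_apply]

theorem Bounded.set {V : ℕ} {σ : State} (h : Bounded V σ) {x : ℕ} {v : ℤ} (hv : |v| ≤ (V : ℤ)) :
    Bounded V (σ.set x v) :=
  ⟨fun y => by rw [State.set_reg]; split_ifs; exacts [hv, h.reg y], h.mem⟩

theorem Bounded.write {V : ℕ} {σ : State} (h : Bounded V σ) {x : ℕ} {v : ℤ}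
    (hv : |v| ≤ (V : ℤ)) : Bounded V (σ.write x v) :=
  ⟨h.reg, fun y => by rw [State.write_mem]; split_ifs; exacts [hv, h.mem y]⟩

/-- Started in `σ`, the program halts within `t` steps in a state satisfying `Q`. Registers and
cells are at most `V` before and after, and words are as large as the expressions of degree at
most `64` over such a state require. -/
def Runs (S V : ℕ) (c : Cmd) (σ : State) (t : ℕ) (Q : State → Prop) : Prop :=
  Bounded V σ → ∃ t' ≤ t, ∃ σ', Exec S (V ^ 64) c σ t' σ' ∧ Bounded V σ' ∧ Q σ'

/-- An expression whose intermediate results fit into the words used by `Runs`. -/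
def Expr.small (e : Expr) : Bool := e.smallConsts && decide (e.deg ≤ 64)

/-- A loop-free program all of whose expressions are small. -/
def Cmd.straight : Cmd → Bool
  | .skip => true
  | .assign _ e => e.small
  | .store a e => a.small && e.small
  | .seq c₁ c₂ => c₁.straight && c₂.straight
  | .ite e c₁ c₂ => e.small && c₁.straight && c₂.straight
  | .loop _ _ => false

/-- A bound on the number of steps of a loop-free program. -/
def Cmd.steps : Cmd → ℕ
  | .skip => 1
  | .assign _ e => e.cost + 1
  | .store a e => a.cost + e.cost + 1
  | .seq c₁ c₂ => c₁.steps + c₂.steps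
  | .ite e c₁ c₂ => e.cost + 1 + (c₁.steps + c₂.steps)
  | .loop _ _ => 0

/-- The weakest precondition of a loop-free program. -/
def Cmd.wp (S V : ℕ) : Cmd → (State → Prop) → State → Prop
  | .skip, Q, σ => Q σ
  | .assign x e, Q, σ => e.Safe S σ ∧ |e.val σ| ≤ (V : ℤ) ∧ Q (σ.set x (e.val σ))
  | .store a e, Q, σ => (a.Safe S σ ∧ e.Safe S σ) ∧ (0 ≤ a.val σ ∧ a.val σ < S) ∧
      |e.val σ| ≤ (V : ℤ) ∧ Q (σ.write (a.val σ).toNat (e.val σ))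
  | .seq c₁ c₂, Q, σ => c₁.wp S V (c₂.wp S V Q) σ
  | .ite e c₁ c₂, Q, σ => e.Safe S σ ∧ (e.val σ ≠ 0 → c₁.wp S V Q σ) ∧
      (e.val σ = 0 → c₂.wp S V Q σ)
  | .loop _ _, _, _ => False

theorem Runs.mono {S V : ℕ} {c : Cmd} {σ : State} {t t' : ℕ} {Q Q' : State → Prop}
    (h : Runs S V c σ t Q) (ht : t ≤ t') (hQ : ∀ σ', Bounded V σ' → Q σ' → Q' σ') :
    Runs S V c σ t' Q' := fun hb => by
  obtain ⟨u, hu, σ', h1, h2, h3⟩ := h hb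
  exact ⟨u, hu.trans ht, σ', h1, h2, hQ _ h2 h3⟩

theorem Runs.seq {S V : ℕ} {c₁ c₂ : Cmd} {σ : State} {t₁ t₂ : ℕ} {Q : State → Prop}
    (h : Runs S V c₁ σ t₁ fun σ' => Runs S V c₂ σ' t₂ Q) :
    Runs S V (.seq c₁ c₂) σ (t₁ + t₂) Q := fun hb => by
  obtain ⟨u, hu, σ', h1, h2, h3⟩ := h hb
  obtain ⟨u', hu', σ'', h1', h2', h3'⟩ := h3 h2
  exact ⟨u + u', by omega, σ'', .seq _ _ _ _ _ _ _ h1 h1', h2', h3'⟩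

theorem Runs.seq_assoc {S V : ℕ} {c₁ c₂ c₃ : Cmd} {σ : State} {t : ℕ} {Q : State → Prop}
    (h : Runs S V (.seq (.seq c₁ c₂) c₃) σ t Q) : Runs S V (.seq c₁ (.seq c₂ c₃)) σ t Q := by
  intro hb
  obtain ⟨u, hu, σ', h1, h2, h3⟩ := h hb
  cases h1 with
  | seq _ τ _ _ _ t₁ t₂ h1 h1' =>
    cases h1 with
    | seq _ τ' _ _ _ s₁ s₂ h4 h5 =>
      exact ⟨s₁ + (s₂ + t₂), by omega, σ', .seq _ _ _ _ _ _ _ h4 (.seq _ _ _ _ _ _ _ h5 h1'),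
        h2, h3⟩

theorem Runs.ite {S V : ℕ} {e : Expr} {c₁ c₂ : Cmd} {σ : State} {t : ℕ} {Q : State → Prop}
    (hV : 16 ≤ V) (hsmall : e.small = true) (hs : e.Safe S σ)
    (h₁ : e.val σ ≠ 0 → Runs S V c₁ σ t Q) (h₂ : e.val σ = 0 → Runs S V c₂ σ t Q) :
    Runs S V (.ite e c₁ c₂) σ (e.cost + 1 + t) Q := fun hb => by
  simp only [Expr.small, Bool.and_eq_true, decide_eq_true_eq] at hsmall
  have he := (e.eval_of_safe hV hb hsmall.1 hs hsmall.2).1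
  by_cases h0 : e.val σ = 0
  · obtain ⟨u, hu, σ', h1, h2, h3⟩ := h₂ h0 hb
    exact ⟨_, by omega, σ', .iteFalse _ _ _ _ _ u (by rw [he, h0]) h1, h2, h3⟩
  · obtain ⟨u, hu, σ', h1, h2, h3⟩ := h₁ h0 hb
    exact ⟨_, by omega, σ', .iteTrue _ _ _ _ _ _ u he h0 h1, h2, h3⟩

/-- A loop-free program meets its weakest precondition. -/
theorem Runs.of_wp {S V : ℕ} (hV : 16 ≤ V) {c : Cmd} {σ : State} {Q : State → Prop}
    (hc : c.straight = true) (h : c.wp S V Q σ) : Runs S V c σ c.steps Q := by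
  induction c generalizing σ Q with
  | skip => exact fun hb => ⟨1, le_rfl, σ, .skip σ, hb, h⟩
  | assign x e =>
    intro hb
    simp only [Cmd.straight, Expr.small, Bool.and_eq_true, decide_eq_true_eq] at hc
    obtain ⟨h1, h2, h3⟩ := h
    exact ⟨_, le_rfl, _, .assign _ _ _ _ (e.eval_of_safe hV hb hc.1 h1 hc.2).1, hb.set h2, h3⟩
  | store a e =>
    intro hb
    simp only [Cmd.straight, Expr.small, Bool.and_eq_true, decide_eq_true_eq] at hc
    obtain ⟨⟨h1, h2⟩, h3, h4, h5⟩ := h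
    exact ⟨_, le_rfl, _, .store _ _ _ _ _ _ (a.eval_of_safe hV hb hc.1.1 h1 hc.1.2).1
      (by simp only [toAddress]; rw [if_pos h3]) (e.eval_of_safe hV hb hc.2.1 h2 hc.2.2).1,
      hb.write h4, h5⟩
  | seq c₁ c₂ ih₁ ih₂ =>
    simp only [Cmd.straight, Bool.and_eq_true] at hc
    exact .seq ((ih₁ hc.1 h).mono le_rfl fun σ' _ h' => ih₂ hc.2 h')
  | ite e c₁ c₂ ih₁ ih₂ =>
    simp only [Cmd.straight, Bool.and_eq_true] at hc
    obtain ⟨h1, h2, h3⟩ := h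
    exact .ite hV hc.1.1 h1
      (fun h0 => (ih₁ hc.1.2 (h2 h0)).mono (Nat.le_add_right _ _) fun _ _ h => h)
      (fun h0 => (ih₂ hc.2 (h3 h0)).mono (Nat.le_add_left _ _) fun _ _ h => h)
  | loop e c => exact h.elim

/-- The rule for loops that are iterated exactly `N` times, with an invariant indexed by the
number of iterations done. -/
theorem Runs.loop {S V : ℕ} (hV : 16 ≤ V) {e : Expr} {c : Cmd} (hsmall : e.small = true)
    {N t : ℕ} (Inv : ℕ → State → Prop)
    (guard : ∀ q ≤ N, ∀ σ, Inv q σ → e.Safe S σ ∧ e.val σ = if q < N then 1 else 0)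
    (body : ∀ q < N, ∀ σ, Inv q σ → Runs S V c σ t (Inv (q + 1)))
    {σ : State} (h0 : Inv 0 σ) :
    Runs S V (.loop e c) σ ((N + 1) * (e.cost + 1 + t)) (Inv N) := by
  simp only [Expr.small, Bool.and_eq_true, decide_eq_true_eq] at hsmall
  suffices H : ∀ d q : ℕ, q + d = N → ∀ σ, Inv q σ →
      Runs S V (.loop e c) σ ((d + 1) * (e.cost + 1 + t)) (Inv N) from
    H N 0 (by omega) σ h0
  intro d
  induction d with
  | zero =>
    intro q hq σ hσ hb
    obtain rfl : q = N := by omega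
    obtain ⟨g1, g2⟩ := guard q le_rfl σ hσ
    rw [if_neg (lt_irrefl _)] at g2
    refine ⟨_, ?_, σ, .loopFalse _ _ _ ?_, hb, hσ⟩
    · simp only [zero_add, one_mul]; omega
    · rw [(e.eval_of_safe hV hb hsmall.1 g1 hsmall.2).1, g2]
  | succ d ih =>
    intro q hq σ hσ hb
    obtain ⟨g1, g2⟩ := guard q (by omega) σ hσ
    rw [if_pos (by omega)] at g2
    obtain ⟨u, hu, σ', h1, h2, h3⟩ := body q (by omega) σ hσ hb
    obtain ⟨u', hu', σ'', h1', h2', h3'⟩ := ih (q + 1) (by omega) σ' h3 h2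
    refine ⟨_, ?_, σ'', .loopTrue _ _ _ _ 1 _ u u' ?_ one_ne_zero h1 h1', h2', h3'⟩
    · rw [add_mul (d + 1) 1]; omega
    · rw [(e.eval_of_safe hV hb hsmall.1 g1 hsmall.2).1, g2]

end BatchScheduling

namespace BatchScheduling

/-! ### The recursion over deadline-ordered jobs -/

/-- The jobs among the first `i` that are released in the interval `(L, R]`. -/
def window (rel : ℕ → ℤ) (i : ℕ) (L R : ℤ) : Finset ℕ :=
  (Finset.range i).filter fun j => L < rel j ∧ rel j ≤ R

/-- `s` schedules the jobs of `window rel i L R` between a batch that starts at `L` and a batch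
that starts at `R`: jobs start at `L + p` or later, at most `b` of them join the batch at `R`, all
others complete by `R`, in at most `c` batches. -/
structure Partial (rel dl : ℕ → ℤ) (p : ℤ) (B i : ℕ) (L R : ℤ) (b c : ℕ) (s : ℕ → ℤ) : Prop where
  rel_le : ∀ j ∈ window rel i L R, rel j ≤ s j
  le_dl : ∀ j ∈ window rel i L R, s j + p ≤ dl j
  left : ∀ j ∈ window rel i L R, L + p ≤ s j
  right : ∀ j ∈ window rel i L R, s j = R ∨ s j + p ≤ R
  sync : ∀ j ∈ window rel i L R, ∀ j' ∈ window rel i L R, s j < s j' → s j + p ≤ s j'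
  cap : ∀ t, ((window rel i L R).filter fun j => s j = t).card ≤ B
  capR : ((window rel i L R).filter fun j => s j = R).card ≤ b
  batches : (((window rel i L R).image s).erase R).card ≤ c

/-- The total waiting time of the jobs in a window. -/
def waiting (rel : ℕ → ℤ) (i : ℕ) (L R : ℤ) (s : ℕ → ℤ) : ℤ :=
  ∑ j ∈ window rel i L R, (s j - rel j)

theorem mem_window {rel : ℕ → ℤ} {i : ℕ} {L R : ℤ} {j : ℕ} :
    j ∈ window rel i L R ↔ j < i ∧ L < rel j ∧ rel j ≤ R := by
  simp [window]

theorem window_zero (rel : ℕ → ℤ) (L R : ℤ) : window rel 0 L R = ∅ := by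
  simp [window]

theorem window_succ_of_not {rel : ℕ → ℤ} {i : ℕ} {L R : ℤ} (h : ¬ (L < rel i ∧ rel i ≤ R)) :
    window rel (i + 1) L R = window rel i L R := by
  ext j
  simp only [mem_window]
  constructor
  · rintro ⟨h1, h2⟩
    refine ⟨?_, h2⟩
    rcases Nat.lt_succ_iff_lt_or_eq.mp h1 with h' | rfl
    exacts [h', absurd h2 h]
  · rintro ⟨h1, h2⟩
    exact ⟨by omega, h2⟩

theorem window_succ {rel : ℕ → ℤ} {i : ℕ} {L R : ℤ} (h : L < rel i ∧ rel i ≤ R) :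
    window rel (i + 1) L R = insert i (window rel i L R) := by
  ext j
  simp only [mem_window, Finset.mem_insert]
  constructor
  · rintro ⟨h1, h2⟩
    rcases Nat.lt_succ_iff_lt_or_eq.mp h1 with h' | rfl
    exacts [.inr ⟨h', h2⟩, .inl rfl]
  · rintro (rfl | ⟨h1, h2⟩)
    exacts [⟨by omega, h⟩, ⟨by omega, h2⟩]

theorem not_mem_window_self (rel : ℕ → ℤ) (i : ℕ) (L R : ℤ) : i ∉ window rel i L R := by
  simp [mem_window]

theorem window_union {rel : ℕ → ℤ} {i : ℕ} {L x R : ℤ} (h1 : L ≤ x) (h2 : x ≤ R) :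
    window rel i L R = window rel i L x ∪ window rel i x R := by
  ext j
  simp only [mem_window, Finset.mem_union]
  constructor
  · rintro ⟨h, h', h''⟩
    rcases le_or_gt (rel j) x with hx | hx
    exacts [.inl ⟨h, h', hx⟩, .inr ⟨h, hx, h''⟩]
  · rintro (⟨h, h', h''⟩ | ⟨h, h', h''⟩)
    exacts [⟨h, h', by omega⟩, ⟨h, by omega, h''⟩]

theorem window_disjoint {rel : ℕ → ℤ} {i : ℕ} {L x R : ℤ} :
    Disjoint (window rel i L x) (window rel i x R) := by
  rw [Finset.disjoint_left]
  intro j h h'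
  rw [mem_window] at h h'
  omega

theorem waiting_succ {rel : ℕ → ℤ} {i : ℕ} {L R : ℤ} (h : L < rel i ∧ rel i ≤ R) (s : ℕ → ℤ) :
    waiting rel (i + 1) L R s = waiting rel i L R s + (s i - rel i) := by
  rw [waiting, window_succ h, Finset.sum_insert (not_mem_window_self _ _ _ _), add_comm]
  rfl

theorem waiting_split {rel : ℕ → ℤ} {i : ℕ} {L x R : ℤ} (h1 : L ≤ x) (h2 : x ≤ R) (s : ℕ → ℤ) :
    waiting rel i L R s = waiting rel i L x s + waiting rel i x R s := by
  rw [waiting, window_union h1 h2, Finset.sum_union window_disjoint]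
  rfl

section Glue

variable {rel dl : ℕ → ℤ} {p : ℤ} {B i : ℕ} {L R : ℤ} {b c : ℕ} {s : ℕ → ℤ}

/-- Only the start times of the jobs in the window matter. -/
theorem Partial.congr {s' : ℕ → ℤ} (h : Partial rel dl p B i L R b c s)
    (hs : ∀ j ∈ window rel i L R, s' j = s j) : Partial rel dl p B i L R b c s' where
  rel_le j hj := by rw [hs j hj]; exact h.rel_le j hj
  le_dl j hj := by rw [hs j hj]; exact h.le_dl j hj
  left j hj := by rw [hs j hj]; exact h.left j hj
  right j hj := by rw [hs j hj]; exact h.right j hj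
  sync j hj j' hj' := by rw [hs j hj, hs j' hj']; exact h.sync j hj j' hj'
  cap t := by
    rw [Finset.filter_congr fun j hj => by rw [hs j hj]]
    exact h.cap t
  capR := by
    rw [Finset.filter_congr fun j hj => by rw [hs j hj]]
    exact h.capR
  batches := by
    rw [Finset.image_congr fun j hj => hs j hj]
    exact h.batches

theorem waiting_congr {s' : ℕ → ℤ} (hs : ∀ j ∈ window rel i L R, s' j = s j) :
    waiting rel i L R s' = waiting rel i L R s :=
  Finset.sum_congr rfl fun j hj => by rw [hs j hj]

/-- A schedule of the earlier jobs extends by putting job `i` into the batch at `R`. -/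
theorem Partial.join_right (h : Partial rel dl p B i L R b c s) (hi : L < rel i ∧ rel i ≤ R)
    (hLR : L + p ≤ R) (hb : b + 1 ≤ B) (hs : s i = R) (hd : R + p ≤ dl i) :
    Partial rel dl p B (i + 1) L R (b + 1) c s := by
  have hw := window_succ hi
  refine ⟨?_, ?_, ?_, ?_, ?_, ?_, ?_, ?_⟩ <;> rw [hw]
  · simp only [Finset.forall_mem_insert]; exact ⟨by omega, h.rel_le⟩
  · simp only [Finset.forall_mem_insert]; exact ⟨by omega, h.le_dl⟩
  · simp only [Finset.forall_mem_insert]; exact ⟨by omega, h.left⟩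
  · simp only [Finset.forall_mem_insert]; exact ⟨by omega, h.right⟩
  · simp only [Finset.forall_mem_insert]
    refine ⟨⟨by omega, fun j hj hlt => ?_⟩, fun j hj => ⟨fun hlt => ?_, fun j' hj' => ?_⟩⟩
    · rcases h.right j hj with h' | h' <;> have := h.left j hj <;> omega
    · rcases h.right j hj with h' | h' <;> omega
    · exact h.sync j hj j' hj'
  · intro t
    by_cases ht : t = R
    · subst ht
      rw [Finset.filter_insert, if_pos hs]
      exact (Finset.card_insert_le _ _).trans ((Nat.succ_le_succ h.capR).trans hb)
    · rw [Finset.filter_insert, if_neg (by rw [hs]; exact fun e => ht e.symm)]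
      exact h.cap t
  · rw [Finset.filter_insert, if_pos hs]
    exact (Finset.card_insert_le _ _).trans (Nat.succ_le_succ h.capR)
  · rw [Finset.image_insert, hs, Finset.erase_insert_eq_erase]
    exact h.batches

/-- A schedule of the earlier jobs that is cut by a batch at `x` extends by putting job `i` into
that batch. -/
theorem Partial.join {x : ℤ} {c₁ c₂ : ℕ} (hp : 0 < p) (h₁ : Partial rel dl p (B + 1) i L x B c₁ s)
    (h₂ : Partial rel dl p (B + 1) i x R b c₂ s) (hi : L < rel i ∧ rel i ≤ x) (hL : L + p ≤ x)
    (hR : x + p ≤ R) (hs : s i = x) (hd : x + p ≤ dl i) :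
    Partial rel dl p (B + 1) (i + 1) L R b (c₁ + c₂ + 1) s := by
  have h₁' := h₁.join_right hi hL le_rfl hs hd
  have hw : window rel (i + 1) L R = window rel (i + 1) L x ∪ window rel i x R := by
    rw [window_succ ⟨hi.1, by omega⟩, window_succ hi, Finset.insert_union,
      window_union (by omega) (by omega : x ≤ R)]
  have hx : ∀ j ∈ window rel (i + 1) L x, s j ≤ x := fun j hj => by
    rcases h₁'.right j hj with h | h <;> omega
  have hx' : ∀ j ∈ window rel i x R, x + p ≤ s j := h₂.left
  have hmem : ∀ P : ℕ → Prop, (∀ j ∈ window rel (i + 1) L x, P j) → (∀ j ∈ window rel i x R, P j) →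
      ∀ j ∈ window rel (i + 1) L x ∪ window rel i x R, P j := by
    intro P h h' j hj
    rcases Finset.mem_union.mp hj with hj | hj
    exacts [h j hj, h' j hj]
  refine ⟨?_, ?_, ?_, ?_, ?_, ?_, ?_, ?_⟩ <;> rw [hw]
  · exact hmem _ h₁'.rel_le h₂.rel_le
  · exact hmem _ h₁'.le_dl h₂.le_dl
  · exact hmem _ h₁'.left fun j hj => by have := hx' j hj; omega
  · exact hmem _ (fun j hj => by have := hx j hj; omega) h₂.right
  · refine hmem _ (fun j hj => hmem _ (h₁'.sync j hj) fun j' hj' _ => ?_)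
      fun j hj => hmem _ (fun j' hj' hlt => ?_) (h₂.sync j hj)
    · have := hx j hj; have := hx' j' hj'; omega
    · have := hx j' hj'; have := hx' j hj; omega
  · intro t
    rw [Finset.filter_union]
    rcases le_or_gt t x with ht | ht
    · rw [Finset.filter_false_of_mem (s := window rel i x R) fun j hj => by
        have := hx' j hj; omega, Finset.union_empty]
      exact h₁'.cap t
    · rw [Finset.filter_false_of_mem (s := window rel (i + 1) L x) fun j hj => by
        have := hx j hj; omega, Finset.empty_union]
      exact h₂.cap t
  · rw [Finset.filter_union, Finset.filter_false_of_mem (s := window rel (i + 1) L x) fun j hj => by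
        have := hx j hj; omega, Finset.empty_union]
    exact h₂.capR
  · rw [Finset.image_union, Finset.erase_union_distrib]
    have e1 : (((window rel (i + 1) L x).image s).erase R).card ≤ c₁ + 1 := by
      refine (Finset.card_le_card (Finset.erase_subset _ _)).trans ?_
      have := Finset.pred_card_le_card_erase (s := (window rel (i + 1) L x).image s) (a := x)
      have := h₁'.batches
      omega
    have := Finset.card_union_le (((window rel (i + 1) L x).image s).erase R)
      (((window rel i x R).image s).erase R)
    have := h₂.batches
    omega

/-- Conversely, removing job `i` from the batch at `R`. -/
theorem Partial.remove_right (h : Partial rel dl p B (i + 1) L R b c s)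
    (hi : L < rel i ∧ rel i ≤ R) (hs : s i = R) :
    ∃ b', b = b' + 1 ∧ Partial rel dl p B i L R b' c s := by
  have hw := window_succ hi
  have hsub : window rel i L R ⊆ window rel (i + 1) L R := by
    rw [hw]; exact Finset.subset_insert _ _
  have hcap := h.capR
  rw [hw, Finset.filter_insert, if_pos hs, Finset.card_insert_of_notMem
    (fun hm => not_mem_window_self _ _ _ _ (Finset.mem_of_mem_filter _ hm))] at hcap
  obtain ⟨b', rfl⟩ : ∃ b', b = b' + 1 := ⟨b - 1, by omega⟩
  refine ⟨b', rfl, fun j hj => h.rel_le j (hsub hj), fun j hj => h.le_dl j (hsub hj),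
    fun j hj => h.left j (hsub hj), fun j hj => h.right j (hsub hj),
    fun j hj j' hj' => h.sync j (hsub hj) j' (hsub hj'),
    fun t => (Finset.card_le_card (Finset.filter_subset_filter _ hsub)).trans (h.cap t),
    by omega, (Finset.card_le_card (Finset.erase_subset_erase _
      (Finset.image_subset_image hsub))).trans h.batches⟩

/-- Removing job `i` cuts the schedule at its start time, if no earlier job that is released by
then starts later. -/
theorem Partial.cut (hp : 0 < p) (h : Partial rel dl p (B + 1) (i + 1) L R b c s)
    (hi : L < rel i ∧ rel i ≤ R) (hs : s i ≠ R)
    (hex : ∀ j ∈ window rel i L R, rel j ≤ s i → s j ≤ s i) :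
    ∃ c₁ c₂, c₁ + c₂ + 1 = c ∧ Partial rel dl p (B + 1) i L (s i) B c₁ s ∧
      Partial rel dl p (B + 1) i (s i) R b c₂ s := by
  have hw := window_succ hi
  have hsub : window rel i L R ⊆ window rel (i + 1) L R := by
    rw [hw]; exact Finset.subset_insert _ _
  have himem : i ∈ window rel (i + 1) L R := by rw [hw]; exact Finset.mem_insert_self _ _
  have hiL := h.left i himem
  have hiR : s i + p ≤ R := (h.right i himem).resolve_left hs
  have hu := window_union (rel := rel) (i := i) (by omega : L ≤ s i) (by omega : s i ≤ R)
  have hl : window rel i L (s i) ⊆ window rel i L R := by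
    rw [hu]; exact Finset.subset_union_left
  have hr : window rel i (s i) R ⊆ window rel i L R := by
    rw [hu]; exact Finset.subset_union_right
  have hlx : ∀ j ∈ window rel i L (s i), s j ≤ s i := fun j hj =>
    hex j (hl hj) (mem_window.mp hj).2.2
  have hrx : ∀ j ∈ window rel i (s i) R, s i + p ≤ s j := fun j hj => by
    refine h.sync i himem j (hsub (hr hj)) ?_
    have := h.rel_le j (hsub (hr hj))
    have := (mem_window.mp hj).2.1
    omega
  -- The batches before `s i`, the one at `s i` and those after it are distinct.
  have hcard : (((window rel i L (s i)).image s).erase (s i)).card + 1 +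
      (((window rel i (s i) R).image s).erase R).card ≤ c := by
    refine le_trans ?_ h.batches
    rw [← Finset.card_insert_of_notMem (Finset.notMem_erase (s i) _),
      ← Finset.card_union_of_disjoint]
    · refine Finset.card_le_card ?_
      intro t
      simp only [Finset.mem_union, Finset.mem_insert, Finset.mem_erase, Finset.mem_image]
      rintro ((rfl | ⟨h1, j, hj, rfl⟩) | ⟨h1, j, hj, rfl⟩)
      · exact ⟨hs, i, himem, rfl⟩
      · exact ⟨by have := hlx j hj; omega, j, hsub (hl hj), rfl⟩
      · exact ⟨h1, j, hsub (hr hj), rfl⟩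
    · rw [Finset.disjoint_left]
      intro t
      simp only [Finset.mem_insert, Finset.mem_erase, Finset.mem_image]
      rintro (rfl | ⟨h1, j, hj, rfl⟩) ⟨h2, j', hj', h3⟩
      · have := hrx j' hj'; omega
      · have := hrx j' hj'; have := hlx j hj; omega
  have hB : ((window rel i L (s i)).filter fun j => s j = s i).card ≤ B := by
    have := h.cap (s i)
    rw [hw, Finset.filter_insert, if_pos rfl, Finset.card_insert_of_notMem
      (fun hm => not_mem_window_self _ _ _ _ (Finset.mem_of_mem_filter _ hm))] at this
    exact (Finset.card_le_card (Finset.filter_subset_filter _ hl)).trans (by omega)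
  refine ⟨(((window rel i L (s i)).image s).erase (s i)).card,
    c - (((window rel i L (s i)).image s).erase (s i)).card - 1, by omega, ?_, ?_⟩
  · refine ⟨fun j hj => h.rel_le j (hsub (hl hj)), fun j hj => h.le_dl j (hsub (hl hj)),
      fun j hj => h.left j (hsub (hl hj)), fun j hj => ?_,
      fun j hj j' hj' => h.sync j (hsub (hl hj)) j' (hsub (hl hj')),
      fun t => (Finset.card_le_card (Finset.filter_subset_filter _ (hl.trans hsub))).trans
        (h.cap t),
      hB, le_rfl⟩
    rcases (hlx j hj).lt_or_eq with hlt | heq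
    exacts [.inr (h.sync j (hsub (hl hj)) i himem hlt), .inl heq]
  · exact ⟨fun j hj => h.rel_le j (hsub (hr hj)), fun j hj => h.le_dl j (hsub (hr hj)),
      hrx, fun j hj => h.right j (hsub (hr hj)),
      fun j hj j' hj' => h.sync j (hsub (hr hj)) j' (hsub (hr hj')),
      fun t => (Finset.card_le_card (Finset.filter_subset_filter _ (hr.trans hsub))).trans
        (h.cap t),
      (Finset.card_le_card (Finset.filter_subset_filter _ (hr.trans hsub))).trans h.capR, by omega⟩

/-- Exchanging job `i`, which has the latest deadline, with a job that is released by `s i` and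
starts later. -/
theorem Partial.swap (h : Partial rel dl p B (i + 1) L R b c s)
    (hi : L < rel i ∧ rel i ≤ R) {j : ℕ} (hj : j ∈ window rel i L R) (hd : dl j ≤ dl i)
    (hr : rel j ≤ s i) (hlt : s i < s j) :
    Partial rel dl p B (i + 1) L R b c (s ∘ Equiv.swap i j) ∧
      waiting rel (i + 1) L R (s ∘ Equiv.swap i j) = waiting rel (i + 1) L R s := by
  have hw := window_succ hi
  have hjm : j ∈ window rel (i + 1) L R := by rw [hw]; exact Finset.mem_insert_of_mem hj
  have him : i ∈ window rel (i + 1) L R := by rw [hw]; exact Finset.mem_insert_self _ _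
  have hmem : ∀ a, Equiv.swap i j a ∈ window rel (i + 1) L R ↔ a ∈ window rel (i + 1) L R := by
    intro a
    rcases eq_or_ne a i with rfl | h1
    · simp [him, hjm]
    rcases eq_or_ne a j with rfl | h2
    · simp [him, hjm]
    rw [Equiv.swap_apply_of_ne_of_ne h1 h2]
  have hmap : (window rel (i + 1) L R).map (Equiv.swap i j).toEmbedding =
      window rel (i + 1) L R := by
    ext a
    rw [Finset.mem_map_equiv, Equiv.symm_swap, hmem]
  have hfilter : ∀ t, ((window rel (i + 1) L R).filter fun a => s (Equiv.swap i j a) = t).card =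
      ((window rel (i + 1) L R).filter fun a => s a = t).card := by
    intro t
    conv_rhs => rw [← hmap, Finset.filter_map, Finset.card_map]
    rfl
  have himage : (window rel (i + 1) L R).image (s ∘ Equiv.swap i j) =
      (window rel (i + 1) L R).image s := by
    conv_rhs => rw [← hmap, Finset.map_eq_image, Finset.image_image]
    rfl
  have hcase : ∀ (P : ℕ → ℤ → Prop), P i (s j) → P j (s i) →
      (∀ a ∈ window rel (i + 1) L R, P a (s a)) →
      ∀ a ∈ window rel (i + 1) L R, P a (s (Equiv.swap i j a)) := by
    intro P hPi hPj hP a ha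
    rcases eq_or_ne a i with rfl | h1
    · simpa using hPi
    rcases eq_or_ne a j with rfl | h2
    · simpa using hPj
    rw [Equiv.swap_apply_of_ne_of_ne h1 h2]
    exact hP a ha
  have hri := h.rel_le i him
  have hdj := h.le_dl j hjm
  refine ⟨⟨?_, ?_, ?_, ?_, ?_, ?_, ?_, ?_⟩, ?_⟩
  · exact hcase (fun a t => rel a ≤ t) (by omega) hr h.rel_le
  · exact hcase (fun a t => t + p ≤ dl a) (by omega) (by omega) h.le_dl
  · exact fun a ha => h.left _ ((hmem a).mpr ha)
  · exact fun a ha => h.right _ ((hmem a).mpr ha)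
  · exact fun a ha a' ha' => h.sync _ ((hmem a).mpr ha) _ ((hmem a').mpr ha')
  · intro t
    exact (hfilter t).trans_le (h.cap t)
  · exact (hfilter R).trans_le h.capR
  · rw [himage]; exact h.batches
  · simp only [waiting, Finset.sum_sub_distrib]
    congr 1
    conv_rhs => rw [← hmap, Finset.sum_map]
    rfl

/-- After finitely many exchanges, no job of the window that is released by the start of job `i`
starts later than job `i`. -/
theorem Partial.exists_exchanged (hdl : ∀ j < i, dl j ≤ dl i)
    (h : Partial rel dl p B (i + 1) L R b c s) (hp : 0 ≤ p) (hi : L < rel i ∧ rel i ≤ R)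
    {P : ℤ → Prop} (hP : ∀ j ∈ window rel (i + 1) L R, P (s j)) :
    ∃ s', Partial rel dl p B (i + 1) L R b c s' ∧
      waiting rel (i + 1) L R s' = waiting rel (i + 1) L R s ∧
      (∀ j ∈ window rel (i + 1) L R, P (s' j)) ∧
      ∀ j ∈ window rel i L R, rel j ≤ s' i → s' j ≤ s' i := by
  have hw := window_succ hi
  have him : i ∈ window rel (i + 1) L R := by rw [hw]; exact Finset.mem_insert_self _ _
  -- Every exchange increases the start time of job `i`, which is at most `R`.
  induction hN : (R - s i).toNat using Nat.strong_induction_on generalizing s with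
  | _ N ih =>
    by_cases hex : ∀ j ∈ window rel i L R, rel j ≤ s i → s j ≤ s i
    · exact ⟨s, h, rfl, hP, hex⟩
    · push Not at hex
      obtain ⟨j, hj, hr, hlt⟩ := hex
      have hjm : j ∈ window rel (i + 1) L R := by rw [hw]; exact Finset.mem_insert_of_mem hj
      obtain ⟨h1, h2⟩ := h.swap hi hj (hdl j (mem_window.mp hj).1) hr hlt
      have hjR : s j ≤ R := by rcases h.right j hjm with h | h <;> omega
      have hi' : (s ∘ Equiv.swap i j) i = s j := by simp
      obtain ⟨s', a, b, c, d⟩ := ih (R - s j).toNat (by omega) h1 (fun a ha => by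
        rcases eq_or_ne a i with rfl | h1
        · simpa using hP j hjm
        rcases eq_or_ne a j with rfl | h2
        · simpa using hP i him
        simpa [Equiv.swap_apply_of_ne_of_ne h1 h2] using hP a ha) (by rw [hi'])
      exact ⟨s', a, b.trans h2, c, d⟩

end Glue

end BatchScheduling

namespace BatchScheduling

/-! ### Tables of optimal values and their correctness -/

/-- The data of the recursion: release times and deadlines of the jobs in deadline order, `m`
candidate start times, the number `B` of companions a job can have in its batch (one less than the
capacity), the budget `k`, the length `p`, and the value `M` that stands for infeasibility. -/
structure DP where
  m : ℕ
  B : ℕ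
  k : ℕ
  p : ℤ
  M : ℤ
  rel : ℕ → ℤ
  dl : ℕ → ℤ
  time : ℕ → ℤ

namespace DP

/-- The position in the table of the subproblem of the first `i` jobs between the candidate times
with indices `l` and `r`, of which at most `b` may start at the right end and the others use at
most `c` batches. -/
def cell (D : DP) (i l r b c : ℕ) : ℕ :=
  (((i * D.m + l) * D.m + r) * (D.B + 1) + b) * (D.k + 1) + c

/-- The contents of the table: the optimal value of a subproblem, the start time of its last job,
and the positions of the subproblems to the left and to the right of that start time. -/
structure Table where
  cost : ℕ → ℤ
  start : ℕ → ℤ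
  left : ℕ → ℤ
  right : ℕ → ℤ

/-- Job `i` can start at time `s` in the subproblem `(l, r, b, c)`, which leaves the subproblems at
the positions `ql` and `qr` and gives the total value `v`. Either the job joins the batch at the
right end, and there is one subproblem, or it is in a batch at the candidate time `x`, and the
budget is divided into `c₁ + c₂ + 1`. Only the pairs `(x, c₁)` satisfying `X` are considered. -/
def Choice (D : DP) (cost : ℕ → ℤ) (X : ℕ → ℕ → Prop) (i l r b c : ℕ) (v s ql qr : ℤ) : Prop :=
  (∃ b', b = b' + 1 ∧ D.time r + D.p ≤ D.dl i ∧ s = D.time r ∧ ql = D.cell i l r b' c ∧ qr = ql ∧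
    v = cost (D.cell i l r b' c) + (s - D.rel i)) ∨
  ∃ x < D.m, ∃ c₁ c₂, X x c₁ ∧ c₁ + c₂ + 1 = c ∧ D.time l + D.p ≤ D.time x ∧
    D.time x + D.p ≤ D.time r ∧ D.rel i ≤ D.time x ∧ D.time x + D.p ≤ D.dl i ∧ s = D.time x ∧
    ql = D.cell i l x D.B c₁ ∧ qr = D.cell i x r b c₂ ∧
    v = cost (D.cell i l x D.B c₁) + cost (D.cell i x r b c₂) + (s - D.rel i)

/-- `v` is the minimum of `M` and of the values of the choices for job `i`, and the choice given by
`s`, `ql` and `qr` attains it if it is less than `M`. -/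
structure Best (D : DP) (cost : ℕ → ℤ) (X : ℕ → ℕ → Prop) (i l r b c : ℕ) (v s ql qr : ℤ) :
    Prop where
  le_M : v ≤ D.M
  le : ∀ v' s' ql' qr', D.Choice cost X i l r b c v' s' ql' qr' → v ≤ v'
  attained : v = D.M ∨ D.Choice cost X i l r b c v s ql qr

/-- The entry of the table for the subproblem `(i + 1, l, r, b, c)` is correct relative to the
entries for `i`. If job `i` is not in the window, it refers to the subproblem without it. -/
def Entry (D : DP) (t : Table) (i l r b c : ℕ) : Prop :=
  let a := D.cell (i + 1) l r b c
  (¬ (D.time l < D.rel i ∧ D.rel i ≤ D.time r) → t.cost a = t.cost (D.cell i l r b c) ∧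
    t.left a = D.cell i l r b c ∧ t.right a = D.cell i l r b c) ∧
  (D.time l < D.rel i ∧ D.rel i ≤ D.time r →
    D.Best t.cost (fun _ _ => True) i l r b c (t.cost a) (t.start a) (t.left a) (t.right a))

/-- The schedule that the subproblem at position `a`, which has `i` jobs, finds by following the
references in the table. -/
def schedule (D : DP) (t : Table) : ℕ → ℕ → ℕ → ℤ
  | 0, _, _ => 0
  | i + 1, a, j =>
    if j = i then t.start a
    else if D.rel j ≤ t.start a then D.schedule t i (t.left a).toNat j
    else D.schedule t i (t.right a).toNat j

/-- A table all of whose entries for at most `n` jobs are correct. -/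
structure Correct (D : DP) (n : ℕ) (t : Table) : Prop where
  zero : ∀ l < D.m, ∀ r < D.m, ∀ b ≤ D.B, ∀ c ≤ D.k, t.cost (D.cell 0 l r b c) = 0
  succ : ∀ i < n, ∀ l < D.m, ∀ r < D.m, ∀ b ≤ D.B, ∀ c ≤ D.k, D.Entry t i l r b c

variable {D : DP} {n : ℕ} {t : Table}

theorem Correct.cost_nonneg (ht : D.Correct n t) (hM : 0 ≤ D.M) :
    ∀ i ≤ n, ∀ l < D.m, ∀ r < D.m, ∀ b ≤ D.B, ∀ c ≤ D.k, 0 ≤ t.cost (D.cell i l r b c) := by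
  intro i
  induction i with
  | zero => exact fun _ l hl r hr b hb c hc => (ht.zero l hl r hr b hb c hc).ge
  | succ i ih =>
    intro hi l hl r hr b hb c hc
    obtain ⟨e1, e2⟩ := ht.succ i hi l hl r hr b hb c hc
    by_cases hw : D.time l < D.rel i ∧ D.rel i ≤ D.time r
    · rcases (e2 hw).attained with h | h
      · rw [h]; exact hM
      · rcases h with ⟨b', rfl, -, h, -, -, hv⟩ | ⟨x, hx, c₁, c₂, -, hc', -, -, h1, -, h, -, -, hv⟩
        · have := ih (by omega) l hl r hr b' (by omega) c hc
          omega
        · have := ih (by omega) l hl x hx D.B le_rfl c₁ (by omega)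
          have := ih (by omega) x hx r hr b hb c₂ (by omega)
          omega
    · rw [(e1 hw).1]
      exact ih (by omega) l hl r hr b hb c hc

/-- Following the references from an entry with finite value gives a schedule of that value. -/
theorem Correct.sound (ht : D.Correct n t) (hM : 0 ≤ D.M) (hp : 0 < D.p) :
    ∀ i ≤ n, ∀ l < D.m, ∀ r < D.m, ∀ b ≤ D.B, ∀ c ≤ D.k, D.time l + D.p ≤ D.time r →
      t.cost (D.cell i l r b c) < D.M →
      Partial D.rel D.dl D.p (D.B + 1) i (D.time l) (D.time r) b c
        (D.schedule t i (D.cell i l r b c)) ∧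
      waiting D.rel i (D.time l) (D.time r) (D.schedule t i (D.cell i l r b c)) =
        t.cost (D.cell i l r b c) := by
  intro i
  induction i with
  | zero =>
    intro _ l hl r hr b hb c hc _ _
    rw [ht.zero l hl r hr b hb c hc, waiting, window_zero, Finset.sum_empty]
    exact ⟨by constructor <;> simp [window_zero], rfl⟩
  | succ i ih =>
    intro hi l hl r hr b hb c hc hlr hlt
    obtain ⟨e1, e2⟩ := ht.succ i hi l hl r hr b hb c hc
    have hne : ∀ L R, ∀ j ∈ window D.rel i L R, j ≠ i := fun L R j hj => by
      have := (mem_window.mp hj).1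
      omega
    by_cases hw : D.time l < D.rel i ∧ D.rel i ≤ D.time r
    · rcases (e2 hw).attained with h | h
      · omega
      have hs : D.schedule t (i + 1) (D.cell (i + 1) l r b c) i =
          t.start (D.cell (i + 1) l r b c) := by simp [schedule]
      rcases h with ⟨b', rfl, hd, h, hl', hr', hv⟩ |
        ⟨x, hx, c₁, c₂, -, hc', h1, h2, h3, hd, h, hl', hr', hv⟩
      · obtain ⟨g1, g2⟩ := ih (by omega) l hl r hr b' (by omega) c hc hlr (by omega)
        have heq : ∀ j ∈ window D.rel i (D.time l) (D.time r),
            D.schedule t (i + 1) (D.cell (i + 1) l r (b' + 1) c) j =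
              D.schedule t i (D.cell i l r b' c) j := fun j hj => by
          simp [schedule, hne _ _ j hj, hr', hl']
        refine ⟨(g1.congr heq).join_right hw hlr (by omega) (hs.trans h) hd, ?_⟩
        rw [waiting_succ hw, waiting_congr heq, g2, hs, hv]
      · have n1 := ht.cost_nonneg hM i (by omega) l hl x hx D.B le_rfl c₁ (by omega)
        have n2 := ht.cost_nonneg hM i (by omega) x hx r hr b hb c₂ (by omega)
        obtain ⟨g1, g2⟩ := ih (by omega) l hl x hx D.B le_rfl c₁ (by omega) h1 (by omega)
        obtain ⟨g3, g4⟩ := ih (by omega) x hx r hr b hb c₂ (by omega) h2 (by omega)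
        have heq1 : ∀ j ∈ window D.rel i (D.time l) (D.time x),
            D.schedule t (i + 1) (D.cell (i + 1) l r b c) j =
              D.schedule t i (D.cell i l x D.B c₁) j := fun j hj => by
          simp [schedule, hne _ _ j hj, hl', h, (mem_window.mp hj).2.2]
        have heq2 : ∀ j ∈ window D.rel i (D.time x) (D.time r),
            D.schedule t (i + 1) (D.cell (i + 1) l r b c) j =
              D.schedule t i (D.cell i x r b c₂) j := fun j hj => by
          simp [schedule, hne _ _ j hj, hr', h, not_le.mpr (mem_window.mp hj).2.1]
        refine ⟨?_, ?_⟩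
        · rw [← hc']
          have := (g1.congr heq1).join hp (g3.congr heq2) ⟨hw.1, h3⟩ h1 h2
          simp only [hc'] at this
          exact hc' ▸ this (hs.trans h) hd
        · rw [waiting_succ hw, waiting_split (x := D.time x) (by omega) (by omega),
            waiting_congr heq1, waiting_congr heq2, g2, g4, hs, hv]
    · obtain ⟨h1, h2, h3⟩ := e1 hw
      rw [h1] at hlt ⊢
      obtain ⟨g1, g2⟩ := ih (by omega) l hl r hr b hb c hc hlr hlt
      have heq : ∀ j ∈ window D.rel i (D.time l) (D.time r),
          D.schedule t (i + 1) (D.cell (i + 1) l r b c) j =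
            D.schedule t i (D.cell i l r b c) j := fun j hj => by
        simp [schedule, hne _ _ j hj, h2, h3]
      have hwin := window_succ_of_not hw
      refine ⟨?_, ?_⟩
      · have g := g1.congr heq
        exact ⟨by rw [hwin]; exact g.rel_le, by rw [hwin]; exact g.le_dl,
          by rw [hwin]; exact g.left, by rw [hwin]; exact g.right, by rw [hwin]; exact g.sync,
          by rw [hwin]; exact g.cap, by rw [hwin]; exact g.capR, by rw [hwin]; exact g.batches⟩
      · rw [waiting, hwin]
        exact (waiting_congr heq).trans g2

/-- An entry is a lower bound for all schedules whose start times are candidate times. -/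
theorem Correct.le_waiting (ht : D.Correct n t) (hp : 0 < D.p)
    (hdl : ∀ i < n, ∀ j < i, D.dl j ≤ D.dl i) :
    ∀ i ≤ n, ∀ l < D.m, ∀ r < D.m, ∀ b ≤ D.B, ∀ c ≤ D.k, ∀ s,
      Partial D.rel D.dl D.p (D.B + 1) i (D.time l) (D.time r) b c s →
      (∀ j ∈ window D.rel i (D.time l) (D.time r), ∃ x < D.m, s j = D.time x) →
      t.cost (D.cell i l r b c) ≤ waiting D.rel i (D.time l) (D.time r) s := by
  intro i
  induction i with
  | zero =>
    intro _ l hl r hr b hb c hc s _ _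
    rw [ht.zero l hl r hr b hb c hc, waiting, window_zero, Finset.sum_empty]
  | succ i ih =>
    intro hi l hl r hr b hb c hc s hs hT
    obtain ⟨e1, e2⟩ := ht.succ i hi l hl r hr b hb c hc
    by_cases hw : D.time l < D.rel i ∧ D.rel i ≤ D.time r
    · have hwin := window_succ hw
      have himem : i ∈ window D.rel (i + 1) (D.time l) (D.time r) := by
        rw [hwin]; exact Finset.mem_insert_self _ _
      obtain ⟨s', g1, g2, g3, g4⟩ := hs.exists_exchanged (hdl i hi) hp.le hw
        (P := fun u => ∃ x < D.m, u = D.time x) hT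
      rw [← g2]
      have hsub : ∀ j ∈ window D.rel i (D.time l) (D.time r),
          ∃ x < D.m, s' j = D.time x := fun j hj => g3 j (by
        rw [hwin]; exact Finset.mem_insert_of_mem hj)
      have hri := g1.rel_le i himem
      have hdi := g1.le_dl i himem
      have hli := g1.left i himem
      rw [waiting_succ hw]
      by_cases hR : s' i = D.time r
      · obtain ⟨b', rfl, g5⟩ := g1.remove_right hw hR
        have := ih (by omega) l hl r hr b' (by omega) c hc s' g5 hsub
        have := (e2 hw).le _ _ _ _ (.inl ⟨b', rfl, by omega, rfl, rfl, rfl, rfl⟩)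
        rw [hR]
        omega
      · have hri' := (g1.right i himem).resolve_left hR
        obtain ⟨c₁, c₂, hc', g5, g6⟩ := g1.cut hp hw hR g4
        obtain ⟨x, hx, hxe⟩ := g3 i himem
        rw [waiting_split (x := s' i) (by omega) (by omega)]
        have hu := window_union (rel := D.rel) (i := i) (by omega : D.time l ≤ s' i)
          (by omega : s' i ≤ D.time r)
        rw [hxe] at g5 g6 hu hli hri hri' hdi ⊢
        have := ih (by omega) l hl x hx D.B le_rfl c₁ (by omega) s' g5 fun j hj =>
          hsub j (by rw [hu]; exact Finset.mem_union_left _ hj)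
        have := ih (by omega) x hx r hr b hb c₂ (by omega) s' g6 fun j hj =>
          hsub j (by rw [hu]; exact Finset.mem_union_right _ hj)
        have := (e2 hw).le _ _ _ _ (.inr ⟨x, hx, c₁, c₂, trivial, hc', hli, hri', hri, hdi,
          rfl, rfl, rfl, rfl⟩)
        omega
    · have hwin := window_succ_of_not hw
      have hsub := window_succ_of_not hw
      rw [(e1 hw).1, waiting, hwin]
      refine ih (by omega) l hl r hr b hb c hc s ?_ (by rwa [hwin] at hT)
      exact ⟨by rw [← hwin]; exact hs.rel_le, by rw [← hwin]; exact hs.le_dl,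
        by rw [← hwin]; exact hs.left, by rw [← hwin]; exact hs.right,
        by rw [← hwin]; exact hs.sync, by rw [← hwin]; exact hs.cap,
        by rw [← hwin]; exact hs.capR, by rw [← hwin]; exact hs.batches⟩

end DP

end BatchScheduling

namespace BatchScheduling

/-! ### Start times of optimal schedules -/

namespace BatchInstance

variable {I : BatchInstance}

theorem exists_isOptimal (h : ∃ s, I.Feasible s) : ∃ s, I.IsOptimal s := by
  obtain ⟨s, hs⟩ := h
  have hnn : ∀ s, I.Feasible s → 0 ≤ I.flowTime s := fun s hs =>
    Finset.sum_nonneg fun j _ => by have := hs.release_le j; omega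
  induction hN : (I.flowTime s).toNat using Nat.strong_induction_on generalizing s with
  | _ N ih =>
    by_cases hopt : ∀ s', I.Feasible s' → I.flowTime s ≤ I.flowTime s'
    · exact ⟨s, hs, hopt⟩
    · push Not at hopt
      obtain ⟨s', h1, h2⟩ := hopt
      have := hnn s' h1
      exact ih _ (by omega) s' h1 rfl

/-- In an optimal schedule no batch can be moved to an earlier time `u` by which all its jobs are
released: another batch is in the way. -/
theorem IsOptimal.exists_blocking {s : Fin I.n → ℤ} (h : I.IsOptimal s) (j : Fin I.n) {u : ℤ}
    (hu : u < s j) (hrel : ∀ i, s i = s j → I.release i ≤ u) :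
    ∃ i, s i ≠ s j ∧ s i - u < I.p ∧ u - s i < I.p := by
  by_contra! hcon
  obtain ⟨hf, hmin⟩ := h
  have hp := I.p_pos
  -- The batch of job `j` moves to `u`, and all others stay.
  set φ : ℤ → ℤ := fun t => if t = s j then u else t with hφ
  have hne : ∀ i, s i ≠ s j → s i ≠ u := fun i hi he => by
    have := hcon i hi; omega
  have hinj : ∀ a b, φ (s a) = φ (s b) ↔ s a = s b := by
    intro a b
    simp only [hφ]
    split_ifs with h1 h2 h2
    · simp [h1, h2]
    · simp only [h1]; exact ⟨fun e => absurd e.symm (hne b h2), fun e => absurd e.symm h2⟩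
    · simp only [h2]; exact ⟨fun e => absurd e (hne a h1), fun e => absurd e h1⟩
    · rfl
  have hle : ∀ i, φ (s i) ≤ s i := fun i => by
    simp only [hφ]; split_ifs with h1
    · omega
    · exact le_rfl
  have hfeas : I.Feasible fun i => φ (s i) := by
    refine ⟨fun i => ?_, fun i => ?_, fun a b => ?_, fun t => ?_, ?_⟩
    · have := hf.release_le i
      simp only [hφ]; split_ifs with h1
      exacts [hrel i h1, this]
    · have := hf.le_deadline i; have := hle i; omega
    · have h1 := hf.synchronous a b
      simp only [hφ]
      split_ifs with ha hb hb
      · omega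
      · intro hlt
        have := hcon b hb
        by_contra hc
        have := this (by omega)
        omega
      · intro hlt
        have := hcon a ha
        by_contra hc
        have := this (by omega)
        omega
      · exact h1
    · by_cases hex : ∃ a, φ (s a) = t
      · obtain ⟨a, rfl⟩ := hex
        simp only [hinj]
        exact hf.capacity (s a)
      · rw [Finset.filter_false_of_mem fun a _ he => hex ⟨a, he⟩]
        simp
    · have : (Finset.univ.image fun i => φ (s i)) = (Finset.univ.image s).image φ := by
        rw [Finset.image_image]; rfl
      rw [this]
      exact Finset.card_image_le.trans hf.budget
  have hlt : I.flowTime (fun i => φ (s i)) < I.flowTime s := by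
    refine Finset.sum_lt_sum (fun i _ => by have := hle i; beta_reduce; omega)
      ⟨j, Finset.mem_univ _, ?_⟩
    simp only [hφ, if_true]
    omega
  exact absurd (hmin _ hfeas) (not_le.mpr hlt)

/-- The batches of an optimal schedule form blocks without idle time, each of which begins at a
release time. -/
theorem IsOptimal.exists_release_add {s : Fin I.n → ℤ} (h : I.IsOptimal s) (j : Fin I.n) :
    ∃ i : Fin I.n, ∃ l < I.n, s j = I.release i + l * I.p := by
  have hp := I.p_pos
  suffices H : ∀ N : ℕ, ∀ j, ((Finset.univ.image s).filter (· < s j)).card = N →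
      ∃ i : Fin I.n, ∃ l ≤ N, s j = I.release i + l * I.p by
    obtain ⟨i, l, hl, he⟩ := H _ j rfl
    refine ⟨i, l, hl.trans_lt ?_, he⟩
    have h1 : (Finset.univ.image s).filter (· < s j) ⊂ Finset.univ.image s := by
      rw [Finset.filter_ssubset]
      exact ⟨s j, by simp, by simp⟩
    have h2 := Finset.card_lt_card h1
    have h3 : (Finset.univ.image s).card ≤ I.n := by
      simpa using Finset.card_image_le (s := (Finset.univ : Finset (Fin I.n))) (f := s)
    omega
  intro N
  induction N using Nat.strong_induction_on with
  | _ N ih =>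
    intro j hN
    by_cases hrel : ∃ i, s i = s j ∧ s j = I.release i
    · obtain ⟨i, -, hi⟩ := hrel
      exact ⟨i, 0, by omega, by simp [hi]⟩
    · push Not at hrel
      obtain ⟨i, h1, h2, h3⟩ := h.exists_blocking j (u := s j - 1) (by omega) fun i hi => by
        have := h.1.release_le i; have := hrel i hi; omega
      have hi : s i + I.p = s j := by
        rcases lt_or_gt_of_ne h1 with hlt | hlt
        · have := h.1.synchronous _ _ hlt; omega
        · have := h.1.synchronous _ _ hlt; omega
      have hlt : ((Finset.univ.image s).filter (· < s i)).card < N := by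
        rw [← hN]
        refine Finset.card_lt_card ⟨fun t ht => ?_, fun hsub => ?_⟩
        · rw [Finset.mem_filter] at ht ⊢
          exact ⟨ht.1, by omega⟩
        · have := hsub (Finset.mem_filter.mpr ⟨Finset.mem_image_of_mem s (Finset.mem_univ i),
            (by omega : s i < s j)⟩)
          simp at this
      obtain ⟨i', l, hl, he⟩ := ih _ hlt i rfl
      exact ⟨i', l + 1, by omega, by rw [← hi, he]; push_cast; ring⟩

/-- Unit jobs: if jobs are parked one by one at the first free time after their release, at the
distinct times `u`, then an optimal schedule starts jobs at parking times only. In a block of busy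
times that ends at `s j`, every batch has a job that is released within the block, so that the block
is full. -/
theorem IsOptimal.mem_range_parking {s : Fin I.n → ℤ} (h : I.IsOptimal s) (hp : I.p = 1)
    {u : Fin I.n → ℤ} (hu : Function.Injective u) (hle : ∀ i, I.release i ≤ u i)
    (hfull : ∀ i t, I.release i ≤ t → t ≤ u i → ∃ i', u i' = t) (j : Fin I.n) :
    ∃ i, u i = s j := by
  have hblock : ∀ j, ∀ t < s j, (∀ i, s i = s j → I.release i ≤ t) → ∃ i, s i = t := by
    intro j t ht hr
    obtain ⟨i, -, h1, h2⟩ := h.exists_blocking j ht hr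
    exact ⟨i, by omega⟩
  -- The block begins at `a`.
  have hblk : ∃ a ≤ s j, (∀ t, a ≤ t → t ≤ s j → ∃ i, s i = t) ∧ ¬ ∃ i, s i = a - 1 := by
    by_contra! hcon
    have hall : ∀ N : ℕ, ∀ t, s j - N ≤ t → t ≤ s j → ∃ i, s i = t := by
      intro N
      induction N with
      | zero => exact fun t h1 h2 => ⟨j, by push_cast at h1; omega⟩
      | succ N ih =>
        intro t h1 h2
        push_cast at h1
        rcases eq_or_ne t (s j - N - 1) with rfl | hne
        · exact hcon (s j - N) (by omega) ih
        · exact ih t (by omega) h2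
    have hcard := Finset.card_le_card (s := Finset.Icc (s j - I.n) (s j))
      (t := Finset.univ.image s) fun t ht => by
        rw [Finset.mem_Icc] at ht
        obtain ⟨i, hi⟩ := hall I.n t ht.1 ht.2
        exact Finset.mem_image.mpr ⟨i, Finset.mem_univ _, hi⟩
    have := Finset.card_image_le (s := (Finset.univ : Finset (Fin I.n))) (f := s)
    simp only [Int.card_Icc, Finset.card_univ, Fintype.card_fin] at *
    omega
  obtain ⟨a, ha, hbusy, hidle⟩ := hblk
  by_contra! hcon
  set J := Finset.univ.filter fun i => a ≤ I.release i ∧ I.release i ≤ s j with hJ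
  have h1 : (Finset.Icc a (s j)).card ≤ (J.image s).card := by
    refine Finset.card_le_card fun t ht => ?_
    rw [Finset.mem_Icc] at ht
    obtain ⟨i, rfl⟩ := hbusy t ht.1 ht.2
    by_contra hno
    refine hidle (hblock i (a - 1) (by omega) fun i' hi' => ?_)
    by_contra hr
    refine hno (Finset.mem_image.mpr ⟨i', ?_, hi'⟩)
    have := h.1.release_le i'
    simp only [hJ, Finset.mem_filter, Finset.mem_univ, true_and]
    omega
  have h2 : (J.image u).card ≤ (Finset.Ico a (s j)).card := by
    refine Finset.card_le_card fun t ht => ?_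
    obtain ⟨i, hi, rfl⟩ := Finset.mem_image.mp ht
    simp only [hJ, Finset.mem_filter, Finset.mem_univ, true_and] at hi
    have := hle i
    rw [Finset.mem_Ico]
    refine ⟨by omega, ?_⟩
    by_contra hge
    obtain ⟨i', hi'⟩ := hfull i (s j) hi.2 (by omega)
    exact hcon i' hi'
  rw [Finset.card_image_of_injective _ hu] at h2
  have h3 := Finset.card_image_le (s := J) (f := s)
  simp only [Int.card_Icc, Int.card_Ico] at h1 h2
  omega

/-! ### Instances in deadline order -/

/-- The recursion solves the instance: `rank` puts the jobs into deadline order, the candidate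
times with indices `0` and `1` lie before and after everything, and the start times of all optimal
schedules are candidates. -/
structure _root_.BatchScheduling.DP.Solves (D : DP) (I : BatchInstance) (rank : Fin I.n → ℕ) :
    Prop where
  inj : Function.Injective rank
  lt : ∀ j, rank j < I.n
  m_pos : 2 ≤ D.m
  B_eq : D.B + 1 = I.B
  k_eq : D.k = I.k
  p_eq : D.p = I.p
  rel_eq : ∀ j, D.rel (rank j) = I.release j
  dl_eq : ∀ j, D.dl (rank j) = I.deadline j
  sorted : ∀ i < I.n, ∀ j < i, D.dl j ≤ D.dl i
  lt_release : ∀ j, D.time 0 + D.p ≤ I.release j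
  deadline_le : ∀ j, I.deadline j ≤ D.time 1
  release_le : ∀ j, I.release j ≤ D.time 1
  span : D.time 0 + D.p ≤ D.time 1
  M_eq : D.M = I.n * (D.time 1 - D.time 0)
  candidate : ∀ s, I.IsOptimal s → ∀ j, ∃ x < D.m, s j = D.time x

/-- The position of the whole problem. -/
def _root_.BatchScheduling.DP.top (D : DP) (n : ℕ) : ℕ := D.cell n 0 1 0 D.k

section

variable {D : DP} {rank : Fin I.n → ℕ} (H : D.Solves I rank)
include H

theorem _root_.BatchScheduling.DP.Solves.window_eq :
    window D.rel I.n (D.time 0) (D.time 1) = Finset.univ.image rank := by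
  have hsub : Finset.univ.image rank ⊆ window D.rel I.n (D.time 0) (D.time 1) := by
    intro q hq
    obtain ⟨j, -, rfl⟩ := Finset.mem_image.mp hq
    have := H.lt_release j
    have := H.release_le j
    have := I.p_pos
    have := H.p_eq
    rw [mem_window, H.rel_eq]
    exact ⟨H.lt j, by omega, by omega⟩
  refine (Finset.eq_of_subset_of_card_le hsub ?_).symm
  rw [Finset.card_image_of_injective _ H.inj]
  exact (Finset.card_filter_le _ _).trans (by simp)

/-- A schedule is feasible if and only if it solves the whole problem of the recursion. -/
theorem _root_.BatchScheduling.DP.Solves.feasible_iff (s : ℕ → ℤ) :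
    I.Feasible (fun j => s (rank j)) ↔
      Partial D.rel D.dl D.p (D.B + 1) I.n (D.time 0) (D.time 1) 0 D.k s := by
  have hw := H.window_eq
  have hall : ∀ P : ℕ → Prop,
      (∀ q ∈ window D.rel I.n (D.time 0) (D.time 1), P q) ↔ ∀ j, P (rank j) := by
    intro P; rw [hw]; simp
  have hcard : ∀ t, ((window D.rel I.n (D.time 0) (D.time 1)).filter fun q => s q = t).card =
      (Finset.univ.filter fun j => s (rank j) = t).card := by
    intro t
    rw [hw, Finset.filter_image, Finset.card_image_of_injective _ H.inj]
  have himage : (window D.rel I.n (D.time 0) (D.time 1)).image s =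
      Finset.univ.image fun j => s (rank j) := by
    rw [hw, Finset.image_image]; rfl
  have hp := I.p_pos
  have hpe := H.p_eq
  constructor
  · rintro ⟨h1, h2, h3, h4, h5⟩
    have hR : ∀ j, s (rank j) + D.p ≤ D.time 1 := fun j => by
      have := h2 j; have := H.deadline_le j; omega
    refine ⟨?_, ?_, ?_, ?_, ?_, ?_, ?_, ?_⟩
    · rw [hall]; exact fun j => (H.rel_eq j).trans_le (h1 j)
    · rw [hall]; intro j; rw [H.dl_eq, H.p_eq]; exact h2 j
    · rw [hall]; intro j; have := h1 j; have := H.lt_release j; omega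
    · rw [hall]; exact fun j => .inr (hR j)
    · rw [hall]; intro j; rw [hall]; intro j'; rw [H.p_eq]; exact h3 j j'
    · intro t; rw [hcard, H.B_eq]; exact h4 t
    · rw [hcard, Finset.filter_false_of_mem fun j _ => by have := hR j; omega]; simp
    · rw [himage, H.k_eq]; exact (Finset.card_le_card (Finset.erase_subset _ _)).trans h5
  · intro h
    have hR : ∀ j, s (rank j) ≠ D.time 1 := by
      intro j he
      have := h.capR
      rw [hcard, Nat.le_zero, Finset.card_eq_zero, Finset.filter_eq_empty_iff] at this
      exact this (Finset.mem_univ j) he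
    refine ⟨fun j => ?_, fun j => ?_, fun i j => ?_, fun t => ?_, ?_⟩
    · rw [← H.rel_eq]; exact (hall _).mp h.rel_le j
    · rw [← H.dl_eq, ← H.p_eq]; exact (hall _).mp h.le_dl j
    · rw [← H.p_eq]; exact (hall _).mp ((hall _).mp h.sync i) j
    · rw [← hcard, ← H.B_eq]; exact h.cap t
    · rw [← himage, ← H.k_eq]
      have := h.batches
      rwa [Finset.erase_eq_of_notMem] at this
      rw [himage]
      simpa using hR

theorem _root_.BatchScheduling.DP.Solves.waiting_eq (s : ℕ → ℤ) :
    waiting D.rel I.n (D.time 0) (D.time 1) s =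
      I.flowTime (fun j => s (rank j)) - I.n * I.p := by
  rw [waiting, H.window_eq, Finset.sum_image H.inj.injOn, flowTime]
  simp only [H.rel_eq, Finset.sum_sub_distrib, Finset.sum_add_distrib, Finset.sum_const,
    Finset.card_univ, Fintype.card_fin, nsmul_eq_mul]
  ring

/-- A correct table decides the instance and gives an optimal schedule. -/
theorem _root_.BatchScheduling.DP.Solves.correct {t : DP.Table} (ht : D.Correct I.n t) :
    (D.M ≤ t.cost (D.top I.n) → ¬ ∃ s, I.Feasible s) ∧
    (t.cost (D.top I.n) < D.M →
      I.IsOptimal fun j => D.schedule t I.n (D.top I.n) (rank j)) := by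
  have hp : 0 < D.p := by rw [H.p_eq]; exact_mod_cast I.p_pos
  have hm := H.m_pos
  have hn : (0 : ℤ) < I.n := by exact_mod_cast I.n_pos
  have hM : 0 ≤ D.M := by
    rw [H.M_eq]
    have := H.span
    exact mul_nonneg (by omega) (by omega)
  have key : ∀ s, I.IsOptimal s →
      t.cost (D.top I.n) ≤ I.flowTime s - I.n * I.p ∧ I.flowTime s - I.n * I.p < D.M := by
    intro s hs
    obtain ⟨s', rfl⟩ : ∃ s' : ℕ → ℤ, s = fun j => s' (rank j) :=
      ⟨Function.extend rank s 0, funext fun j => (H.inj.extend_apply s 0 j).symm⟩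
    have hpar := (H.feasible_iff s').mp hs.1
    constructor
    · rw [← H.waiting_eq]
      refine ht.le_waiting hp H.sorted I.n le_rfl 0 (by omega) 1 (by omega) 0 (by omega) D.k le_rfl
        s' hpar fun q hq => ?_
      rw [H.window_eq] at hq
      obtain ⟨j, -, rfl⟩ := Finset.mem_image.mp hq
      exact H.candidate _ hs j
    · have : I.flowTime (fun j => s' (rank j)) - I.n * I.p =
          ∑ j, (s' (rank j) - I.release j) := by
        simp only [flowTime, Finset.sum_sub_distrib, Finset.sum_add_distrib, Finset.sum_const,
          Finset.card_univ, Fintype.card_fin, nsmul_eq_mul]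
        ring
      rw [this, H.M_eq]
      have hlt : ∀ j ∈ (Finset.univ : Finset (Fin I.n)),
          s' (rank j) - I.release j < D.time 1 - D.time 0 := fun j _ => by
        have := hs.1.le_deadline j
        have := H.deadline_le j
        have := H.lt_release j
        omega
      have := Finset.sum_lt_sum_of_nonempty ⟨⟨0, I.n_pos⟩, Finset.mem_univ _⟩ hlt
      simpa [mul_sub] using this
  constructor
  · intro hle hex
    obtain ⟨s, hs⟩ := exists_isOptimal hex
    have := key s hs
    omega
  · intro hlt
    obtain ⟨h1, h2⟩ := ht.sound hM hp I.n le_rfl 0 (by omega) 1 (by omega) 0 (by omega) D.k le_rfl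
      H.span hlt
    rw [H.waiting_eq] at h2
    have hfeas := (H.feasible_iff _).mpr h1
    refine ⟨hfeas, fun s' hs' => ?_⟩
    obtain ⟨s, hs⟩ := exists_isOptimal ⟨s', hs'⟩
    have := (key s hs).1
    have := hs.2 s' hs'
    simp only [DP.top] at *
    omega

end

end BatchInstance

end BatchScheduling

namespace BatchScheduling

/-! ### The program -/

/- Expressions are written in arithmetic notation. -/
instance : Add Expr := ⟨.add⟩
instance : Sub Expr := ⟨.sub⟩
instance : Mul Expr := ⟨.mul⟩
instance (z : ℕ) : OfNat Expr z := ⟨.const (OfNat.ofNat z)⟩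

theorem Expr.val_sub (σ : State) (a b : Expr) : (a - b).val σ = a.val σ - b.val σ := rfl
theorem Expr.safe_sub (S : ℕ) (σ : State) (a b : Expr) :
    (a - b).Safe S σ ↔ a.Safe S σ ∧ b.Safe S σ := Iff.rfl

infixr:35 " ;; " => Cmd.seq
infix:50 " ≔ " => Cmd.assign
infix:60 " ≼ " => Expr.le
notation "𝐫" => Expr.reg
notation "𝐦" => Expr.load

/- Registers `0` to `11` are set once. They hold the numbers of the instance, the number `m` of
candidate times, the addresses of the arrays of release times and deadlines in deadline order, of
ranks, of candidate times and of the table, and the bounds `A` and `M`. -/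
notation "vn" => 0
notation "vk" => 1
notation "vB" => 2
notation "vp" => 3
notation "vm" => 4
notation "vrel" => 5
notation "vdl" => 6
notation "vrank" => 7
notation "vtime" => 8
notation "vtab" => 9
notation "vA" => 10
notation "vM" => 11
/- Registers `12` to `22` describe the current subproblem: the coordinates of the subproblem
without its last job, the positions of both in the table, the times at both ends, and the last
job. -/
notation "vi" => 12
notation "vl" => 13
notation "vr" => 14
notation "vb" => 15
notation "vc" => 16
notation "vq0" => 17
notation "vq" => 18
notation "vL" => 19
notation "vR" => 20
notation "vri" => 21
notation "vdi" => 22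
/- The best choice found so far and the choice under consideration. -/
notation "vbest" => 23
notation "vstart" => 24
notation "vleft" => 25
notation "vright" => 26
notation "vx" => 27
notation "vc1" => 28
notation "vql" => 29
notation "vqr" => 30
notation "vv" => 31
notation "vtx" => 32
/- The current job, its place in deadline order, and its sort key. -/
notation "vj" => 33
notation "vpos" => 34
notation "vkey" => 35

/-- Keep the choice under consideration, which starts the job at `s`, if it is better. -/
def improve (s : Expr) : Cmd :=
  .ite (𝐫 vv + 1 ≼ 𝐫 vbest)
    (vbest ≔ 𝐫 vv ;; vstart ≔ s ;; vleft ≔ 𝐫 vql ;; vright ≔ 𝐫 vqr) .skip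

/-- Consider the batch at candidate time `x` with `c₁` batches before it. -/
def trySplit : Cmd :=
  vql ≔ (((𝐫 vi * 𝐫 vm + 𝐫 vl) * 𝐫 vm + 𝐫 vx) * 𝐫 vB + (𝐫 vB - 1)) * (𝐫 vk + 1) + 𝐫 vc1 ;;
  vqr ≔ (((𝐫 vi * 𝐫 vm + 𝐫 vx) * 𝐫 vm + 𝐫 vr) * 𝐫 vB + 𝐫 vb) * (𝐫 vk + 1) +
    (𝐫 vc - 1 - 𝐫 vc1) ;;
  vv ≔ 𝐦 (𝐫 vtab + 4 * 𝐫 vql) + 𝐦 (𝐫 vtab + 4 * 𝐫 vqr) + (𝐫 vtx - 𝐫 vri) ;;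
  improve (𝐫 vtx) ;;
  vc1 ≔ 𝐫 vc1 + 1

/-- Consider all divisions of the budget for the candidate time `x`. -/
def trySplits : Cmd := .loop (𝐫 vc1 + 1 ≼ 𝐫 vc) trySplit

/-- Consider the candidate time `x`, provided that job `i` and a batch at the right end allow it. -/
def tryTime : Cmd :=
  (vtx ≔ 𝐦 (𝐫 vtime + 𝐫 vx) ;; vc1 ≔ 0) ;;
  .ite ((𝐫 vL + 𝐫 vp ≼ 𝐫 vtx) * (𝐫 vtx + 𝐫 vp ≼ 𝐫 vR) * (𝐫 vri ≼ 𝐫 vtx) *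
    (𝐫 vtx + 𝐫 vp ≼ 𝐫 vdi)) trySplits .skip ;;
  vx ≔ 𝐫 vx + 1

/-- Consider all candidate times. -/
def tryTimes : Cmd := .loop (𝐫 vx + 1 ≼ 𝐫 vm) tryTime

/-- Consider joining the batch at the right end. -/
def tryRight : Cmd :=
  vbest ≔ 𝐫 vM ;; vstart ≔ 0 ;; vleft ≔ 0 ;; vright ≔ 0 ;; vx ≔ 0 ;;
  .ite ((1 ≼ 𝐫 vb) * (𝐫 vR + 𝐫 vp ≼ 𝐫 vdi))
    (vql ≔ 𝐫 vq0 - (𝐫 vk + 1) ;; vqr ≔ 𝐫 vql ;;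
      vv ≔ 𝐦 (𝐫 vtab + 4 * 𝐫 vql) + (𝐫 vR - 𝐫 vri) ;; improve (𝐫 vR)) .skip

/-- Compute the positions of the subproblem without and with job `i`, and load its data. -/
def locate : Cmd :=
  vq0 ≔ (((𝐫 vi * 𝐫 vm + 𝐫 vl) * 𝐫 vm + 𝐫 vr) * 𝐫 vB + 𝐫 vb) * (𝐫 vk + 1) + 𝐫 vc ;;
  vq ≔ 𝐫 vq0 + 𝐫 vm * 𝐫 vm * 𝐫 vB * (𝐫 vk + 1) ;;
  vL ≔ 𝐦 (𝐫 vtime + 𝐫 vl) ;;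
  vR ≔ 𝐦 (𝐫 vtime + 𝐫 vr) ;;
  vri ≔ 𝐦 (𝐫 vrel + 𝐫 vi) ;;
  vdi ≔ 𝐦 (𝐫 vdl + 𝐫 vi)

/-- The subproblem does not contain job `i`: take over the value of the one without it. -/
def copyEntry : Cmd :=
  vbest ≔ 𝐦 (𝐫 vtab + 4 * 𝐫 vq0) ;; vstart ≔ 0 ;; vleft ≔ 𝐫 vq0 ;; vright ≔ 𝐫 vq0

/-- Write the four words of the entry: value, start time, and the two references. -/
def storeEntry : Cmd :=
  .store (𝐫 vtab + 4 * 𝐫 vq) (𝐫 vbest) ;;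
  .store (𝐫 vtab + 4 * 𝐫 vq + 1) (𝐫 vstart) ;;
  .store (𝐫 vtab + 4 * 𝐫 vq + 2) (𝐫 vleft) ;;
  .store (𝐫 vtab + 4 * 𝐫 vq + 3) (𝐫 vright)

/-- Go on to the next subproblem in the order of the table. -/
def advance : Cmd :=
  vc ≔ 𝐫 vc + 1 ;;
  .ite (𝐫 vk + 1 ≼ 𝐫 vc)
    (vc ≔ 0 ;; vb ≔ 𝐫 vb + 1 ;;
    .ite (𝐫 vB ≼ 𝐫 vb)
      (vb ≔ 0 ;; vr ≔ 𝐫 vr + 1 ;;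
      .ite (𝐫 vm ≼ 𝐫 vr)
        (vr ≔ 0 ;; vl ≔ 𝐫 vl + 1 ;;
        .ite (𝐫 vm ≼ 𝐫 vl) (vl ≔ 0 ;; vi ≔ 𝐫 vi + 1) .skip)
      .skip)
    .skip)
  .skip

/-- Compute the entry of the current subproblem and go on to the next one. -/
def fillEntry : Cmd :=
  locate ;;
  .ite ((𝐫 vL + 1 ≼ 𝐫 vri) * (𝐫 vri ≼ 𝐫 vR)) (tryRight ;; tryTimes) copyEntry ;;
  storeEntry ;; advance

/-- Compute all entries. Those for no jobs are `0` from the beginning. -/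
def fillTable : Cmd :=
  (vi ≔ 0 ;; vl ≔ 0 ;; vr ≔ 0 ;; vb ≔ 0 ;; vc ≔ 0) ;; .loop (𝐫 vi + 1 ≼ 𝐫 vn) fillEntry

/-! ### Computing one entry of the table -/

/-- The bounds on the memory and on the numbers in it that the program needs, with `m` candidate
times that lie between `-A` and `A`, up to a factor `n + 1`. -/
structure Room (I : BatchInstance) (m : ℕ) (A : ℤ) (S V : ℕ) : Prop where
  m_pos : 2 ≤ m
  S_le : S ≤ V
  le_V : 16 ≤ V
  k_lt : I.k + I.B + 1 ≤ V
  p_le : I.p ≤ A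
  table : 4 + 5 * I.n + m + 4 * ((((I.n + 1) * m) * m * I.B) * (I.k + 1)) ≤ S
  values : 8 * ((I.n + 1) * A) + 8 ≤ V

/-- The contents of the registers that are set once. -/
structure Consts (I : BatchInstance) (m : ℕ) (A : ℤ) (σ : State) : Prop where
  n_eq : σ.reg vn = I.n
  k_eq : σ.reg vk = I.k
  B_eq : σ.reg vB = I.B
  p_eq : σ.reg vp = I.p
  m_eq : σ.reg vm = m
  rel_eq : σ.reg vrel = 4 + 2 * I.n
  dl_eq : σ.reg vdl = 4 + 3 * I.n
  rank_eq : σ.reg vrank = 4 + 4 * I.n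
  time_eq : σ.reg vtime = 4 + 5 * I.n
  tab_eq : σ.reg vtab = 4 + 5 * I.n + m
  A_eq : σ.reg vA = A
  M_eq : σ.reg vM = I.n * (A + A)

theorem Consts.set {I : BatchInstance} {m : ℕ} {A : ℤ} {σ : State} (h : Consts I m A σ) {x : ℕ}
    (hx : 12 ≤ x) (v : ℤ) : Consts I m A (σ.set x v) := by
  have : ∀ y, y < 12 → (σ.set x v).reg y = σ.reg y := fun y hy => by
    rw [State.set_reg, if_neg (by omega)]
  constructor <;> rw [this _ (by norm_num)]
  exacts [h.n_eq, h.k_eq, h.B_eq, h.p_eq, h.m_eq, h.rel_eq, h.dl_eq, h.rank_eq, h.time_eq,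
    h.tab_eq, h.A_eq, h.M_eq]

/-- The data of the recursion in memory; entries outside the arrays are `0`. -/
def dataOf (I : BatchInstance) (m : ℕ) (A : ℤ) (μ : ℕ → ℤ) : DP where
  m := m
  B := I.B - 1
  k := I.k
  p := I.p
  M := I.n * (A + A)
  rel q := if q < I.n then μ (4 + 2 * I.n + q) else 0
  dl q := if q < I.n then μ (4 + 3 * I.n + q) else 0
  time x := if x < m then μ (4 + 5 * I.n + x) else 0

/-- The table in memory. -/
def tableOf (I : BatchInstance) (m : ℕ) (μ : ℕ → ℤ) : DP.Table where
  cost a := μ (4 + 5 * I.n + m + 4 * a)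
  start a := μ (4 + 5 * I.n + m + 4 * a + 1)
  left a := μ (4 + 5 * I.n + m + 4 * a + 2)
  right a := μ (4 + 5 * I.n + m + 4 * a + 3)

namespace DP

variable {D : DP} {cost : ℕ → ℤ} {X X' : ℕ → ℕ → Prop} {i l r b c : ℕ}

theorem Choice.mono (hX : ∀ x c₁, c₁ < c → X x c₁ → X' x c₁) {v s ql qr : ℤ}
    (h : D.Choice cost X i l r b c v s ql qr) : D.Choice cost X' i l r b c v s ql qr := by
  rcases h with h | ⟨x, hx, c₁, c₂, h, hc, h'⟩
  exacts [.inl h, .inr ⟨x, hx, c₁, c₂, hX _ _ (by omega) h, hc, h'⟩]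

theorem Best.mono {v s ql qr : ℤ} (h : D.Best cost X i l r b c v s ql qr)
    (hX : ∀ x c₁, c₁ < c → X x c₁ → X' x c₁) (hX' : ∀ x c₁, c₁ < c → X' x c₁ → X x c₁) :
    D.Best cost X' i l r b c v s ql qr :=
  ⟨h.le_M, fun _ _ _ _ h' => h.le _ _ _ _ (h'.mono hX'), h.attained.imp_right fun h' => h'.mono hX⟩

/-- Considering one more choice of value `v'`. -/
theorem Best.step {v s ql qr v' s' ql' qr' : ℤ} (h : D.Best cost X i l r b c v s ql qr)
    (hX : ∀ x c₁, c₁ < c → X x c₁ → X' x c₁)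
    (hnew : ∀ w t a a', D.Choice cost X' i l r b c w t a a' →
      D.Choice cost X i l r b c w t a a' ∨ w = v')
    (hc : D.Choice cost X' i l r b c v' s' ql' qr') :
    (v' + 1 ≤ v → D.Best cost X' i l r b c v' s' ql' qr') ∧
    (v < v' + 1 → D.Best cost X' i l r b c v s ql qr) := by
  constructor
  · intro hlt
    refine ⟨by have := h.le_M; omega, fun w t a a' hw => ?_, .inr hc⟩
    rcases hnew w t a a' hw with hw | rfl
    · have := h.le _ _ _ _ hw
      omega
    · exact le_rfl
  · intro hle
    refine ⟨h.le_M, fun w t a a' hw => ?_, h.attained.imp_right fun h' => h'.mono hX⟩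
    rcases hnew w t a a' hw with hw | rfl
    · exact h.le _ _ _ _ hw
    · omega

/-- The number of table entries for each number of jobs. -/
def layer (D : DP) : ℕ := D.m * D.m * (D.B + 1) * (D.k + 1)

theorem cell_succ (D : DP) (i l r b c : ℕ) :
    D.cell (i + 1) l r b c = D.cell i l r b c + D.layer := by
  simp only [cell, layer]; ring

theorem cell_eq (D : DP) (i l r b c : ℕ) :
    D.cell i l r b c = i * D.layer + D.cell 0 l r b c := by
  simp only [cell, layer]; ring

theorem cell_zero_lt (hl : l < D.m) (hr : r < D.m) (hb : b ≤ D.B) (hc : c ≤ D.k) :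
    D.cell 0 l r b c < D.layer := by
  have key : ∀ x X y Y : ℕ, x < X → y < Y → x * Y + y < X * Y := fun x X y Y hx hy => by
    calc x * Y + y < x * Y + Y := by omega
      _ = (x + 1) * Y := by ring
      _ ≤ X * Y := Nat.mul_le_mul_right _ hx
  have h1 := key _ _ _ _ hl hr
  have h2 := key _ _ _ _ h1 (Nat.lt_succ_of_le hb)
  have h3 := key _ _ _ _ h2 (Nat.lt_succ_of_le hc)
  simpa [cell, layer] using h3

theorem cell_lt (hl : l < D.m) (hr : r < D.m) (hb : b ≤ D.B) (hc : c ≤ D.k) :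
    D.cell i l r b c < (i + 1) * D.layer := by
  rw [cell_eq, add_mul, one_mul]
  exact Nat.add_lt_add_left (cell_zero_lt hl hr hb hc) _

theorem cell_injective {i' l' r' b' c' : ℕ} (hl : l < D.m) (hr : r < D.m) (hb : b ≤ D.B)
    (hc : c ≤ D.k) (hl' : l' < D.m) (hr' : r' < D.m) (hb' : b' ≤ D.B) (hc' : c' ≤ D.k)
    (h : D.cell i l r b c = D.cell i' l' r' b' c') :
    i = i' ∧ l = l' ∧ r = r' ∧ b = b' ∧ c = c' := by
  have key : ∀ {x x' y y' Y : ℕ}, y < Y → y' < Y → x * Y + y = x' * Y + y' →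
      x = x' ∧ y = y' := by
    intro x x' y y' Y hy hy' h
    have h1 : (x * Y + y) % Y = (x' * Y + y') % Y := by rw [h]
    rw [Nat.mul_add_mod_of_lt hy, Nat.mul_add_mod_of_lt hy'] at h1
    subst h1
    exact ⟨Nat.eq_of_mul_eq_mul_right (by omega) (Nat.add_right_cancel h), rfl⟩
  obtain ⟨h1, rfl⟩ := key (Nat.lt_succ_of_le hc) (Nat.lt_succ_of_le hc') h
  obtain ⟨h2, rfl⟩ := key (Nat.lt_succ_of_le hb) (Nat.lt_succ_of_le hb') h1
  obtain ⟨h3, rfl⟩ := key hr hr' h2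
  obtain ⟨h4, rfl⟩ := key hl hl' h3
  exact ⟨h4, rfl, rfl, rfl, rfl⟩

end DP

end BatchScheduling

namespace BatchScheduling

/-- The state while the choices for the last job of a subproblem are examined. -/
structure AtEntry (I : BatchInstance) (m : ℕ) (A : ℤ) (μ : ℕ → ℤ) (i l r b c : ℕ) (σ : State) :
    Prop where
  consts : Consts I m A σ
  mem_eq : σ.mem = μ
  i_eq : σ.reg vi = i
  l_eq : σ.reg vl = l
  r_eq : σ.reg vr = r
  b_eq : σ.reg vb = b
  c_eq : σ.reg vc = c
  q0_eq : σ.reg vq0 = (dataOf I m A μ).cell i l r b c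
  q_eq : σ.reg vq = (dataOf I m A μ).cell (i + 1) l r b c
  L_eq : σ.reg vL = (dataOf I m A μ).time l
  R_eq : σ.reg vR = (dataOf I m A μ).time r
  ri_eq : σ.reg vri = (dataOf I m A μ).rel i
  di_eq : σ.reg vdi = (dataOf I m A μ).dl i

theorem AtEntry.set {I : BatchInstance} {m : ℕ} {A : ℤ} {μ : ℕ → ℤ} {i l r b c : ℕ} {σ : State}
    (h : AtEntry I m A μ i l r b c σ) {x : ℕ} (hx : 23 ≤ x) (v : ℤ) :
    AtEntry I m A μ i l r b c (σ.set x v) := by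
  have : ∀ y, y < 23 → (σ.set x v).reg y = σ.reg y := fun y hy => by
    rw [State.set_reg, if_neg (by omega)]
  constructor
  · exact h.consts.set (by omega) v
  · exact h.mem_eq
  all_goals rw [this _ (by norm_num)]
  exacts [h.i_eq, h.l_eq, h.r_eq, h.b_eq, h.c_eq, h.q0_eq, h.q_eq, h.L_eq, h.R_eq, h.ri_eq, h.di_eq]

/-- The subproblem with coordinates `i`, `l`, `r`, `b`, `c`, to which job `i` is to be added, the
table being filled for the first `i` jobs. -/
structure Filled (I : BatchInstance) (m : ℕ) (A : ℤ) (S V : ℕ) (μ : ℕ → ℤ) (i l r b c : ℕ) :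
    Prop where
  room : Room I m A S V
  i_lt : i < I.n
  l_lt : l < m
  r_lt : r < m
  b_lt : b < I.B
  c_le : c ≤ I.k
  time_le : ∀ x < m, |(dataOf I m A μ).time x| ≤ (I.n + 1) * A
  rel_le : ∀ q < I.n, |(dataOf I m A μ).rel q| ≤ A
  cost_nonneg : ∀ a < (i + 1) * (dataOf I m A μ).layer, 0 ≤ (tableOf I m μ).cost a
  cost_le : ∀ a < (i + 1) * (dataOf I m A μ).layer, (tableOf I m μ).cost a ≤ I.n * (A + A)

variable {I : BatchInstance} {m : ℕ} {A : ℤ} {S V : ℕ} {μ : ℕ → ℤ} {i l r b c : ℕ} {σ : State}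

theorem Room.cell_lt (h : Room I m A S V) {i l r b c : ℕ} (hi : i ≤ I.n) (hl : l < m) (hr : r < m)
    (hb : b < I.B) (hc : c ≤ I.k) :
    4 + 5 * I.n + m + 4 * (dataOf I m A μ).cell i l r b c + 3 < S := by
  have h1 : (dataOf I m A μ).cell i l r b c < (i + 1) * (dataOf I m A μ).layer :=
    DP.cell_lt hl hr (by simp only [dataOf]; omega) hc
  have h2 : (i + 1) * (dataOf I m A μ).layer ≤ ((((I.n + 1) * m) * m * I.B) * (I.k + 1)) := by
    have : I.B - 1 + 1 = I.B := by have := I.B_pos; omega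
    simp only [DP.layer, dataOf, this]
    calc (i + 1) * (m * m * I.B * (I.k + 1)) ≤ (I.n + 1) * (m * m * I.B * (I.k + 1)) :=
          Nat.mul_le_mul_right _ (by omega)
      _ = _ := by ring
  have := h.table
  omega

/-- The pairs `(x, c₁)` that have been considered before the pair `(x₀, q)`. -/
def Before (x₀ q : ℕ) (x c₁ : ℕ) : Prop := x < x₀ ∨ x = x₀ ∧ c₁ < q

/-- Invariant of the loop over the possible starts of the last job: `Best` holds for the pairs
considered so far. -/
structure Searching (I : BatchInstance) (m : ℕ) (A : ℤ) (μ : ℕ → ℤ) (i l r b c x₀ q : ℕ)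
    (σ : State) : Prop where
  at_entry : AtEntry I m A μ i l r b c σ
  best : (dataOf I m A μ).Best (tableOf I m μ).cost (Before x₀ q) i l r b c
    (σ.reg vbest) (σ.reg vstart) (σ.reg vleft) (σ.reg vright)
  x_eq : σ.reg vx = x₀

theorem cell_cast (I : BatchInstance) (m : ℕ) (A : ℤ) (μ : ℕ → ℤ) (i l r b c : ℕ) :
    (((((i : ℤ) * m + l) * m + r) * I.B + b) * (I.k + 1) + c) =
      (dataOf I m A μ).cell i l r b c := by
  have hB : ((I.B - 1 : ℕ) : ℤ) = I.B - 1 := by have := I.B_pos; omega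
  simp only [DP.cell, dataOf]
  push_cast [hB]
  ring

theorem load_cost (I : BatchInstance) (m : ℕ) (μ : ℕ → ℤ) (a : ℕ) :
    μ (4 + 5 * (I.n : ℤ) + m + 4 * a).toNat = (tableOf I m μ).cost a := by
  simp only [tableOf]
  congr 1

theorem Room.bounds (h : Room I m A S V) : 0 ≤ A ∧ I.n * (A + A) = 2 * (I.n * A) ∧
    (I.n + 1) * A = I.n * A + A ∧ 0 ≤ I.n * A ∧ 8 * (I.n * A) + 8 * A + 8 ≤ V := by
  have hA : 0 ≤ A := by have := h.p_le; omega
  have := h.values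
  exact ⟨hA, by ring, by ring, by positivity, by linarith⟩

/-- A value of a choice fits into a word. -/
theorem Filled.value_le (hf : Filled I m A S V μ i l r b c) {x a₁ a₂ : ℕ} (hx : x < m)
    (h₁ : a₁ < (i + 1) * (dataOf I m A μ).layer) (h₂ : a₂ < (i + 1) * (dataOf I m A μ).layer) :
    |(tableOf I m μ).cost a₁ + (tableOf I m μ).cost a₂ +
      ((dataOf I m A μ).time x - (dataOf I m A μ).rel i)| ≤ (V : ℤ) ∧
    |(tableOf I m μ).cost a₁ + ((dataOf I m A μ).time x - (dataOf I m A μ).rel i)| ≤ (V : ℤ) ∧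
    |(dataOf I m A μ).time x| ≤ (V : ℤ) ∧ |(tableOf I m μ).cost a₁| ≤ (V : ℤ) := by
  obtain ⟨b1, b2, b3, b4, b5⟩ := hf.room.bounds
  have t1 := hf.time_le x hx
  have t2 := hf.rel_le i hf.i_lt
  have t3 := hf.cost_nonneg a₁ h₁
  have t4 := hf.cost_nonneg a₂ h₂
  have t5 := hf.cost_le a₁ h₁
  have t6 := hf.cost_le a₂ h₂
  rw [b2] at t5 t6
  rw [b3] at t1
  rw [abs_le] at t1 t2
  simp only [abs_le]
  generalize (I.n : ℤ) * A = N at *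
  refine ⟨⟨?_, ?_⟩, ⟨?_, ?_⟩, ⟨?_, ?_⟩, ?_, ?_⟩ <;> linarith

theorem runs_trySplit (hf : Filled I m A S V μ i l r b c) {x q : ℕ} (hx : x < m) (hq : q < c)
    (h : Searching I m A μ i l r b c x q σ) (htx : σ.reg vtx = (dataOf I m A μ).time x)
    (hc1 : σ.reg vc1 = q)
    (h1 : (dataOf I m A μ).time l + I.p ≤ (dataOf I m A μ).time x)
    (h2 : (dataOf I m A μ).time x + I.p ≤ (dataOf I m A μ).time r)
    (h3 : (dataOf I m A μ).rel i ≤ (dataOf I m A μ).time x)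
    (h4 : (dataOf I m A μ).time x + I.p ≤ (dataOf I m A μ).dl i) :
    Runs S V trySplit σ trySplit.steps fun σ' => Searching I m A μ i l r b c x (q + 1) σ' ∧
      σ'.reg vtx = (dataOf I m A μ).time x ∧ σ'.reg vc1 = (q + 1 : ℕ) := by
  obtain ⟨hat, hbest, hx'⟩ := h
  obtain ⟨c₂, rfl⟩ : ∃ c₂, c = q + c₂ + 1 := ⟨c - q - 1, by omega⟩
  have hBp := I.B_pos
  have hB : ((I.B - 1 : ℕ) : ℤ) = I.B - 1 := by omega
  have hi := hf.i_lt
  have hkc := hf.c_le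
  have e1 := cell_cast I m A μ i l x (I.B - 1) q
  have e2 := cell_cast I m A μ i x r b c₂
  rw [hB] at e1
  have l1 := hf.room.cell_lt (μ := μ) hf.i_lt.le hf.l_lt hx (b := I.B - 1) (by omega)
    (c := q) (by omega)
  have l2 := hf.room.cell_lt (μ := μ) hf.i_lt.le hx hf.r_lt hf.b_lt (c := c₂) (by omega)
  have l3 := DP.cell_lt (D := dataOf I m A μ) (i := i) hf.l_lt hx (b := I.B - 1) le_rfl
    (c := q) (by simp only [dataOf]; omega)
  have l4 := DP.cell_lt (D := dataOf I m A μ) (i := i) hx hf.r_lt (b := b)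
    (by have := hf.b_lt; simp only [dataOf]; omega) (c := c₂) (by simp only [dataOf]; omega)
  -- The only pair considered here is `(x, q)`.
  have step := hbest.step (X' := Before x (q + 1)) (fun x' c' _ hX => by
      rcases hX with hX | hX
      exacts [.inl hX, .inr ⟨hX.1, by omega⟩])
    (v' := (tableOf I m μ).cost ((dataOf I m A μ).cell i l x (I.B - 1) q) +
      (tableOf I m μ).cost ((dataOf I m A μ).cell i x r b c₂) +
        ((dataOf I m A μ).time x - (dataOf I m A μ).rel i))
    (fun w t a a' hw => by
      rcases hw with hw | ⟨x', hx', c₁', c₂', hX, hcc, hrest⟩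
      · exact .inl (.inl hw)
      · by_cases hnew : x' = x ∧ c₁' = q
        · obtain ⟨rfl, rfl⟩ := hnew
          obtain rfl : c₂' = c₂ := by omega
          obtain ⟨-, -, -, -, hs, -, -, hv⟩ := hrest
          exact .inr (by rw [hv, hs]; rfl)
        · refine .inl (.inr ⟨x', hx', c₁', c₂', ?_, hcc, hrest⟩)
          rcases hX with hX | hX
          exacts [.inl hX, .inr ⟨hX.1, by omega⟩])
    (.inr ⟨x, hx, q, c₂, .inr ⟨rfl, by omega⟩, rfl, h1, h2, h3, h4, rfl, rfl, rfl, rfl⟩)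
  obtain ⟨g1, g2, g3, -⟩ := hf.value_le hx l3 l4
  have hS := hf.room.S_le
  have hc := hat.consts
  refine Runs.of_wp hf.room.le_V rfl ?_
  have e3 : ((q + c₂ : ℕ) : ℤ) + 1 - 1 - q = c₂ := by omega
  simp only [trySplit, improve, Cmd.wp, Expr.val, Expr.Safe, Expr.val_sub, Expr.safe_sub,
    State.set_reg, State.set_mem, Nat.reduceEqDiff, if_true, if_false,
    hc.k_eq, hc.B_eq, hc.m_eq, hat.i_eq, hat.l_eq, hat.r_eq, hat.b_eq, hat.c_eq, hx', hc1, e1, e2,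
    e3, htx, hat.mem_eq, hc.tab_eq, hat.ri_eq, load_cost, true_and, and_true, ne_eq,
    ite_eq_right_iff, one_ne_zero, imp_false, not_le, not_lt, Nat.cast_succ, Nat.abs_cast]
  have f1 : |(q : ℤ) + 1| ≤ V := by have := hf.room.k_lt; rw [abs_le]; omega
  refine ⟨by omega, by omega, by omega, g1, fun hlt => ⟨g1, g3, by omega, by omega, f1, ?_⟩,
    fun hle => ⟨f1, ?_⟩⟩
  · refine ⟨?_, by
      simp only [State.set_reg, Nat.reduceEqDiff, if_true, if_false]; exact step.1 hlt,
        by simpa using hx'⟩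
    repeat' first | exact hat | refine AtEntry.set ?_ (by norm_num) _
  · refine ⟨?_, by simpa using step.2 hle, by simpa using hx'⟩
    repeat' first | exact hat | refine AtEntry.set ?_ (by norm_num) _

/-- The state is as described, and the table entry for the subproblem may be written. -/
structure Found (I : BatchInstance) (m : ℕ) (A : ℤ) (μ : ℕ → ℤ) (i l r b c : ℕ)
    (σ : State) : Prop where
  at_entry : AtEntry I m A μ i l r b c σ
  out : ¬ ((dataOf I m A μ).time l < (dataOf I m A μ).rel i ∧
      (dataOf I m A μ).rel i ≤ (dataOf I m A μ).time r) →
    σ.reg vbest = (tableOf I m μ).cost ((dataOf I m A μ).cell i l r b c) ∧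
    σ.reg vleft = (dataOf I m A μ).cell i l r b c ∧ σ.reg vright = (dataOf I m A μ).cell i l r b c
  best : (dataOf I m A μ).time l < (dataOf I m A μ).rel i ∧
      (dataOf I m A μ).rel i ≤ (dataOf I m A μ).time r →
    (dataOf I m A μ).Best (tableOf I m μ).cost (fun _ _ => True) i l r b c
      (σ.reg vbest) (σ.reg vstart) (σ.reg vleft) (σ.reg vright)

theorem runs_trySplits (hf : Filled I m A S V μ i l r b c) {x : ℕ} (hx : x < m)
    (h : Searching I m A μ i l r b c x 0 σ) (htx : σ.reg vtx = (dataOf I m A μ).time x)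
    (hc1 : σ.reg vc1 = 0)
    (h1 : (dataOf I m A μ).time l + I.p ≤ (dataOf I m A μ).time x)
    (h2 : (dataOf I m A μ).time x + I.p ≤ (dataOf I m A μ).time r)
    (h3 : (dataOf I m A μ).rel i ≤ (dataOf I m A μ).time x)
    (h4 : (dataOf I m A μ).time x + I.p ≤ (dataOf I m A μ).dl i) :
    Runs S V trySplits σ ((I.k + 1) * 200) (Searching I m A μ i l r b c x c) := by
  have := Runs.loop hf.room.le_V (S := S) (e := 𝐫 vc1 + 1 ≼ 𝐫 vc) (c := trySplit) rfl (N := c)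
    (fun q σ => Searching I m A μ i l r b c x q σ ∧
      σ.reg vtx = (dataOf I m A μ).time x ∧ σ.reg vc1 = (q : ℕ))
    (fun q hq σ hσ => ⟨by simp [Expr.Safe], by
      simp only [Expr.val, hσ.2.2, hσ.1.at_entry.c_eq]
      congr 1
      simp only [eq_iff_iff]
      omega⟩)
    (fun q hq σ hσ => runs_trySplit hf hx hq hσ.1 hσ.2.1 hσ.2.2 h1 h2 h3 h4)
    ⟨h, htx, by simpa using hc1⟩
  refine this.mono ?_ fun _ _ h => h.1
  refine Nat.mul_le_mul (by have := hf.c_le; omega) ?_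
  decide

theorem runs_tryTime (hf : Filled I m A S V μ i l r b c) {x : ℕ} (hx : x < m)
    (h : Searching I m A μ i l r b c x 0 σ) :
    Runs S V tryTime σ ((I.k + 1) * 300) (Searching I m A μ i l r b c (x + 1) 0) := by
  obtain ⟨hat, hbest, hx'⟩ := h
  have hc := hat.consts
  have htab := hf.room.table
  have hS := hf.room.S_le
  have htime : μ (4 + 5 * (I.n : ℤ) + x).toNat = (dataOf I m A μ).time x := by
    simp only [dataOf, hx, if_true]; congr 1
  have h0 := DP.cell_lt (D := dataOf I m A μ) (i := i) hx hx (b := 0) (by simp only [dataOf]; omega)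
    (c := 0) (by omega)
  obtain ⟨-, -, g3, -⟩ := hf.value_le hx h0 h0
  refine Runs.mono (t := 7 + (30 + (I.k + 1) * 200 + 4)) (Runs.seq
    (Q := Searching I m A μ i l r b c (x + 1) 0)
    ((Runs.of_wp hf.room.le_V rfl (Q := fun σ => Searching I m A μ i l r b c x 0 σ ∧
      σ.reg vtx = (dataOf I m A μ).time x ∧ σ.reg vc1 = 0) ?_).mono (by decide)
      fun σ' _ hσ' => Runs.seq (Runs.mono (Q := fun σ => AtEntry I m A μ i l r b c σ ∧
        (dataOf I m A μ).Best (tableOf I m μ).cost (Before (x + 1) 0) i l r b c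
          (σ.reg vbest) (σ.reg vstart) (σ.reg vleft) (σ.reg vright) ∧ σ.reg vx = x)
      (Runs.ite (t := (I.k + 1) * 200) hf.room.le_V rfl ?_ ?_ ?_) ?_
      fun σ'' _ hσ'' => (Runs.of_wp hf.room.le_V rfl ?_).mono (by decide) fun _ _ h => h)))
    (by omega) fun _ _ h => h
  · simp only [Cmd.wp, Expr.val, Expr.Safe, State.set_reg, Nat.reduceEqDiff, if_true,
      if_false, hc.time_eq, hx', hat.mem_eq, htime, true_and, and_true]
    refine ⟨by omega, g3, by simp, ⟨(hat.set (by norm_num) _).set (by norm_num) _, ?_, by simpa⟩⟩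
    simpa using hbest
  · simp [Expr.Safe]
  · intro hcond
    obtain ⟨h1, h2, h3⟩ := hσ'
    have h4 := h1.at_entry
    simp only [Expr.val, h4.L_eq, h4.R_eq, h4.ri_eq, h4.di_eq, h2, h4.consts.p_eq, ne_eq,
      mul_eq_zero, not_or, ite_eq_right_iff, one_ne_zero, imp_false, not_not] at hcond
    obtain ⟨⟨⟨c1, c2⟩, c3⟩, c4⟩ := hcond
    refine (runs_trySplits hf hx h1 h2 h3 c1 c2 c3 c4).mono le_rfl fun σ'' _ hσ'' =>
      ⟨hσ''.at_entry, hσ''.best.mono ?_ ?_, hσ''.x_eq⟩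
    · rintro x' c₁ hc₁ (h | h)
      exacts [.inl (by omega), .inl (by omega)]
    · rintro x' c₁ hc₁ (h | h)
      · rcases Nat.lt_succ_iff_lt_or_eq.mp h with h | h
        exacts [.inl h, .inr ⟨h, hc₁⟩]
      · omega
  · intro hcond
    obtain ⟨h1, h2, h3⟩ := hσ'
    have h4 := h1.at_entry
    simp only [Expr.val, h4.L_eq, h4.R_eq, h4.ri_eq, h4.di_eq, h2, h4.consts.p_eq,
      mul_eq_zero, ite_eq_right_iff, one_ne_zero, imp_false] at hcond
    refine (Runs.of_wp hf.room.le_V rfl ?_).mono (Q := fun σ => σ = σ') ?_ fun σ'' _ hσ'' => ?_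
    · simp [Cmd.wp]
    · simp only [Cmd.steps]; omega
    · subst hσ''
      refine ⟨h4, ⟨h1.best.le_M, fun v s a a' hv => ?_, h1.best.attained.imp_right fun h => ?_⟩,
        h1.x_eq⟩
      · refine h1.best.le v s a a' ?_
        rcases hv with hv | ⟨x', hx', c₁, c₂, hX, hcc, d1, d2, d3, d4, hrest⟩
        · exact .inl hv
        · rcases hX with hX | hX
          · rcases Nat.lt_succ_iff_lt_or_eq.mp hX with hX | rfl
            · exact .inr ⟨x', hx', c₁, c₂, .inl hX, hcc, d1, d2, d3, d4, hrest⟩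
            · change _ + (I.p : ℤ) ≤ _ at d1 d2 d4
              tauto
          · omega
      · refine h.mono fun x' c₁ _ hX => ?_
        rcases hX with hX | hX <;> exact .inl (by omega)
  · simp only [Expr.cost]; omega
  · obtain ⟨h1, h2, h3⟩ := hσ''
    have hm := hf.room.m_pos
    simp only [Cmd.wp, Expr.val, Expr.Safe, h3, true_and, and_true]
    refine ⟨by rw [abs_le]; omega, h1.set (by norm_num) _, ?_, by simp⟩
    simpa using h2

theorem runs_tryTimes (hf : Filled I m A S V μ i l r b c)
    (h : Searching I m A μ i l r b c 0 0 σ) :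
    Runs S V tryTimes σ ((m + 1) * ((I.k + 1) * 400)) (Searching I m A μ i l r b c m 0) := by
  refine (Runs.loop hf.room.le_V (S := S) (e := 𝐫 vx + 1 ≼ 𝐫 vm) (c := tryTime) rfl (N := m)
    (fun x σ => Searching I m A μ i l r b c x 0 σ)
    (fun q hq σ hσ => ⟨by simp [Expr.Safe], by
      simp only [Expr.val, hσ.x_eq, hσ.at_entry.consts.m_eq]
      congr 1
      simp only [eq_iff_iff]
      omega⟩)
    (fun x hx σ hσ => runs_tryTime hf hx hσ) h).mono ?_ fun _ _ h => h
  refine Nat.mul_le_mul le_rfl ?_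
  simp only [Expr.cost]
  omega

/-- Before the loop over candidate times, joining the batch at the right end is considered. -/
theorem runs_tryRight (hf : Filled I m A S V μ i l r b c) (hat : AtEntry I m A μ i l r b c σ) :
    Runs S V tryRight σ tryRight.steps (Searching I m A μ i l r b c 0 0) := by
  have hc := hat.consts
  obtain ⟨b1, b2, b3, b4, b5⟩ := hf.room.bounds
  have hS := hf.room.S_le
  have hM : |(I.n : ℤ) * (A + A)| ≤ V := by rw [abs_le]; omega
  have l1 := hf.room.cell_lt (μ := μ) hf.i_lt.le hf.l_lt hf.r_lt hf.b_lt hf.c_le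
  have hx0 : ∀ x' c', ¬ Before 0 0 x' c' := by
    rintro x' c' (h | h) <;> omega
  refine Runs.of_wp hf.room.le_V rfl ?_
  simp only [tryRight, improve, Cmd.wp, Expr.val, Expr.Safe, Expr.val_sub, Expr.safe_sub,
    State.set_reg, State.set_mem, Nat.reduceEqDiff, if_true, if_false, hc.M_eq, hc.p_eq,
    hc.k_eq, hc.tab_eq, hat.mem_eq, hat.R_eq, hat.di_eq, hat.ri_eq, hat.q0_eq, hat.b_eq,
    true_and, and_true, ne_eq, mul_eq_zero, not_or, ite_eq_right_iff, one_ne_zero, imp_false,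
    not_le, not_lt]
  have hset : ∀ {σ'}, AtEntry I m A μ i l r b c σ' → ∀ {x}, 23 ≤ x → ∀ v,
      AtEntry I m A μ i l r b c (σ'.set x v) := fun h _ hx v => h.set hx v
  have hM' : (dataOf I m A μ).M = I.n * (A + A) := rfl
  have habs : |(0 : ℤ)| ≤ V := by simp
  refine ⟨hM, habs, habs, habs, habs, fun ⟨hb1, hd⟩ => ?_, fun hno => ?_⟩
  · obtain ⟨b', rfl⟩ : ∃ b', b = b' + 1 := ⟨b - 1, by omega⟩
    have hbB := hf.b_lt
    have e1 : (((dataOf I m A μ).cell i l r (b' + 1) c : ℕ) : ℤ) - (I.k + 1) =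
        (dataOf I m A μ).cell i l r b' c := by
      simp only [DP.cell, dataOf]; push_cast; ring
    have l2 := hf.room.cell_lt (μ := μ) hf.i_lt.le hf.l_lt hf.r_lt (b := b') (by omega) hf.c_le
    have l3 := DP.cell_lt (D := dataOf I m A μ) (i := i) hf.l_lt hf.r_lt (b := b')
      (by simp only [dataOf]; omega) (c := c) hf.c_le
    obtain ⟨-, g2, g3, -⟩ := hf.value_le hf.r_lt l3 l3
    simp only [e1, load_cost, Nat.abs_cast]
    have hnew : ∀ v s a a', (dataOf I m A μ).Choice (tableOf I m μ).cost (Before 0 0) i l r (b' + 1)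
        c v s a a' → v = (tableOf I m μ).cost ((dataOf I m A μ).cell i l r b' c) +
          ((dataOf I m A μ).time r - (dataOf I m A μ).rel i) := by
      rintro v s a a' (⟨b₁, hb₁, -, hs, -, -, hv⟩ | ⟨x, -, c₁, -, hX, -⟩)
      · obtain rfl : b₁ = b' := by omega
        rw [hv, hs]
      · exact absurd hX (hx0 _ _)
    refine ⟨by omega, by omega, by omega, g2, fun hlt => ⟨g2, g3, by omega, by omega, ?_, ?_, ?_⟩,
      fun hle => ⟨?_, ?_, ?_⟩⟩
    · repeat' first | exact hat | refine AtEntry.set ?_ (by norm_num) _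
    · simp only [State.set_reg, Nat.reduceEqDiff, if_true, if_false]
      exact ⟨by rw [hM']; omega, fun v s a a' h => (hnew v s a a' h).ge,
        .inr (.inl ⟨b', rfl, hd, rfl, rfl, rfl, rfl⟩)⟩
    · simp
    · repeat' first | exact hat | refine AtEntry.set ?_ (by norm_num) _
    · simp only [State.set_reg, Nat.reduceEqDiff, if_true, if_false]
      exact ⟨le_rfl, fun v s a a' h => by rw [hnew v s a a' h]; omega, .inl rfl⟩
    · simp
  · refine ⟨?_, ?_, ?_⟩
    · repeat' first | exact hat | refine AtEntry.set ?_ (by norm_num) _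
    · simp only [State.set_reg, Nat.reduceEqDiff, if_true, if_false]
      refine ⟨le_rfl, fun v s a a' h => ?_, .inl rfl⟩
      rcases h with ⟨b', rfl, hd, -⟩ | ⟨x, -, c₁, -, hX, -⟩
      · change _ + (I.p : ℤ) ≤ _ at hd
        omega
      · exact absurd hX (hx0 _ _)
    · simp

theorem runs_copyEntry (hf : Filled I m A S V μ i l r b c) (hat : AtEntry I m A μ i l r b c σ)
    (hout : ¬ ((dataOf I m A μ).time l < (dataOf I m A μ).rel i ∧
      (dataOf I m A μ).rel i ≤ (dataOf I m A μ).time r)) :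
    Runs S V copyEntry σ copyEntry.steps (Found I m A μ i l r b c) := by
  have hc := hat.consts
  have hS := hf.room.S_le
  have hbB := hf.b_lt
  have l1 := hf.room.cell_lt (μ := μ) hf.i_lt.le hf.l_lt hf.r_lt hf.b_lt hf.c_le
  have l3 := DP.cell_lt (D := dataOf I m A μ) (i := i) hf.l_lt hf.r_lt (b := b)
      (by simp only [dataOf]; omega) (c := c) hf.c_le
  obtain ⟨-, -, -, g⟩ := hf.value_le hf.r_lt l3 l3
  refine Runs.of_wp hf.room.le_V rfl ?_
  simp only [copyEntry, Cmd.wp, Expr.val, Expr.Safe,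
    State.set_reg, Nat.reduceEqDiff, if_false,
    hc.tab_eq, hat.mem_eq, hat.q0_eq, load_cost, Nat.abs_cast, true_and, and_true]
  refine ⟨by omega, g, by simp, by omega, by omega, ?_, fun _ => by simp, fun h => absurd h hout⟩
  repeat' first | exact hat | refine AtEntry.set ?_ (by norm_num) _

/-- The state at the beginning of the work on an entry. -/
structure AtStart (I : BatchInstance) (m : ℕ) (A : ℤ) (μ : ℕ → ℤ) (i l r b c : ℕ) (σ : State) :
    Prop where
  consts : Consts I m A σ
  mem_eq : σ.mem = μ
  i_eq : σ.reg vi = i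
  l_eq : σ.reg vl = l
  r_eq : σ.reg vr = r
  b_eq : σ.reg vb = b
  c_eq : σ.reg vc = c

theorem runs_locate (hf : Filled I m A S V μ i l r b c) (h : AtStart I m A μ i l r b c σ) :
    Runs S V locate σ locate.steps (AtEntry I m A μ i l r b c) := fun hbd => by
  have hm := hbd.mem
  revert hbd
  obtain ⟨hc, hmem, hi, hl, hr, hb, hcc⟩ := h
  have hS := hf.room.S_le
  have htab := hf.room.table
  have hbB := hf.b_lt
  have hil := hf.i_lt
  have hll := hf.l_lt
  have hrl := hf.r_lt
  have e1 := cell_cast I m A μ i l r b c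
  have e2 : (((dataOf I m A μ).cell i l r b c : ℕ) : ℤ) + m * m * I.B * (I.k + 1) =
      (dataOf I m A μ).cell (i + 1) l r b c := by
    rw [DP.cell_succ]
    have : I.B - 1 + 1 = I.B := by omega
    simp only [DP.layer, dataOf, this]
    push_cast
    ring
  have l1 := hf.room.cell_lt (μ := μ) hf.i_lt.le hf.l_lt hf.r_lt hf.b_lt hf.c_le
  have l2 := hf.room.cell_lt (μ := μ) (i := i + 1) hf.i_lt hf.l_lt hf.r_lt hf.b_lt hf.c_le
  have htime : μ (4 + 5 * (I.n : ℤ) + l).toNat = (dataOf I m A μ).time l := by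
    simp only [dataOf, hll, if_true]; congr 1
  have htime' : μ (4 + 5 * (I.n : ℤ) + r).toNat = (dataOf I m A μ).time r := by
    simp only [dataOf, hrl, if_true]; congr 1
  have hrel : μ (4 + 2 * (I.n : ℤ) + i).toNat = (dataOf I m A μ).rel i := by
    simp only [dataOf, hil, if_true]; congr 1
  have hdl : μ (4 + 3 * (I.n : ℤ) + i).toNat = (dataOf I m A μ).dl i := by
    simp only [dataOf, hil, if_true]; congr 1
  rw [hmem] at hm
  have hm1 : |(dataOf I m A μ).time l| ≤ V := htime ▸ hm _
  have hm2 : |(dataOf I m A μ).time r| ≤ V := htime' ▸ hm _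
  have hm3 : |(dataOf I m A μ).rel i| ≤ V := hrel ▸ hm _
  have hm4 : |(dataOf I m A μ).dl i| ≤ V := hdl ▸ hm _
  refine Runs.of_wp hf.room.le_V rfl ?_
  simp only [locate, Cmd.wp, Expr.val, Expr.Safe,
    State.set_reg, State.set_mem, Nat.reduceEqDiff, if_true, if_false, hc.k_eq,
    hc.B_eq, hc.m_eq, hc.time_eq, hc.rel_eq, hc.dl_eq, hmem, hi, hl, hr, hb, hcc, e1, e2, htime,
    htime',
    hrel, hdl, Nat.abs_cast, true_and, and_true]
  refine ⟨by omega, by omega, by omega, hm1, by omega, hm2, by omega, hm3, by omega, hm4, ?_⟩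
  constructor
  · repeat' first | exact hc | refine Consts.set ?_ (by norm_num) _
  all_goals simp [hmem, hi, hl, hr, hb, hcc]

/-- The best choice for the last job of a subproblem is found. -/
theorem runs_search (hf : Filled I m A S V μ i l r b c) (h : AtStart I m A μ i l r b c σ) :
    Runs S V (locate ;; .ite ((𝐫 vL + 1 ≼ 𝐫 vri) * (𝐫 vri ≼ 𝐫 vR)) (tryRight ;; tryTimes)
      copyEntry) σ (300 + (m + 1) * ((I.k + 1) * 400)) (Found I m A μ i l r b c) := by
  refine Runs.mono (t := locate.steps + (10 + (tryRight.steps + (m + 1) * ((I.k + 1) * 400))))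
    (Runs.seq ((runs_locate hf h).mono le_rfl fun σ' _ hat =>
      Runs.ite hf.room.le_V rfl ?_ (fun hcond => ?_) (fun hcond => ?_))) ?_ fun _ _ h => h
  · simp [Expr.Safe]
  · simp only [Expr.val, hat.L_eq, hat.ri_eq, hat.R_eq, ne_eq, mul_eq_zero, not_or,
      ite_eq_right_iff, one_ne_zero, imp_false, not_not] at hcond
    refine Runs.seq ((runs_tryRight hf hat).mono le_rfl fun σ'' _ h'' =>
      (runs_tryTimes hf h'').mono le_rfl fun σ₃ _ h₃ => ⟨h₃.at_entry, fun hn => ?_, fun _ => ?_⟩)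
    · exact absurd ⟨by omega, hcond.2⟩ hn
    · refine ⟨h₃.best.le_M, fun v s a a' hv => h₃.best.le v s a a' ?_,
        h₃.best.attained.imp_right fun h => h.mono fun _ _ _ _ => trivial⟩
      rcases hv with hv | ⟨x, hx, c₁, c₂, -, hrest⟩
      exacts [.inl hv, .inr ⟨x, hx, c₁, c₂, .inl hx, hrest⟩]
  · simp only [Expr.val, hat.L_eq, hat.ri_eq, hat.R_eq, mul_eq_zero,
      ite_eq_right_iff, one_ne_zero, imp_false] at hcond
    refine (runs_copyEntry hf hat fun hn => ?_).mono ?_ fun _ _ h => h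
    · omega
    · have : copyEntry.steps ≤ tryRight.steps := by decide
      omega
  · have : locate.steps + tryRight.steps ≤ 290 := by decide
    omega

end BatchScheduling

namespace BatchScheduling

/-! ### The loop over the table -/

namespace DP

variable {D : DP} {t t' : Table} {cost cost' : ℕ → ℤ} {X : ℕ → ℕ → Prop} {i l r b c : ℕ}

theorem Choice.congr (hl : l < D.m) (hr : r < D.m) (hb : b ≤ D.B) (hc : c ≤ D.k)
    (h : ∀ a < (i + 1) * D.layer, cost' a = cost a) {v s ql qr : ℤ}
    (hch : D.Choice cost X i l r b c v s ql qr) : D.Choice cost' X i l r b c v s ql qr := by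
  rcases hch with ⟨b', rfl, h1, h2, h3, h4, h5⟩ |
    ⟨x, hx, c₁, c₂, h1, h2, h3, h4, h5, h6, h7, h8, h9, h10⟩
  · refine .inl ⟨b', rfl, h1, h2, h3, h4, ?_⟩
    rw [h _ (cell_lt hl hr (by omega) hc)]
    exact h5
  · refine .inr ⟨x, hx, c₁, c₂, h1, h2, h3, h4, h5, h6, h7, h8, h9, ?_⟩
    rw [h _ (cell_lt hl hx le_rfl (by omega)), h _ (cell_lt hx hr hb (by omega))]
    exact h10

/-- The correctness of an entry depends only on that entry and on the entries for fewer jobs. -/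
theorem Entry.congr (hl : l < D.m) (hr : r < D.m) (hb : b ≤ D.B) (hc : c ≤ D.k)
    (h : ∀ a ≤ D.cell (i + 1) l r b c, t'.cost a = t.cost a ∧ t'.start a = t.start a ∧
      t'.left a = t.left a ∧ t'.right a = t.right a)
    (he : D.Entry t i l r b c) : D.Entry t' i l r b c := by
  have hlow : ∀ a < (i + 1) * D.layer, t'.cost a = t.cost a := fun a ha =>
    (h a (by rw [cell_eq]; omega)).1
  obtain ⟨h1, h2, h3, h4⟩ := h _ le_rfl
  have hcell := cell_lt (i := i) hl hr hb hc
  constructor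
  · intro hw
    rw [h1, h3, h4, hlow _ hcell]
    exact he.1 hw
  · intro hw
    rw [h1, h2, h3, h4]
    obtain ⟨b1, b2, b3⟩ := he.2 hw
    exact ⟨b1, fun v s a a' hv => b2 v s a a' (hv.congr hl hr hb hc fun a ha => (hlow a ha).symm),
      b3.imp_right fun hv => hv.congr hl hr hb hc hlow⟩

theorem Best.nonneg (hl : l < D.m) (hr : r < D.m) (hb : b ≤ D.B) (hc : c ≤ D.k)
    (hM : 0 ≤ D.M) (hcost : ∀ a < (i + 1) * D.layer, 0 ≤ cost a)
    (hw : D.rel i ≤ D.time r) {v s ql qr : ℤ} (h : D.Best cost X i l r b c v s ql qr) : 0 ≤ v := by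
  rcases h.attained with rfl | ⟨b', rfl, -, h2, -, -, hv⟩ |
    ⟨x, hx, c₁, c₂, -, h2, -, -, h5, -, h7, -, -, hv⟩
  · exact hM
  · have := hcost _ (cell_lt hl hr (b := b') (by omega) hc)
    omega
  · have := hcost _ (cell_lt hl hx le_rfl (c := c₁) (by omega))
    have := hcost _ (cell_lt hx hr hb (c := c₂) (by omega))
    omega

theorem cell_next_batch (D : DP) (i l r b : ℕ) :
    D.cell i l r (b + 1) 0 = D.cell i l r b D.k + 1 := by
  simp only [cell]; ring

theorem cell_next_right (D : DP) (i l r : ℕ) :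
    D.cell i l (r + 1) 0 0 = D.cell i l r D.B D.k + 1 := by
  simp only [cell]; ring

theorem cell_next_left (i l : ℕ) (hr : r + 1 = D.m) :
    D.cell i (l + 1) 0 0 0 = D.cell i l r D.B D.k + 1 := by
  simp only [cell, ← hr]; ring

theorem cell_next_job (i : ℕ) (hl : l + 1 = D.m) (hr : r + 1 = D.m) :
    D.cell (i + 1) 0 0 0 0 = D.cell i l r D.B D.k + 1 := by
  obtain rfl : l = r := by omega
  simp only [cell, ← hr]; ring

end DP

variable {I : BatchInstance} {m : ℕ} {A : ℤ} {S V : ℕ} {μ : ℕ → ℤ} {i l r b c : ℕ} {σ : State}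

/-- After the entry is written, only its four cells have changed. -/
structure Written (I : BatchInstance) (m : ℕ) (A : ℤ) (μ : ℕ → ℤ) (i l r b c : ℕ)
    (σ : State) : Prop where
  start : AtStart I m A σ.mem i l r b c σ
  frame : ∀ a, a < 4 + 5 * I.n + m + 4 * (dataOf I m A μ).cell (i + 1) l r b c ∨
    4 + 5 * I.n + m + 4 * (dataOf I m A μ).cell (i + 1) l r b c + 4 ≤ a → σ.mem a = μ a
  entry : ∃ v s ql qr : ℤ,
    (tableOf I m σ.mem).cost ((dataOf I m A μ).cell (i + 1) l r b c) = v ∧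
    (tableOf I m σ.mem).start ((dataOf I m A μ).cell (i + 1) l r b c) = s ∧
    (tableOf I m σ.mem).left ((dataOf I m A μ).cell (i + 1) l r b c) = ql ∧
    (tableOf I m σ.mem).right ((dataOf I m A μ).cell (i + 1) l r b c) = qr ∧
    (¬ ((dataOf I m A μ).time l < (dataOf I m A μ).rel i ∧
        (dataOf I m A μ).rel i ≤ (dataOf I m A μ).time r) →
      v = (tableOf I m μ).cost ((dataOf I m A μ).cell i l r b c) ∧
      ql = (dataOf I m A μ).cell i l r b c ∧ qr = (dataOf I m A μ).cell i l r b c) ∧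
    ((dataOf I m A μ).time l < (dataOf I m A μ).rel i ∧
        (dataOf I m A μ).rel i ≤ (dataOf I m A μ).time r →
      (dataOf I m A μ).Best (tableOf I m μ).cost (fun _ _ => True) i l r b c v s ql qr)

theorem runs_storeEntry (hf : Filled I m A S V μ i l r b c) (h : Found I m A μ i l r b c σ) :
    Runs S V storeEntry σ storeEntry.steps (Written I m A μ i l r b c) := fun hbd => by
  have g1 := hbd.reg vbest
  have g2 := hbd.reg vstart
  have g3 := hbd.reg vleft
  have g4 := hbd.reg vright
  revert hbd
  obtain ⟨hat, hout, hbest⟩ := h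
  have hc := hat.consts
  have l1 := hf.room.cell_lt (μ := μ) (i := i + 1) hf.i_lt hf.l_lt hf.r_lt hf.b_lt hf.c_le
  generalize hq : (dataOf I m A μ).cell (i + 1) l r b c = q at *
  have hqe := hat.q_eq
  rw [hq] at hqe
  have e0 : (4 + 5 * (I.n : ℤ) + m + 4 * q).toNat = 4 + 5 * I.n + m + 4 * q := by omega
  have e1 : (4 + 5 * (I.n : ℤ) + m + 4 * q + 1).toNat = 4 + 5 * I.n + m + 4 * q + 1 := by omega
  have e2 : (4 + 5 * (I.n : ℤ) + m + 4 * q + 2).toNat = 4 + 5 * I.n + m + 4 * q + 2 := by omega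
  have e3 : (4 + 5 * (I.n : ℤ) + m + 4 * q + 3).toNat = 4 + 5 * I.n + m + 4 * q + 3 := by omega
  refine Runs.of_wp hf.room.le_V rfl ?_
  simp only [storeEntry, Cmd.wp, Expr.val, Expr.Safe, State.write_reg, hc.tab_eq, hqe, e0, e1, e2,
    e3, true_and, and_true]
  refine ⟨by omega, g1, by omega, g2, by omega, g3, by omega, g4, ?_, ?_, ?_⟩
  · exact ⟨⟨hc.n_eq, hc.k_eq, hc.B_eq, hc.p_eq, hc.m_eq, hc.rel_eq, hc.dl_eq, hc.rank_eq,
      hc.time_eq, hc.tab_eq, hc.A_eq, hc.M_eq⟩, rfl, hat.i_eq, hat.l_eq, hat.r_eq, hat.b_eq,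
      hat.c_eq⟩
  · intro a ha
    rw [hq] at ha
    simp only [State.write_mem, hat.mem_eq]
    rw [if_neg (by omega), if_neg (by omega), if_neg (by omega), if_neg (by omega)]
  · refine ⟨_, _, _, _, rfl, rfl, rfl, rfl, ?_, ?_⟩ <;>
      simp only [hq, tableOf, State.write_mem, if_true, Nat.add_left_cancel_iff, Nat.reduceEqDiff,
        if_false, Nat.left_eq_add, Nat.add_eq_left, OfNat.ofNat_ne_zero, one_ne_zero]
    · exact hout
    · exact hbest

/-- The invariant of the loop over the table: the entries at positions below `q` are correct. -/
structure Filling (I : BatchInstance) (m : ℕ) (A : ℤ) (μ₀ : ℕ → ℤ) (q : ℕ) (σ : State) :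
    Prop where
  cursor : ∃ i l r b c, AtStart I m A σ.mem i l r b c σ ∧ l < m ∧ r < m ∧ b < I.B ∧ c ≤ I.k ∧
    (dataOf I m A μ₀).cell (i + 1) l r b c = q
  frame : ∀ a < 4 + 5 * I.n + m, σ.mem a = μ₀ a
  zero : ∀ a < (dataOf I m A μ₀).layer, (tableOf I m σ.mem).cost a = 0
  nonneg : ∀ a < q, 0 ≤ (tableOf I m σ.mem).cost a
  le : ∀ a < q, (tableOf I m σ.mem).cost a ≤ I.n * (A + A)
  entry : ∀ i < I.n, ∀ l < m, ∀ r < m, ∀ b < I.B, ∀ c ≤ I.k,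
    (dataOf I m A μ₀).cell (i + 1) l r b c < q →
    (dataOf I m A μ₀).Entry (tableOf I m σ.mem) i l r b c

theorem dataOf_congr {μ μ₀ : ℕ → ℤ} (h : ∀ a < 4 + 5 * I.n + m, μ a = μ₀ a) :
    dataOf I m A μ = dataOf I m A μ₀ := by
  simp only [dataOf, DP.mk.injEq, true_and]
  refine ⟨funext fun q => ?_, funext fun q => ?_, funext fun q => ?_⟩
  all_goals split_ifs with hq
  exacts [h _ (by omega), rfl, h _ (by omega), rfl, h _ (by omega), rfl]

theorem runs_advance (hR : Room I m A S V) (h : AtStart I m A μ i l r b c σ) (hi : i < I.n)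
    (hl : l < m) (hr : r < m) (hb : b < I.B) (hc : c ≤ I.k) :
    Runs S V advance σ advance.steps fun σ' => σ'.mem = μ ∧
      ∃ i' l' r' b' c', AtStart I m A μ i' l' r' b' c' σ' ∧ l' < m ∧ r' < m ∧ b' < I.B ∧ c' ≤ I.k ∧
        (dataOf I m A μ).cell (i' + 1) l' r' b' c' =
          (dataOf I m A μ).cell (i + 1) l r b c + 1 := by
  obtain ⟨hcs, hmem, h1, h2, h3, h4, h5⟩ := h
  have hS := hR.S_le
  have htab := hR.table
  have hk := hR.k_lt
  have hm := hR.m_pos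
  have hB : I.B - 1 + 1 = I.B := by omega
  have hset : ∀ {σ'}, Consts I m A σ' → ∀ {x}, 12 ≤ x → ∀ v, Consts I m A (σ'.set x v) :=
    fun h _ hx v => h.set hx v
  refine Runs.of_wp hR.le_V rfl ?_
  simp only [advance, Cmd.wp, Expr.val, Expr.Safe, State.set_reg, State.set_mem, Nat.reduceEqDiff,
    if_true, if_false, hcs.k_eq, hcs.B_eq, hcs.m_eq, h1, h2, h3, h4, h5, hmem, true_and, and_true,
    ne_eq, ite_eq_right_iff, one_ne_zero, imp_false, not_le, not_lt, abs_zero,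
    Nat.cast_nonneg]
  have a1 : |(c : ℤ) + 1| ≤ V := by rw [abs_le]; omega
  have a2 : |(b : ℤ) + 1| ≤ V := by rw [abs_le]; omega
  have a3 : |(r : ℤ) + 1| ≤ V := by rw [abs_le]; omega
  have a4 : |(l : ℤ) + 1| ≤ V := by rw [abs_le]; omega
  have a5 : |(i : ℤ) + 1| ≤ V := by rw [abs_le]; omega
  refine ⟨a1, fun d1 => ⟨a2, fun d2 => ⟨a3, fun d3 => ⟨a4, fun d4 => ⟨a5, ?_⟩, fun d4 => ?_⟩,
    fun d3 => ?_⟩, fun d2 => ?_⟩, fun d1 => ?_⟩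
  · refine ⟨i + 1, 0, 0, 0, 0, ⟨?_, ?_, ?_, ?_, ?_, ?_, ?_⟩, by omega, by omega, by omega,
      by omega, ?_⟩
    · repeat' first | exact hcs | refine Consts.set ?_ (by norm_num) _
    all_goals try simp [hmem]
    obtain rfl : c = I.k := by omega
    obtain rfl : b = I.B - 1 := by omega
    exact DP.cell_next_job (D := dataOf I m A μ) _ (by simp only [dataOf]; omega)
      (by simp only [dataOf]; omega)
  · refine ⟨i, l + 1, 0, 0, 0, ⟨?_, ?_, ?_, ?_, ?_, ?_, ?_⟩, by omega, by omega, by omega,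
      by omega, ?_⟩
    · repeat' first | exact hcs | refine Consts.set ?_ (by norm_num) _
    all_goals try simp [h1, hmem]
    obtain rfl : c = I.k := by omega
    obtain rfl : b = I.B - 1 := by omega
    exact DP.cell_next_left (D := dataOf I m A μ) _ _ (by simp only [dataOf]; omega)
  · refine ⟨i, l, r + 1, 0, 0, ⟨?_, ?_, ?_, ?_, ?_, ?_, ?_⟩, by omega, by omega, by omega,
      by omega, ?_⟩
    · repeat' first | exact hcs | refine Consts.set ?_ (by norm_num) _
    all_goals try simp [h1, h2, hmem]
    obtain rfl : c = I.k := by omega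
    obtain rfl : b = I.B - 1 := by omega
    exact DP.cell_next_right (dataOf I m A μ) _ _ _
  · refine ⟨i, l, r, b + 1, 0, ⟨?_, ?_, ?_, ?_, ?_, ?_, ?_⟩, by omega, by omega, by omega,
      by omega, ?_⟩
    · repeat' first | exact hcs | refine Consts.set ?_ (by norm_num) _
    all_goals try simp [h1, h2, h3, hmem]
    obtain rfl : c = I.k := by omega
    exact DP.cell_next_batch (dataOf I m A μ) _ _ _ _
  · refine ⟨i, l, r, b, c + 1, ⟨?_, ?_, ?_, ?_, ?_, ?_, ?_⟩, by omega, by omega, by omega,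
      by omega, rfl⟩
    · repeat' first | exact hcs | refine Consts.set ?_ (by norm_num) _
    all_goals simp [h1, h2, h3, h4, hmem]

/-- The data below the table that the loop over the table relies on. -/
structure Ready (I : BatchInstance) (m : ℕ) (A : ℤ) (S V : ℕ) (μ : ℕ → ℤ) : Prop where
  room : Room I m A S V
  time_le : ∀ x < m, |(dataOf I m A μ).time x| ≤ (I.n + 1) * A
  rel_le : ∀ q < I.n, |(dataOf I m A μ).rel q| ≤ A

theorem runs_fillEntry {μ₀ : ℕ → ℤ} (hR : Ready I m A S V μ₀) {q : ℕ}
    (hq : q < (I.n + 1) * (dataOf I m A μ₀).layer) (h : Filling I m A μ₀ q σ) :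
    Runs S V fillEntry σ (600 + (m + 1) * ((I.k + 1) * 400)) (Filling I m A μ₀ (q + 1)) := by
  obtain ⟨⟨i, l, r, b, c, hst, hl, hr, hb, hc, hcell⟩, hframe, hzero, hnn, hle, hent⟩ := h
  have hD := dataOf_congr (A := A) hframe
  have hB : (dataOf I m A μ₀).B = I.B - 1 := rfl
  have hi : i < I.n := by
    by_contra hcon
    rw [DP.cell_eq] at hcell
    have := Nat.mul_le_mul_right (dataOf I m A μ₀).layer (by omega : I.n + 1 ≤ i + 1)
    omega
  have hlow : (i + 1) * (dataOf I m A μ₀).layer ≤ q := by rw [DP.cell_eq] at hcell; omega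
  have hf : Filled I m A S V σ.mem i l r b c := by
    refine ⟨hR.room, hi, hl, hr, hb, hc, ?_, ?_, ?_, ?_⟩ <;> rw [hD]
    exacts [hR.time_le, hR.rel_le, fun a ha => hnn a (by omega), fun a ha => hle a (by omega)]
  have hM : (dataOf I m A μ₀).M = I.n * (A + A) := rfl
  have hb5 := hR.room.bounds
  have hcellA := DP.cell_lt (D := dataOf I m A μ₀) (i := i) hl hr (b := b) (by omega) hc
  refine Runs.mono (t := 300 + (m + 1) * ((I.k + 1) * 400) + (storeEntry.steps + advance.steps))
    (Runs.seq_assoc ?_) (by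
      have : storeEntry.steps + advance.steps ≤ 300 := by decide
      omega) fun _ _ h => h
  refine Runs.seq ((runs_search hf hst).mono le_rfl fun σ₁ _ h₁ => Runs.seq
    ((runs_storeEntry hf h₁).mono le_rfl fun σ₂ _ h₂ =>
      (runs_advance hR.room h₂.start hi hl hr hb hc).mono le_rfl fun σ₃ _ h₃ => ?_))
  obtain ⟨w1, w2, v, s, ql, qr, x1, x2, x3, x4, w4, w5⟩ := h₂
  obtain ⟨y1, i', l', r', b', c', y2, y3, y4, y5, y6, y7⟩ := h₃
  have hframe₂ : ∀ a < 4 + 5 * I.n + m, σ₂.mem a = μ₀ a := fun a ha => by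
    rw [w2 a (.inl (by omega)), hframe a ha]
  have hD₂ := dataOf_congr (A := A) hframe₂
  rw [hD₂, hcell] at y7
  rw [hD] at w2 x1 x2 x3 x4 w4 w5
  rw [hcell] at w2 x1 x2 x3 x4
  have hold : ∀ a, a ≠ q → (tableOf I m σ₂.mem).cost a = (tableOf I m σ.mem).cost a ∧
      (tableOf I m σ₂.mem).start a = (tableOf I m σ.mem).start a ∧
      (tableOf I m σ₂.mem).left a = (tableOf I m σ.mem).left a ∧
      (tableOf I m σ₂.mem).right a = (tableOf I m σ.mem).right a := fun a ha => by
    simp only [tableOf]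
    refine ⟨w2 _ ?_, w2 _ ?_, w2 _ ?_, w2 _ ?_⟩ <;> omega
  have hlayer : (dataOf I m A μ₀).layer ≤ q := by
    refine le_trans ?_ hlow
    exact Nat.le_mul_of_pos_left _ (by omega)
  have hv : 0 ≤ v ∧ v ≤ I.n * (A + A) := by
    by_cases hw : (dataOf I m A μ₀).time l < (dataOf I m A μ₀).rel i ∧
      (dataOf I m A μ₀).rel i ≤ (dataOf I m A μ₀).time r
    · refine ⟨(w5 hw).nonneg hl hr (by omega) hc (by rw [hM]; omega)
        (fun a ha => hnn a (by omega)) hw.2, (w5 hw).le_M⟩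
    · rw [(w4 hw).1]
      exact ⟨hnn _ (by omega), hle _ (by omega)⟩
  refine ⟨⟨i', l', r', b', c', ?_, y3, y4, y5, y6, y7⟩, ?_, ?_, ?_, ?_, ?_⟩
  · rw [y1]; exact y2
  · rw [y1]; exact hframe₂
  · intro a ha
    rw [y1, (hold a (by omega)).1]
    exact hzero a ha
  · intro a ha
    rw [y1]
    rcases Nat.lt_succ_iff_lt_or_eq.mp ha with ha | rfl
    · rw [(hold a (by omega)).1]; exact hnn a ha
    · rw [x1]; exact hv.1
  · intro a ha
    rw [y1]
    rcases Nat.lt_succ_iff_lt_or_eq.mp ha with ha | rfl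
    · rw [(hold a (by omega)).1]; exact hle a ha
    · rw [x1]; exact hv.2
  · intro i₁ hi₁ l₁ hl₁ r₁ hr₁ b₁ hb₁ c₁ hc₁ hlt
    rw [y1]
    rcases Nat.lt_succ_iff_lt_or_eq.mp hlt with hlt | heq
    · exact (hent i₁ hi₁ l₁ hl₁ r₁ hr₁ b₁ hb₁ c₁ hc₁ hlt).congr hl₁ hr₁ (by omega) hc₁
        fun a ha => hold a (by omega)
    · obtain ⟨e1, rfl, rfl, rfl, rfl⟩ := DP.cell_injective (D := dataOf I m A μ₀) hl₁ hr₁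
        (by omega) hc₁ hl hr (by omega) hc (heq.trans hcell.symm)
      obtain rfl : i₁ = i := by omega
      refine ⟨fun hw => ?_, fun hw => ?_⟩
      · rw [hcell, x1, x3, x4, (hold _ (by omega)).1]
        exact w4 hw
      · rw [hcell, x1, x2, x3, x4]
        obtain ⟨z1, z2, z3⟩ := w5 hw
        have hcost : ∀ a < (i₁ + 1) * (dataOf I m A μ₀).layer,
            (tableOf I m σ₂.mem).cost a = (tableOf I m σ.mem).cost a := fun a ha =>
          (hold a (by omega)).1
        exact ⟨z1, fun v s a a' hv => z2 v s a a' (hv.congr hl hr (by omega) hc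
          fun a ha => (hcost a ha).symm), z3.imp_right fun hv => hv.congr hl hr (by omega) hc hcost⟩

/-- The state after the table is filled. -/
structure Full (I : BatchInstance) (m : ℕ) (A : ℤ) (μ₀ : ℕ → ℤ) (σ : State) : Prop where
  consts : Consts I m A σ
  frame : ∀ a < 4 + 5 * I.n + m, σ.mem a = μ₀ a
  correct : (dataOf I m A μ₀).Correct I.n (tableOf I m σ.mem)

theorem runs_fillTable (hR : Ready I m A S V σ.mem) (hc : Consts I m A σ)
    (hzero : ∀ a, 4 + 5 * I.n + m ≤ a → σ.mem a = 0) :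
    Runs S V fillTable σ ((I.n * (m * m * I.B * (I.k + 1)) + 1) *
      (700 + (m + 1) * ((I.k + 1) * 400)) + 10) (Full I m A σ.mem) := by
  have hB : (dataOf I m A σ.mem).B = I.B - 1 := rfl
  have hBp := I.B_pos
  have hb5 := hR.room.bounds
  have hm := hR.room.m_pos
  have hlayer : (dataOf I m A σ.mem).layer = m * m * I.B * (I.k + 1) := by
    have : I.B - 1 + 1 = I.B := by omega
    simp only [DP.layer, dataOf, this]
  rw [← hlayer]
  set μ₀ := σ.mem with hμ
  refine Runs.mono (t := 10 + _) (Runs.seq ((Runs.of_wp hR.room.le_V rfl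
    (Q := Filling I m A μ₀ (dataOf I m A μ₀).layer) ?_).mono (by decide) fun σ' _ h' =>
    Runs.loop hR.room.le_V (N := I.n * (dataOf I m A μ₀).layer) rfl
      (fun q => Filling I m A μ₀ ((dataOf I m A μ₀).layer + q)) ?_ (fun q hq σ hσ =>
        runs_fillEntry (q := (dataOf I m A μ₀).layer + q) hR (by rw [add_mul]; omega) hσ) h')) ?_
    fun σ' _ h' => ?_
  · simp only [Cmd.wp, Expr.val, Expr.Safe, true_and, abs_zero, Nat.cast_nonneg]
    refine ⟨⟨0, 0, 0, 0, 0, ⟨?_, rfl, ?_, ?_, ?_, ?_, ?_⟩, by omega, by omega, by omega, by omega,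
      ?_⟩, fun a _ => rfl, ?_, ?_, ?_, ?_⟩
    · repeat' first | exact hc | refine Consts.set ?_ (by norm_num) _
    iterate 5 simp
    · simp [DP.cell, DP.layer]
    iterate 3
      intro a _
      simp only [tableOf, State.set_mem]
      rw [← hμ, hzero _ (by omega)]
    · exact (by omega : (0 : ℤ) ≤ I.n * (A + A))
    · intro i hi l hl r hr b hb c hc hlt
      rw [DP.cell_eq, add_mul] at hlt
      omega
  · intro q hq σ hσ
    refine ⟨by simp [Expr.Safe], ?_⟩
    obtain ⟨i, l, r, b, c, hst, hl, hr, hb, hc, hcell⟩ := hσ.cursor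
    have h0 := DP.cell_zero_lt (D := dataOf I m A μ₀) hl hr (b := b) (by omega) hc
    rw [DP.cell_eq] at hcell
    simp only [Expr.val, hst.i_eq, hst.consts.n_eq]
    congr 1
    simp only [eq_iff_iff]
    constructor
    · intro h
      have := Nat.mul_le_mul_right (dataOf I m A μ₀).layer (by omega : i + 1 ≤ I.n)
      omega
    · intro h
      by_contra hcon
      have := Nat.mul_le_mul_right (dataOf I m A μ₀).layer (by omega : I.n + 1 ≤ i + 1)
      rw [add_mul] at this
      omega
  · rw [add_comm]
    refine Nat.add_le_add_right (Nat.mul_le_mul le_rfl ?_) _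
    simp only [Expr.cost]
    omega
  · obtain ⟨⟨i, l, r, b, c, hst, -⟩, hframe, hz, -, -, hent⟩ := h'
    refine ⟨hst.consts, hframe, fun l hl r hr b hb c hc => hz _ ?_,
      fun i hi l hl r hr b hb c hc => hent i hi l hl r hr b (by omega) c hc ?_⟩
    · exact DP.cell_zero_lt hl hr hb hc
    · have := DP.cell_lt (D := dataOf I m A μ₀) (i := i + 1) hl hr hb hc
      have := Nat.mul_le_mul_right (dataOf I m A μ₀).layer (by omega : i + 1 + 1 ≤ I.n + 1)
      rw [add_mul I.n] at this
      omega

end BatchScheduling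

namespace BatchScheduling

/-! ### Reading off the schedule -/

/-- Replace the current subproblem by the one with one job fewer that contains the job at position
`pos`. -/
def descendStep : Cmd :=
  .ite (𝐦 (𝐫 vrel + 𝐫 vpos) ≼ 𝐦 (𝐫 vtab + 4 * 𝐫 vq0 + 1))
    (vq0 ≔ 𝐦 (𝐫 vtab + 4 * 𝐫 vq0 + 2)) (vq0 ≔ 𝐦 (𝐫 vtab + 4 * 𝐫 vq0 + 3)) ;;
  vi ≔ 𝐫 vi - 1

/-- Go down to the entry whose last job is the one at position `pos`. -/
def descend : Cmd := .loop (𝐫 vpos + 2 ≼ 𝐫 vi) descendStep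

/-- Look up the start time of a job and write it to the output, which overwrites the input. -/
def readJob : Cmd :=
  (vpos ≔ 𝐦 (𝐫 vrank + 𝐫 vj) ;; vi ≔ 𝐫 vn ;;
    vq0 ≔ ((𝐫 vn * 𝐫 vm * 𝐫 vm + 1) * 𝐫 vB) * (𝐫 vk + 1) + 𝐫 vk) ;;
  descend ;;
  .store (𝐫 vj + 1) (𝐦 (𝐫 vtab + 4 * 𝐫 vq0 + 1)) ;; vj ≔ 𝐫 vj + 1

/-- Report that there is no feasible schedule if the value of the whole problem is `M`, and write
the optimal schedule otherwise. -/
def readOut : Cmd :=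
  .ite (𝐫 vM ≼ 𝐦 (𝐫 vtab + 4 * (((𝐫 vn * 𝐫 vm * 𝐫 vm + 1) * 𝐫 vB) * (𝐫 vk + 1) + 𝐫 vk)))
    (.store 0 0)
    (vj ≔ 0 ;; .loop (𝐫 vj + 1 ≼ 𝐫 vn) readJob ;; .store 0 1)

/-- The position `a` belongs to a solvable subproblem of the first `i` jobs whose window contains
job `j`. -/
def DP.Contains (D : DP) (t : DP.Table) (i a j : ℕ) : Prop :=
  ∃ l r b c, l < D.m ∧ r < D.m ∧ b ≤ D.B ∧ c ≤ D.k ∧ a = D.cell i l r b c ∧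
    t.cost (D.cell i l r b c) < D.M ∧ D.time l < D.rel j ∧ D.rel j ≤ D.time r

theorem DP.Correct.descend {D : DP} {n : ℕ} {t : DP.Table} (ht : D.Correct n t) (hM : 0 ≤ D.M)
    {i a j : ℕ} (hi : i < n) (hj : j < i) (h : D.Contains t (i + 1) a j) :
    ∃ a' : ℕ, (if D.rel j ≤ t.start a then t.left a else t.right a) = a' ∧ D.Contains t i a' j ∧
      D.schedule t (i + 1) a j = D.schedule t i a' j := by
  obtain ⟨l, r, b, c, hl, hr, hb, hc, rfl, hcost, h1, h2⟩ := h
  have hsched : ∀ a', (if D.rel j ≤ t.start (D.cell (i + 1) l r b c) then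
      t.left (D.cell (i + 1) l r b c) else t.right (D.cell (i + 1) l r b c)) = (a' : ℕ) →
      D.schedule t (i + 1) (D.cell (i + 1) l r b c) j = D.schedule t i a' j := by
    intro a' ha'
    rw [schedule, if_neg hj.ne]
    split_ifs at ha' ⊢ <;> rw [ha', Int.toNat_natCast]
  suffices H : ∃ a' : ℕ, (if D.rel j ≤ t.start (D.cell (i + 1) l r b c) then
      t.left (D.cell (i + 1) l r b c) else t.right (D.cell (i + 1) l r b c)) = (a' : ℕ) ∧
      D.Contains t i a' j by
    obtain ⟨a', h, h'⟩ := H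
    exact ⟨a', h, h', hsched a' h⟩
  obtain ⟨e1, e2⟩ := ht.succ i hi l hl r hr b hb c hc
  by_cases hw : D.time l < D.rel i ∧ D.rel i ≤ D.time r
  · rcases (e2 hw).attained with h | ⟨b', rfl, -, h3, h4, h5, hv⟩ |
      ⟨x, hx, c₁, c₂, -, h3, h4, h5, h6, -, h7, h8, h9, hv⟩
    · omega
    · refine ⟨D.cell i l r b' c, by rw [h5, h4]; simp, l, r, b', c, hl, hr, by omega, hc, rfl, ?_,
        h1, h2⟩
      omega
    · have := ht.cost_nonneg hM i hi.le l hl x hx D.B le_rfl c₁ (by omega)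
      have := ht.cost_nonneg hM i hi.le x hx r hr b hb c₂ (by omega)
      by_cases hle : D.rel j ≤ D.time x
      · exact ⟨_, by rw [h7, if_pos hle, h8], l, x, D.B, c₁, hl, hx, le_rfl, by omega, rfl,
          by omega, h1, hle⟩
      · exact ⟨_, by rw [h7, if_neg hle, h9], x, r, b, c₂, hx, hr, hb, by omega, rfl,
          by omega, by omega, h2⟩
  · obtain ⟨h3, h4, h5⟩ := e1 hw
    exact ⟨D.cell i l r b c, by rw [h4, h5]; simp, l, r, b, c, hl, hr, hb, hc, rfl, by omega,
      h1, h2⟩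

variable {I : BatchInstance} {m : ℕ} {A : ℤ} {S V : ℕ} {μ₀ μ : ℕ → ℤ} {σ : State}

theorem DP.Contains.lt (hR : Room I m A S V) {i a j : ℕ} {t : DP.Table} (hi : i ≤ I.n)
    (h : (dataOf I m A μ₀).Contains t i a j) : 4 + 5 * I.n + m + 4 * a + 3 < S := by
  obtain ⟨l, r, b, c, hl, hr, hb, hc, rfl, -⟩ := h
  have hB : (dataOf I m A μ₀).B = I.B - 1 := rfl
  have := I.B_pos
  exact hR.cell_lt hi hl hr (by omega) hc

theorem runs_descend (hR : Room I m A S V) (hf : Full I m A μ₀ ⟨σ.reg, μ⟩)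
    (hν : ∀ a, 4 + 2 * I.n ≤ a → σ.mem a = μ a) {pos a : ℕ} (hpos : pos < I.n)
    (hreg : σ.reg vpos = pos) (hi : σ.reg vi = I.n) (hq : σ.reg vq0 = a)
    (ha : (dataOf I m A μ₀).Contains (tableOf I m μ) I.n a pos) {j : ℕ} (hj : σ.reg vj = j) :
    Runs S V descend σ ((I.n + 1) * 100) fun σ' => Consts I m A σ' ∧ σ'.mem = σ.mem ∧
      σ'.reg vj = j ∧ ∃ a' : ℕ, σ'.reg vq0 = a' ∧ 4 + 5 * I.n + m + 4 * a' + 3 < S ∧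
        (tableOf I m μ).start a' = (dataOf I m A μ₀).schedule (tableOf I m μ) I.n a pos := by
  obtain ⟨hc, hframe, hcorr⟩ := hf
  have hM : 0 ≤ (dataOf I m A μ₀).M := by
    have := hR.bounds
    exact (by omega : (0 : ℤ) ≤ I.n * (A + A))
  have hS := hR.S_le
  have hc' : Consts I m A σ := ⟨hc.n_eq, hc.k_eq, hc.B_eq, hc.p_eq, hc.m_eq, hc.rel_eq, hc.dl_eq,
    hc.rank_eq, hc.time_eq, hc.tab_eq, hc.A_eq, hc.M_eq⟩
  have htab := hR.table
  have hrelpos : μ (4 + 2 * I.n + pos) = (dataOf I m A μ₀).rel pos := by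
    simp only [dataOf, hpos, if_true]
    exact hframe _ (by omega)
  refine Runs.mono (Runs.loop hR.le_V (e := 𝐫 vpos + 2 ≼ 𝐫 vi) (c := descendStep) rfl
    (N := I.n - 1 - pos) (t := descendStep.steps) (fun y σ' => Consts I m A σ' ∧ σ'.mem = σ.mem ∧
      σ'.reg vj = j ∧ σ'.reg vpos = pos ∧ ∃ i a' : ℕ, i + y = I.n ∧ σ'.reg vi = i ∧
        σ'.reg vq0 = a' ∧
        (dataOf I m A μ₀).Contains (tableOf I m μ) i a' pos ∧
        (dataOf I m A μ₀).schedule (tableOf I m μ) i a' pos =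
          (dataOf I m A μ₀).schedule (tableOf I m μ) I.n a pos) ?_ ?_ ?_) ?_ ?_
  · rintro y hy σ' ⟨-, -, -, h1, i, a', h2, h3, -⟩
    refine ⟨by simp [Expr.Safe], ?_⟩
    simp only [Expr.val, h1, h3]
    congr 1
    simp only [eq_iff_iff]
    omega
  · rintro y hy σ' ⟨c1, c2, c3, h1, i, a', h2, h3, h4, h5, h6⟩
    obtain ⟨i, rfl⟩ : ∃ i', i = i' + 1 := ⟨i - 1, by omega⟩
    have l1 := h5.lt hR (by omega)
    obtain ⟨a'', g1, g2, g3⟩ := hcorr.descend hM (by omega) (by omega) h5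
    have l2 := g2.lt hR (by omega)
    have e1 : σ.mem (4 + 2 * (I.n : ℤ) + pos).toNat = (dataOf I m A μ₀).rel pos := by
      rw [← hrelpos, ← hν _ (by omega)]; congr 1
    have e2 : σ.mem (4 + 5 * (I.n : ℤ) + m + 4 * a' + 1).toNat = (tableOf I m μ).start a' := by
      simp only [tableOf]; rw [← hν _ (by omega)]; congr 1
    have e3 : σ.mem (4 + 5 * (I.n : ℤ) + m + 4 * a' + 2).toNat = (tableOf I m μ).left a' := by
      simp only [tableOf]; rw [← hν _ (by omega)]; congr 1
    have e4 : σ.mem (4 + 5 * (I.n : ℤ) + m + 4 * a' + 3).toNat = (tableOf I m μ).right a' := by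
      simp only [tableOf]; rw [← hν _ (by omega)]; congr 1
    have l3 : |(i : ℤ)| ≤ V := by rw [abs_le]; omega
    have l4 : |(a'' : ℤ)| ≤ V := by rw [abs_le]; omega
    have hfin : ∀ v : ℤ, v = a'' → Consts I m A ((σ'.set vq0 v).set vi i) ∧ σ'.reg vj = j ∧
        ∃ i₁ a₁ : ℕ, i₁ + (y + 1) = I.n ∧ (i : ℤ) = i₁ ∧ v = a₁ ∧
          (dataOf I m A μ₀).Contains (tableOf I m μ) i₁ a₁ pos ∧
          (dataOf I m A μ₀).schedule (tableOf I m μ) i₁ a₁ pos =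
            (dataOf I m A μ₀).schedule (tableOf I m μ) I.n a pos := fun v hv =>
      ⟨(c1.set (by norm_num) _).set (by norm_num) _, c3, i, a'', by omega, rfl, hv, g2,
        g3.symm.trans h6⟩
    have hcast : ((i + 1 : ℕ) : ℤ) - 1 = i := by push_cast; ring
    refine Runs.of_wp hR.le_V rfl ?_
    simp only [descendStep, Cmd.wp, Expr.val, Expr.Safe, Expr.val_sub, Expr.safe_sub,
      State.set_reg, State.set_mem, Nat.reduceEqDiff, if_true, if_false, c1.rel_eq, c1.tab_eq,
      h1, h3, h4, c2, e1, e2, e3, e4, true_and, and_true, ne_eq, ite_eq_right_iff, one_ne_zero,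
      imp_false, not_not, hcast]
    refine ⟨by omega, fun hle => ⟨by omega, ?_, l3, ?_⟩, fun hle => ⟨by omega, ?_, l3, ?_⟩⟩
    · rw [if_pos hle] at g1; rw [g1]; exact l4
    · rw [if_pos hle] at g1; exact hfin _ g1
    · rw [if_neg hle] at g1; rw [g1]; exact l4
    · rw [if_neg hle] at g1; exact hfin _ g1
  · exact ⟨hc', rfl, hj, hreg, I.n, a, rfl, hi, hq, ha, rfl⟩
  · refine Nat.mul_le_mul (by omega) ?_
    decide
  · rintro σ' - ⟨c1, c2, c3, h1, i, a', h2, h3, h4, h5, h6⟩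
    obtain rfl : i = pos + 1 := by omega
    refine ⟨c1, c2, c3, a', h4, h5.lt hR (by omega), ?_⟩
    rw [← h6, DP.schedule, if_pos rfl]

theorem runs_readJob (hR : Room I m A S V) (hf : Full I m A μ₀ ⟨σ.reg, μ⟩)
    (hν : ∀ a, 4 + 2 * I.n ≤ a → σ.mem a = μ a) {rank : Fin I.n → ℕ}
    (hrank : ∀ j : Fin I.n, μ₀ (4 + 4 * I.n + j) = rank j)
    (hD : (dataOf I m A μ₀).Solves I rank)
    (htop : (tableOf I m μ).cost ((dataOf I m A μ₀).top I.n) < (dataOf I m A μ₀).M)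
    (j : Fin I.n) (hj : σ.reg vj = (j : ℕ)) :
    Runs S V readJob σ ((I.n + 1) * 200) fun σ' => Consts I m A σ' ∧
      (∀ a, a ≠ (j : ℕ) + 1 → σ'.mem a = σ.mem a) ∧ σ'.reg vj = ((j : ℕ) + 1 : ℕ) ∧
      σ'.mem ((j : ℕ) + 1) = (dataOf I m A μ₀).schedule (tableOf I m μ) I.n
        ((dataOf I m A μ₀).top I.n) (rank j) := fun hbd => by
  have hbm := hbd.mem
  revert hbd
  have hS := hR.S_le
  have htab := hR.table
  have hm := hR.m_pos
  have hBp := I.B_pos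
  have hjn := j.2
  obtain ⟨hc, hframe, hcorr⟩ := id hf
  have hc' : Consts I m A σ := ⟨hc.n_eq, hc.k_eq, hc.B_eq, hc.p_eq, hc.m_eq, hc.rel_eq, hc.dl_eq,
    hc.rank_eq, hc.time_eq, hc.tab_eq, hc.A_eq, hc.M_eq⟩
  have e1 : σ.mem (4 + 4 * (I.n : ℤ) + (j : ℕ)).toNat = rank j := by
    have h1 := hframe (4 + 4 * I.n + j) (by omega)
    have h2 := hν (4 + 4 * I.n + j) (by omega)
    rw [← hrank, ← h1]
    exact h2 ▸ congrArg σ.mem (by omega)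
  have e2 : ((I.n : ℤ) * m * m + 1) * I.B * (I.k + 1) + I.k = ((dataOf I m A μ₀).top I.n : ℕ) := by
    have := cell_cast I m A μ₀ I.n 0 1 0 I.k
    rw [DP.top]
    exact (by push_cast; ring : _ = _).trans this
  have hrk := hD.lt j
  have hwin : rank j ∈ window (dataOf I m A μ₀).rel I.n ((dataOf I m A μ₀).time 0)
      ((dataOf I m A μ₀).time 1) := by
    rw [hD.window_eq]; exact Finset.mem_image_of_mem _ (Finset.mem_univ _)
  rw [mem_window] at hwin
  have hcont : (dataOf I m A μ₀).Contains (tableOf I m μ) I.n ((dataOf I m A μ₀).top I.n)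
      (rank j) := ⟨0, 1, 0, I.k, by simp only [dataOf]; omega, by simp only [dataOf]; omega,
    by omega, le_rfl, rfl, htop, hwin.2.1, hwin.2.2⟩
  have l1 := hcont.lt hR le_rfl
  refine Runs.mono (t := 50 + ((I.n + 1) * 100 + 50)) (Runs.seq ((Runs.of_wp hR.le_V rfl
    (Q := fun σ' => Consts I m A σ' ∧ σ'.mem = σ.mem ∧ σ'.reg vpos = rank j ∧ σ'.reg vi = I.n ∧
      σ'.reg vq0 = ((dataOf I m A μ₀).top I.n : ℕ) ∧ σ'.reg vj = (j : ℕ)) ?_).mono (by decide)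
    fun σ₁ _ h₁ => Runs.seq ((runs_descend hR (μ := μ) (μ₀ := μ₀) (σ := σ₁) ⟨?_, hframe, hcorr⟩ ?_
      hrk h₁.2.2.1 h₁.2.2.2.1 h₁.2.2.2.2.1 hcont h₁.2.2.2.2.2).mono le_rfl
      fun σ₂ _ h₂ => (Runs.of_wp hR.le_V rfl ?_).mono (by decide) fun _ _ h => h)))
      (by omega) fun _ _ h => h
  · simp only [Cmd.wp, Expr.val, Expr.Safe, State.set_reg, State.set_mem, Nat.reduceEqDiff,
      if_true, if_false, hc'.rank_eq, hc'.n_eq, hc'.m_eq, hc'.B_eq, hc'.k_eq, hj, e1, e2, true_and,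
      and_true, Nat.abs_cast]
    refine ⟨by omega, by omega, by omega, by omega, ?_⟩
    repeat' first | exact hc' | refine Consts.set ?_ (by norm_num) _
  · obtain ⟨c1, -⟩ := h₁
    exact ⟨c1.n_eq, c1.k_eq, c1.B_eq, c1.p_eq, c1.m_eq, c1.rel_eq, c1.dl_eq,
      c1.rank_eq, c1.time_eq, c1.tab_eq, c1.A_eq, c1.M_eq⟩
  · rw [h₁.2.1]; exact hν
  · obtain ⟨c1, c2, c3, a', c4, c5, c6⟩ := h₂
    have e3 : σ.mem (4 + 5 * (I.n : ℤ) + m + 4 * a' + 1).toNat = (tableOf I m μ).start a' := by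
      simp only [tableOf]; rw [← hν _ (by omega)]; congr 1
    have e4 : (((j : ℕ) : ℤ) + 1).toNat = j + 1 := by omega
    have g : |(tableOf I m μ).start a'| ≤ V := e3 ▸ hbm _
    have g' : |((j : ℕ) : ℤ) + 1| ≤ V := by rw [abs_le]; omega
    simp only [Cmd.wp, Expr.val, Expr.Safe, State.set_reg, State.set_mem, State.write_mem,
      State.write_reg,
      if_true, c1.tab_eq, c2, c3, c4, h₁.2.1, e3, e4, true_and, and_true, c6]
    rw [c6] at g
    refine ⟨by omega, by omega, g, g', ?_, fun a ha => by rw [if_neg ha], by push_cast; rfl⟩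
    refine Consts.set ?_ (by norm_num) _
    exact ⟨c1.n_eq, c1.k_eq, c1.B_eq, c1.p_eq, c1.m_eq, c1.rel_eq, c1.dl_eq,
      c1.rank_eq, c1.time_eq, c1.tab_eq, c1.A_eq, c1.M_eq⟩

theorem runs_readOut (hR : Room I m A S V) (hf : Full I m A μ₀ σ) {rank : Fin I.n → ℕ}
    (hrank : ∀ j : Fin I.n, μ₀ (4 + 4 * I.n + j) = rank j)
    (hD : (dataOf I m A μ₀).Solves I rank) :
    Runs S V readOut σ ((I.n + 1) * ((I.n + 1) * 300) + 100) (CorrectOutput I) := by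
  have hS := hR.S_le
  have hV := hR.le_V
  have htab := hR.table
  have hm := hR.m_pos
  have hBp := I.B_pos
  have hc := hf.consts
  obtain ⟨hno, hyes⟩ := hD.correct hf.correct
  have e2 : ((I.n : ℤ) * m * m + 1) * I.B * (I.k + 1) + I.k = ((dataOf I m A μ₀).top I.n : ℕ) := by
    have := cell_cast I m A μ₀ I.n 0 1 0 I.k
    rw [DP.top]
    exact (by push_cast; ring : _ = _).trans this
  have l1 : 4 + 5 * I.n + m + 4 * (dataOf I m A μ₀).top I.n + 3 < S :=
    hR.cell_lt le_rfl (by omega) (by omega) hBp le_rfl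
  refine Runs.mono (t := Expr.cost _ + 1 + (10 + ((I.n + 1) * ((I.n + 1) * 300) + 10)))
    (Runs.ite (t := 10 + ((I.n + 1) * ((I.n + 1) * 300) + 10)) hR.le_V rfl ?_ (fun h => ?_)
    fun h => ?_) (by simp only [Expr.cost]; omega) fun _ _ h => h
  · simp only [Expr.Safe, Expr.val, hc.n_eq, hc.m_eq, hc.B_eq, hc.k_eq, hc.tab_eq, e2]
    simp only [true_and, and_true]
    omega
  · refine (Runs.of_wp hR.le_V rfl ?_).mono (t := 3) ?_ fun _ _ h => h
    · simp only [Expr.val, hc.n_eq, hc.m_eq, hc.B_eq, hc.k_eq, hc.tab_eq, hc.M_eq, e2, load_cost,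
        ne_eq, ite_eq_right_iff, one_ne_zero, imp_false, not_not] at h
      simp only [Cmd.wp, Expr.val, Expr.Safe, true_and, abs_zero, Nat.cast_nonneg]
      exact ⟨by omega, .inl ⟨by simp [State.write], hno h⟩⟩
    · omega
  · simp only [Expr.val, hc.n_eq, hc.m_eq, hc.B_eq, hc.k_eq, hc.tab_eq, hc.M_eq, e2, load_cost,
      ite_eq_right_iff, one_ne_zero, imp_false, not_le] at h
    refine Runs.seq ((Runs.of_wp hR.le_V rfl (Q := fun σ' => Consts I m A σ' ∧
      (∀ a, 4 + 2 * I.n ≤ a → σ'.mem a = σ.mem a) ∧ σ'.reg vj = (0 : ℕ) ∧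
      ∀ i : Fin I.n, (i : ℕ) < 0 → σ'.mem (i + 1) = (dataOf I m A μ₀).schedule (tableOf I m σ.mem)
        I.n ((dataOf I m A μ₀).top I.n) (rank i)) ?_).mono (by decide) fun σ₁ _ h₁ =>
      Runs.seq (Runs.mono (Runs.loop hR.le_V (N := I.n) (t := (I.n + 1) * 200) rfl
        (fun j σ' => Consts I m A σ' ∧
          (∀ a, 4 + 2 * I.n ≤ a → σ'.mem a = σ.mem a) ∧ σ'.reg vj = (j : ℕ) ∧
          ∀ i : Fin I.n, (i : ℕ) < j → σ'.mem (i + 1) =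
            (dataOf I m A μ₀).schedule (tableOf I m σ.mem) I.n ((dataOf I m A μ₀).top I.n) (rank i))
        ?_ ?_ h₁) ?_ fun σ₂ _ h₂ => (Runs.of_wp hR.le_V rfl ?_).mono (by decide) fun _ _ h => h))
    · simp only [Cmd.wp, Expr.val, Expr.Safe, State.set_reg, State.set_mem, true_and, abs_zero,
        Nat.cast_nonneg, if_true]
      exact ⟨hc.set (by norm_num) _, fun _ _ => trivial, by simp, fun i hi => by omega⟩
    · rintro q hq σ' ⟨c1, -, c2, -⟩
      refine ⟨by simp [Expr.Safe], ?_⟩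
      simp only [Expr.val, c1.n_eq, c2]
      congr 1
      simp only [eq_iff_iff]
      omega
    · rintro q hq σ' ⟨c1, c2, c3, c4⟩
      refine (runs_readJob hR (σ := σ') (μ := σ.mem) (μ₀ := μ₀) ⟨?_, hf.frame, hf.correct⟩ c2 hrank
        hD h
        ⟨q, hq⟩ c3).mono le_rfl ?_
      · exact ⟨c1.n_eq, c1.k_eq, c1.B_eq, c1.p_eq, c1.m_eq, c1.rel_eq, c1.dl_eq,
          c1.rank_eq, c1.time_eq, c1.tab_eq, c1.A_eq, c1.M_eq⟩
      · rintro σ₃ - ⟨d1, d2, d3, d4⟩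
        refine ⟨d1, fun a ha => ?_, d3, fun i hi => ?_⟩
        · rw [d2 a (by simp only; omega), c2 a ha]
        · rcases Nat.lt_succ_iff_lt_or_eq.mp hi with hlt | heq
          · rw [d2 _ (by simp only; omega), c4 i hlt]
          · obtain rfl : i = ⟨q, hq⟩ := Fin.ext heq
            exact d4
    · refine Nat.mul_le_mul le_rfl ?_
      simp only [Expr.cost]
      omega
    · obtain ⟨c1, c2, c3, c4⟩ := h₂
      simp only [Cmd.wp, Expr.val, Expr.Safe, true_and, abs_one]
      refine ⟨by omega, by omega, .inr ⟨by simp [State.write], ?_⟩⟩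
      convert hyes h using 2 with j
      rw [← c4 j j.2]
      simp [State.write]

end BatchScheduling

namespace BatchScheduling

variable {I : BatchInstance} {m : ℕ} {S V : ℕ} {μ : ℕ → ℤ} {σ : State}

/-! ### Setting up and sorting -/

/-- Load `n` and `p`, and compute `horizon`. -/
def sumSquares : Cmd :=
  (vn ≔ 𝐦 0 ;; vp ≔ 𝐦 3 ;; vA ≔ 𝐫 vp ;; vx ≔ 0) ;;
  .loop (𝐫 vx + 1 ≼ 𝐫 vn + 𝐫 vn) (vA ≔ 𝐫 vA + 𝐦 (4 + 𝐫 vx) * 𝐦 (4 + 𝐫 vx) ;; vx ≔ 𝐫 vx + 1)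

/-- Set the registers that do not change, for `e` candidate times, and the first two of these, which
lie before and after everything. -/
def setConsts (e : Expr) : Cmd :=
  vk ≔ 𝐦 1 ;; vB ≔ 𝐦 2 ;; vm ≔ e ;;
  vrel ≔ 4 + 2 * 𝐫 vn ;; vdl ≔ 4 + 3 * 𝐫 vn ;; vrank ≔ 4 + 4 * 𝐫 vn ;; vtime ≔ 4 + 5 * 𝐫 vn ;;
  vtab ≔ 4 + 5 * 𝐫 vn + 𝐫 vm ;; vM ≔ 𝐫 vn * (𝐫 vA + 𝐫 vA) ;;
  .store (𝐫 vtime) (0 - 𝐫 vA) ;; .store (𝐫 vtime + 1) (𝐫 vA)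

/-- The bound on release times and deadlines that the program uses: `p` plus the sum of all their
squares, which is computed without comparisons. -/
def horizon (I : BatchInstance) : ℤ :=
  I.p + ∑ x ∈ Finset.range (I.n + I.n), (initialState I).mem (4 + x) ^ 2

theorem initialState_release (j : Fin I.n) : (initialState I).mem (4 + j) = I.release j := by
  simp only [initialState]
  rw [if_neg (by omega), if_neg (by omega), if_neg (by omega), if_neg (by omega),
    dif_pos (by omega)]
  congr 1
  ext
  simp

theorem initialState_deadline (j : Fin I.n) :
    (initialState I).mem (4 + I.n + j) = I.deadline j := by
  simp only [initialState]
  rw [if_neg (by omega), if_neg (by omega), if_neg (by omega), if_neg (by omega),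
    dif_neg (by omega), dif_pos (by omega)]
  congr 1
  ext
  simp only
  omega

theorem initialState_zero {a : ℕ} (ha : 4 + 2 * I.n ≤ a) : (initialState I).mem a = 0 := by
  have := I.n_pos
  simp only [initialState]
  rw [if_neg (by omega), if_neg (by omega), if_neg (by omega), if_neg (by omega),
    dif_neg (by omega), dif_neg (by omega)]

theorem le_horizon (I : BatchInstance) : (I.p : ℤ) ≤ horizon I :=
  le_add_of_nonneg_right (Finset.sum_nonneg fun _ _ => sq_nonneg _)

theorem abs_add_le_horizon {x : ℕ} (hx : x < I.n + I.n) :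
    |(initialState I).mem (4 + x)| + I.p ≤ horizon I := by
  have h1 : (initialState I).mem (4 + x) ^ 2 ≤
      ∑ x ∈ Finset.range (I.n + I.n), (initialState I).mem (4 + x) ^ 2 :=
    Finset.single_le_sum (f := fun x => (initialState I).mem (4 + x) ^ 2)
      (fun _ _ => sq_nonneg _) (Finset.mem_range.mpr hx)
  have h2 : |(initialState I).mem (4 + x)| ≤ (initialState I).mem (4 + x) ^ 2 := by
    rw [← sq_abs]
    rcases (abs_nonneg ((initialState I).mem (4 + x))).eq_or_lt with h | h
    · rw [← h]; norm_num
    · nlinarith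
  simp only [horizon]
  omega

theorem abs_release_le (j : Fin I.n) : |I.release j| + I.p ≤ horizon I := by
  rw [← initialState_release]
  exact abs_add_le_horizon (by omega)

theorem abs_deadline_le (j : Fin I.n) : |I.deadline j| + I.p ≤ horizon I := by
  rw [← initialState_deadline, add_assoc]
  exact abs_add_le_horizon (by omega)

theorem runs_sumSquares (hR : Room I m (horizon I) S V) :
    Runs S V sumSquares (initialState I) ((I.n + 1) * 60) fun σ =>
      σ.mem = (initialState I).mem ∧ σ.reg vn = I.n ∧ σ.reg vp = I.p ∧ σ.reg vA = horizon I := by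
  have hS := hR.S_le
  have htab := hR.table
  have hn := I.n_pos
  have hp := hR.p_le
  have hval := hR.bounds
  have hn0 : (initialState I).mem 0 = I.n := rfl
  have hp0 : (initialState I).mem 3 = I.p := rfl
  refine Runs.mono (t := 20 + ((2 * I.n + 1) * 24)) (Runs.seq ((Runs.of_wp hR.le_V rfl ?_).mono
    (by decide) fun σ' _ h' => Runs.mono (Runs.loop hR.le_V rfl (N := I.n + I.n)
      (fun q σ => σ.mem = (initialState I).mem ∧ σ.reg vn = I.n ∧ σ.reg vp = I.p ∧
        σ.reg vA = I.p + ∑ x ∈ Finset.range q, (initialState I).mem (4 + x) ^ 2 ∧ σ.reg vx = q)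
      ?_ (fun q hq σ hσ => Runs.of_wp hR.le_V rfl ?_) h')
      ?_ fun σ₂ _ h₂ => ⟨h₂.1, h₂.2.1, h₂.2.2.1, h₂.2.2.2.1⟩)) (by omega) fun _ _ h => h
  · simp only [Cmd.wp, Expr.val, Expr.Safe, State.set_reg, State.set_mem, Nat.reduceEqDiff,
      if_true, if_false, true_and, and_true, Int.toNat_zero, Int.reduceToNat, hn0, hp0, abs_zero,
      Nat.abs_cast, Finset.range_zero, Finset.sum_empty, add_zero, Nat.cast_zero, Nat.cast_nonneg]
    omega
  · rintro q hq σ ⟨-, h1, -, -, h2⟩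
    refine ⟨by simp [Expr.Safe], ?_⟩
    simp only [Expr.val, h1, h2]
    congr 1
    simp only [eq_iff_iff]
    omega
  · obtain ⟨h1, h2, h3, h4, h5⟩ := hσ
    have e : (4 + (q : ℤ)).toNat = 4 + q := by omega
    have hsum := Finset.sum_range_succ (fun x => (initialState I).mem (4 + x) ^ 2) q
    have hle : ∑ x ∈ Finset.range (q + 1), (initialState I).mem (4 + x) ^ 2 ≤
        ∑ x ∈ Finset.range (I.n + I.n), (initialState I).mem (4 + x) ^ 2 :=
      Finset.sum_le_sum_of_subset_of_nonneg (Finset.range_mono (by omega))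
        fun _ _ _ => sq_nonneg _
    have h0 : 0 ≤ ∑ x ∈ Finset.range (q + 1), (initialState I).mem (4 + x) ^ 2 :=
      Finset.sum_nonneg fun _ _ => sq_nonneg _
    have hA : horizon I = I.p + ∑ x ∈ Finset.range (I.n + I.n),
      (initialState I).mem (4 + x) ^ 2 := rfl
    have e2 : (I.p : ℤ) + ∑ x ∈ Finset.range q, (initialState I).mem (4 + x) ^ 2 +
        (initialState I).mem (4 + q) * (initialState I).mem (4 + q) =
        I.p + ∑ x ∈ Finset.range (q + 1), (initialState I).mem (4 + x) ^ 2 := by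
      rw [hsum]; ring
    simp only [Cmd.wp, Expr.val, Expr.Safe, State.set_reg, State.set_mem, Nat.reduceEqDiff,
      if_true, if_false, true_and, and_true, h1, h2, h3, h4, h5, e, e2]
    refine ⟨by omega, ?_, ?_, by push_cast; rfl⟩
    · rw [abs_le]; omega
    · rw [abs_le]; omega
  · refine Nat.mul_le_mul (by omega) ?_
    decide

/-- The first two of `m` candidate times are written; the memory outside the array of candidate
times is as in the beginning. -/
structure Started (I : BatchInstance) (m : ℕ) (σ : State) : Prop where
  consts : Consts I m (horizon I) σ
  first : σ.mem (4 + 5 * I.n) = - horizon I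
  second : σ.mem (4 + 5 * I.n + 1) = horizon I
  other : ∀ a, a < 4 + 5 * I.n ∨ 4 + 5 * I.n + m ≤ a → σ.mem a = (initialState I).mem a

theorem runs_setConsts (hR : Room I m (horizon I) S V) {e : Expr}
    (he : (setConsts e).straight = true)
    (hsteps : (setConsts e).steps ≤ 100) (hsafe : ∀ σ : State, e.Safe S σ)
    (hval : ∀ σ : State, σ.reg vn = (I.n : ℤ) → e.val σ = (m : ℤ))
    (h : σ.mem = (initialState I).mem ∧ σ.reg vn = I.n ∧ σ.reg vp = I.p ∧
      σ.reg vA = horizon I) :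
    Runs S V (setConsts e) σ 100 (Started I m) := by
  obtain ⟨h1, h2, h3, h4⟩ := h
  have hS := hR.S_le
  have htab := hR.table
  have hn := I.n_pos
  have hp := hR.p_le
  have hk := hR.k_lt
  have hb := hR.bounds
  have hm := hR.m_pos
  have hM : |(I.n : ℤ) * (horizon I + horizon I)| ≤ V := by rw [abs_le]; omega
  have hk0 : (initialState I).mem 1 = I.k := rfl
  have hB0 : (initialState I).mem 2 = I.B := rfl
  refine (Runs.of_wp hR.le_V he ?_).mono hsteps fun _ _ h => h
  have hval' : ∀ v w, e.val ((σ.set vk v).set vB w) = m := fun v w => hval _ (by simpa using h2)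
  have e1 : ∀ z : ℕ, (z : ℤ).toNat = z := Int.toNat_natCast
  have e2 : (4 + 5 * (I.n : ℤ)).toNat = 4 + 5 * I.n := by omega
  have e3 : (4 + 5 * (I.n : ℤ) + 1).toNat = 4 + 5 * I.n + 1 := by omega
  simp only [setConsts, Cmd.wp, Expr.val, Expr.Safe, Expr.val_sub, Expr.safe_sub,
    State.set_reg, State.set_mem, State.write_reg, Nat.reduceEqDiff, if_true, if_false, true_and,
    and_true, h1, h2, h4, hval', hsafe, hk0, hB0, Int.reduceToNat, Nat.abs_cast, e2, e3]
  refine ⟨by omega, by omega, by omega, by omega, by omega, by rw [abs_le]; omega,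
    by rw [abs_le]; omega, by rw [abs_le]; omega, by rw [abs_le]; omega, by rw [abs_le]; omega,
    hM, by omega, by rw [abs_le]; omega, by omega, by rw [abs_le]; omega, ?_⟩
  refine ⟨?_, ?_, ?_, fun a ha => ?_⟩
  · constructor <;> simp [h2, h3, h4]
  · simp
  · simp
  · simp only [State.write_mem, State.set_mem, h1]
    rw [if_neg (by omega), if_neg (by omega)]

/-- Add one to the place of the current job if job `x` has a smaller key. -/
def rankStep : Cmd :=
  vpos ≔ 𝐫 vpos + (1 - (𝐫 vkey ≼ 𝐦 (4 + 𝐫 vn + 𝐫 vx) * 𝐫 vn + 𝐫 vx)) ;; vx ≔ 𝐫 vx + 1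

/-- Count the jobs with a smaller key than the current one, and put it at that place. -/
def placeJob : Cmd :=
  (vkey ≔ 𝐦 (4 + 𝐫 vn + 𝐫 vj) * 𝐫 vn + 𝐫 vj ;; vpos ≔ 0 ;; vx ≔ 0) ;;
  .loop (𝐫 vx + 1 ≼ 𝐫 vn) rankStep ;;
  .store (𝐫 vrel + 𝐫 vpos) (𝐦 (4 + 𝐫 vj)) ;;
  .store (𝐫 vdl + 𝐫 vpos) (𝐦 (4 + 𝐫 vn + 𝐫 vj)) ;;
  .store (𝐫 vrank + 𝐫 vj) (𝐫 vpos) ;;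
  vj ≔ 𝐫 vj + 1

/-- Fill the arrays of ranks, and of release times and deadlines in deadline order. -/
def sortJobs : Cmd := vj ≔ 0 ;; .loop (𝐫 vj + 1 ≼ 𝐫 vn) placeJob

/-- The key by which jobs are sorted: by deadline, and by index for equal deadlines. -/
def sortKey (I : BatchInstance) (j : ℕ) : ℤ := (initialState I).mem (4 + I.n + j) * I.n + j

/-- The number of jobs with a smaller key. -/
def sortRank (I : BatchInstance) (j : ℕ) : ℕ :=
  ((Finset.range I.n).filter fun i => sortKey I i < sortKey I j).card

theorem sortRank_lt_sortRank {i j : ℕ} (hi : i < I.n) (h : sortKey I i < sortKey I j) :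
    sortRank I i < sortRank I j := by
  refine Finset.card_lt_card ⟨fun x hx => ?_, fun hsub => ?_⟩
  · rw [Finset.mem_filter] at hx ⊢
    exact ⟨hx.1, hx.2.trans h⟩
  · have := hsub (Finset.mem_filter.mpr ⟨Finset.mem_range.mpr hi, h⟩)
    simp at this

theorem sortRank_lt {j : ℕ} (hj : j < I.n) : sortRank I j < I.n := by
  conv_rhs => rw [← Finset.card_range I.n]
  refine Finset.card_lt_card ?_
  rw [Finset.filter_ssubset]
  exact ⟨j, by simpa using hj, by simp⟩

theorem deadline_le_of_sortKey_le {i j : ℕ} (hj : j < I.n)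
    (h : sortKey I i ≤ sortKey I j) :
    (initialState I).mem (4 + I.n + i) ≤ (initialState I).mem (4 + I.n + j) := by
  by_contra! hlt
  simp only [sortKey] at h
  have hn : (0 : ℤ) < I.n := by omega
  have := mul_le_mul_of_nonneg_right (Int.add_one_le_of_lt hlt) hn.le
  rw [add_mul] at this
  omega

theorem sortRank_injective {i j : ℕ} (hi : i < I.n) (hj : j < I.n)
    (h : sortRank I i = sortRank I j) : i = j := by
  have h1 : sortKey I i = sortKey I j := by
    rcases lt_trichotomy (sortKey I i) (sortKey I j) with h' | h' | h'
    · have := sortRank_lt_sortRank hi h'; omega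
    · exact h'
    · have := sortRank_lt_sortRank hj h'; omega
  have h2 := le_antisymm (deadline_le_of_sortKey_le hj h1.le)
    (deadline_le_of_sortKey_le hi h1.ge)
  simp only [sortKey, h2] at h1
  omega

/-- The invariant of sorting: the jobs before `j` are in their places. -/
structure Sorting (I : BatchInstance) (m : ℕ) (μ : ℕ → ℤ) (j : ℕ) (σ : State) : Prop where
  consts : Consts I m (horizon I) σ
  j_eq : σ.reg vj = j
  frame : ∀ a, a < 4 + 2 * I.n ∨ 4 + 5 * I.n ≤ a → σ.mem a = μ a
  rel : ∀ i < j, σ.mem (4 + 2 * I.n + sortRank I i) = (initialState I).mem (4 + i)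
  dl : ∀ i < j, σ.mem (4 + 3 * I.n + sortRank I i) = (initialState I).mem (4 + I.n + i)
  rank : ∀ i < j, σ.mem (4 + 4 * I.n + i) = sortRank I i

theorem runs_placeJob (hR : Room I m (horizon I) S V)
    (hμ : ∀ a < 4 + 2 * I.n, μ a = (initialState I).mem a) (hkey : ∀ j < I.n, |sortKey I j| ≤ V)
    {j : ℕ} (hj : j < I.n) (h : Sorting I m μ j σ) :
    Runs S V placeJob σ ((I.n + 1) * 100) (Sorting I m μ (j + 1)) := fun hbd => by
  have hbm := hbd.mem
  revert hbd
  obtain ⟨hc, hvj, hframe, hrel, hdl, hrank⟩ := h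
  have hS := hR.S_le
  have htab := hR.table
  have hm := hR.m_pos
  have hV := hR.le_V
  have hmem : ∀ a < 4 + 2 * I.n, σ.mem a = (initialState I).mem a := fun a ha =>
    (hframe a (.inl ha)).trans (hμ a ha)
  have e1 : ∀ x < I.n, σ.mem (4 + (I.n : ℤ) + x).toNat = (initialState I).mem (4 + I.n + x) :=
    fun x hx => by rw [← hmem _ (by omega)]; congr 1
  have e2 : σ.mem (4 + (j : ℤ)).toNat = (initialState I).mem (4 + j) := by
    rw [← hmem _ (by omega)]; congr 1
  have ekey : ∀ x : ℕ, (initialState I).mem (4 + I.n + x) * I.n + x = sortKey I x := fun _ => rfl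
  have hlt := sortRank_lt hj
  refine Runs.mono (t := 30 + ((I.n + 1) * 34 + 40)) (Runs.seq ((Runs.of_wp hR.le_V rfl
    (Q := fun σ' => Consts I m (horizon I) σ' ∧ σ'.mem = σ.mem ∧ σ'.reg vj = j ∧
      σ'.reg vkey = sortKey I j ∧ σ'.reg vx = (0 : ℕ) ∧ σ'.reg vpos =
      (((Finset.range 0).filter fun i => sortKey I i < sortKey I j).card : ℕ)) ?_).mono (by decide)
    fun σ₁ _ h₁ => Runs.seq (Runs.mono (Runs.loop hR.le_V rfl (N := I.n) (t := 24)
      (fun q σ' => Consts I m (horizon I) σ' ∧ σ'.mem = σ.mem ∧ σ'.reg vj = j ∧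
      σ'.reg vkey = sortKey I j ∧ σ'.reg vx = q ∧ σ'.reg vpos =
      (((Finset.range q).filter fun i => sortKey I i < sortKey I j).card : ℕ)) ?_
      (fun q hq σ' hσ' => (Runs.of_wp hR.le_V rfl ?_).mono (by decide) fun _ _ h => h) h₁) ?_
      fun σ₂ _ h₂ => (Runs.of_wp hR.le_V rfl ?_).mono (by decide) fun _ _ h => h)))
      (by omega) fun _ _ h => h
  · simp only [Cmd.wp, Expr.val, Expr.Safe, State.set_reg, State.set_mem, Nat.reduceEqDiff,
      if_true, if_false, true_and, and_true, hc.n_eq, hvj, e1 j hj, ekey, abs_zero,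
      Nat.cast_nonneg, Finset.range_zero, Finset.filter_empty, Finset.card_empty, Nat.cast_zero]
    refine ⟨by omega, hkey j hj, ?_⟩
    repeat' first | exact hc | refine Consts.set ?_ (by norm_num) _
  · rintro q hq σ ⟨c1, -, -, -, h2, -⟩
    refine ⟨by simp [Expr.Safe], ?_⟩
    simp only [Expr.val, c1.n_eq, h2]
    congr 1
    simp only [eq_iff_iff]
    omega
  · obtain ⟨c1, c2, c3, c4, c5, c6⟩ := hσ'
    have hcard : ((((Finset.range (q + 1)).filter fun i => sortKey I i < sortKey I j).card : ℕ) : ℤ)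
        = (((Finset.range q).filter fun i => sortKey I i < sortKey I j).card : ℕ) +
          (1 - if sortKey I j ≤ sortKey I q then 1 else 0) := by
      rw [Finset.range_add_one, Finset.filter_insert]
      split_ifs with h1 h2 h2
      · omega
      · rw [Finset.card_insert_of_notMem (by simp)]; push_cast; ring
      · simp
      · omega
    have hle : ((Finset.range (q + 1)).filter fun i => sortKey I i < sortKey I j).card ≤ q + 1 :=
      (Finset.card_filter_le _ _).trans (by simp)
    simp only [rankStep, Cmd.wp, Expr.val, Expr.Safe, Expr.val_sub, Expr.safe_sub,
      State.set_reg, State.set_mem, Nat.reduceEqDiff,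
      if_true, if_false, true_and, and_true, c1.n_eq, c2, c3, c4, c5, c6, e1 q hq, ekey, ← hcard,
      Nat.abs_cast]
    refine ⟨by omega, by omega, by rw [abs_le]; omega, ?_, by push_cast; rfl⟩
    repeat' first | exact c1 | refine Consts.set ?_ (by norm_num) _
  · refine Nat.mul_le_mul le_rfl ?_
    decide
  · obtain ⟨c1, c2, c3, c4, c5, c6⟩ := h₂
    change σ₂.reg vpos = (sortRank I j : ℕ) at c6
    generalize hrk : sortRank I j = rk at *
    have f1 : (4 + 2 * (I.n : ℤ) + rk).toNat = 4 + 2 * I.n + rk := by omega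
    have f2 : (4 + 3 * (I.n : ℤ) + rk).toNat = 4 + 3 * I.n + rk := by omega
    have f3 : (4 + 4 * (I.n : ℤ) + j).toNat = 4 + 4 * I.n + j := by omega
    have f4 : (4 + (I.n : ℤ) + j).toNat = 4 + I.n + j := by omega
    have f5 : (if 4 + I.n + j = 4 + 2 * I.n + rk then (initialState I).mem (4 + j)
        else σ.mem (4 + I.n + j)) = (initialState I).mem (4 + I.n + j) := by
      rw [if_neg (by omega), hmem _ (by omega)]
    have g1 : |(initialState I).mem (4 + j)| ≤ V := by rw [← hmem _ (by omega)]; exact hbm _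
    have g2 : |(initialState I).mem (4 + I.n + j)| ≤ V := by
      rw [← hmem _ (by omega)]; exact hbm _
    have g3 : |(rk : ℤ)| ≤ V := by rw [abs_le]; omega
    have g4 : |(j : ℤ) + 1| ≤ V := by rw [abs_le]; omega
    simp only [Cmd.wp, Expr.val, Expr.Safe, State.write_reg, State.write_mem, true_and, and_true,
      c1.n_eq, c1.rel_eq, c1.dl_eq, c1.rank_eq, c2, c3, c6, f1, f2, f3, f4, e2, f5]
    refine ⟨by omega, by omega, g1, by omega, by omega, g2, by omega, g3, g4, ?_⟩
    refine ⟨Consts.set (σ := ((σ₂.write _ _).write _ _).write _ _) ⟨c1.n_eq, c1.k_eq,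
      c1.B_eq, c1.p_eq, c1.m_eq, c1.rel_eq, c1.dl_eq,
      c1.rank_eq, c1.time_eq, c1.tab_eq, c1.A_eq, c1.M_eq⟩ (by norm_num) _, by simp,
      fun a ha => ?_, fun i hi => ?_, fun i hi => ?_, fun i hi => ?_⟩ <;>
      simp only [State.set_mem, State.write_mem, c2]
    · rw [if_neg (by omega), if_neg (by omega), if_neg (by omega)]
      exact hframe a ha
    · have h1 := sortRank_lt (I := I) (j := i) (by omega)
      rw [if_neg (by omega), if_neg (by omega)]
      rcases Nat.lt_succ_iff_lt_or_eq.mp hi with hlt' | rfl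
      · rw [if_neg, hrel i hlt']
        intro he
        have := sortRank_injective (I := I) (i := i) (j := j) (by omega) hj (by omega)
        omega
      · rw [if_pos (by omega)]
    · have h1 := sortRank_lt (I := I) (j := i) (by omega)
      rw [if_neg (by omega)]
      rcases Nat.lt_succ_iff_lt_or_eq.mp hi with hlt' | rfl
      · rw [if_neg, if_neg (by omega), hdl i hlt']
        intro he
        have := sortRank_injective (I := I) (i := i) (j := j) (by omega) hj (by omega)
        omega
      · rw [if_pos (by omega)]
    · rcases Nat.lt_succ_iff_lt_or_eq.mp hi with hlt' | rfl
      · rw [if_neg (by omega), if_neg (by omega), if_neg (by omega), hrank i hlt']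
      · rw [if_pos rfl, hrk]

theorem runs_sortJobs (hR : Room I m (horizon I) S V) (hc : Consts I m (horizon I) σ)
    (hμ : ∀ a < 4 + 2 * I.n, σ.mem a = (initialState I).mem a)
    (hkey : ∀ j < I.n, |sortKey I j| ≤ V) :
    Runs S V sortJobs σ ((I.n + 1) * ((I.n + 1) * 120)) (Sorting I m σ.mem I.n) := by
  refine Runs.mono (t := 2 + (I.n + 1) * (6 + (I.n + 1) * 100)) (Runs.seq
    ((Runs.of_wp hR.le_V rfl (Q := Sorting I m σ.mem 0) ?_).mono (by decide) fun σ₁ _ h₁ =>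
      Runs.mono (Runs.loop hR.le_V rfl (N := I.n) (t := (I.n + 1) * 100) (Sorting I m σ.mem) ?_
        (fun q hq σ' hσ' => runs_placeJob hR hμ hkey hq hσ') h₁) ?_ fun _ _ h => h))
      ?_ fun _ _ h => h
  · simp only [Cmd.wp, Expr.val, Expr.Safe, true_and, abs_zero, Nat.cast_nonneg]
    exact ⟨hc.set (by norm_num) _, by simp, fun a _ => rfl, fun i hi => by omega,
      fun i hi => by omega, fun i hi => by omega⟩
  · rintro q hq σ' hσ'
    refine ⟨by simp [Expr.Safe], ?_⟩
    simp only [Expr.val, hσ'.consts.n_eq, hσ'.j_eq]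
    congr 1
    simp only [eq_iff_iff]
    omega
  · refine Nat.mul_le_mul le_rfl (Nat.add_le_add_right ?_ _)
    decide
  · nlinarith [I.n_pos]

end BatchScheduling

namespace BatchScheduling

variable {I : BatchInstance} {m : ℕ} {S V : ℕ} {σ : State}

/-! ### Candidate times -/

/-- The memory holds `m` candidate times, among them every start time of an optimal schedule. -/
structure Listed (I : BatchInstance) (m : ℕ) (σ : State) : Prop extends Started I m σ where
  bound : ∀ x, x + 2 < m → |σ.mem (4 + 5 * I.n + 2 + x)| ≤ (I.n + 1) * horizon I
  candidate : ∀ s, I.IsOptimal s → ∀ j, ∃ x, x + 2 < m ∧ s j = σ.mem (4 + 5 * I.n + 2 + x)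

theorem Started.write {x : ℕ} (h : Started I m σ) (hx : x + 2 < m) (v : ℤ) :
    Started I m (σ.write (4 + 5 * I.n + 2 + x) v) := by
  refine ⟨⟨h.1.n_eq, h.1.k_eq, h.1.B_eq, h.1.p_eq, h.1.m_eq, h.1.rel_eq, h.1.dl_eq, h.1.rank_eq,
    h.1.time_eq, h.1.tab_eq, h.1.A_eq, h.1.M_eq⟩, ?_, ?_, fun a ha => ?_⟩ <;>
    rw [State.write_mem, if_neg (by omega)]
  exacts [h.first, h.second, h.other a ha]

theorem Started.set {x : ℕ} (h : Started I m σ) (hx : 12 ≤ x) (v : ℤ) : Started I m (σ.set x v) :=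
  ⟨h.consts.set hx v, h.first, h.second, h.other⟩

/-- Candidate time number `x` for general `p`: a release time plus a multiple of `p`. -/
def gridTime (I : BatchInstance) (x : ℕ) : ℤ :=
  (initialState I).mem (4 + x % I.n) + (x / I.n : ℕ) * I.p

/-- List the candidate times for general `p`: the first `n` of them are the release times, and each
of the others is `p` more than the one `n` places before it. -/
def listGrid : Cmd :=
  vx ≔ 0 ;;
  .loop (𝐫 vx + 1 ≼ 𝐫 vn * 𝐫 vn)
    (.ite (𝐫 vx + 1 ≼ 𝐫 vn)
      (.store (𝐫 vtime + 2 + 𝐫 vx) (𝐦 (4 + 𝐫 vx)))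
      (.store (𝐫 vtime + 2 + 𝐫 vx) (𝐦 (𝐫 vtime + 2 + (𝐫 vx - 𝐫 vn)) + 𝐫 vp)) ;;
    vx ≔ 𝐫 vx + 1)

theorem gridTime_of_lt {x : ℕ} (hx : x < I.n) : gridTime I x = (initialState I).mem (4 + x) := by
  simp [gridTime, Nat.mod_eq_of_lt hx, Nat.div_eq_of_lt hx]

theorem gridTime_of_le {x : ℕ} (hx : I.n ≤ x) : gridTime I x = gridTime I (x - I.n) + I.p := by
  simp only [gridTime]
  rw [Nat.mod_eq_sub_mod hx, Nat.div_eq_sub_div I.n_pos hx]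
  push_cast
  ring

theorem abs_gridTime_le {x : ℕ} (hx : x < I.n * I.n) :
    |gridTime I x| ≤ (I.n + 1) * horizon I := by
  have h1 := abs_add_le_horizon (I := I) (x := x % I.n) (by
    have := Nat.mod_lt x I.n_pos; omega)
  have h2 : (((x / I.n : ℕ) : ℤ) + 1) ≤ I.n := by
    exact_mod_cast Nat.div_lt_of_lt_mul hx
  have h3 := le_horizon I
  have h4 : ((x / I.n : ℕ) : ℤ) * I.p ≤ I.n * horizon I :=
    mul_le_mul (by omega) h3 (by omega) (by omega)
  have h5 : |((x / I.n : ℕ) : ℤ) * I.p| = ((x / I.n : ℕ) : ℤ) * I.p := abs_of_nonneg (by positivity)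
  simp only [gridTime]
  refine (abs_add_le _ _).trans ?_
  rw [h5, add_mul]
  omega

theorem runs_listGrid (hR : Room I (I.n * I.n + 2) (horizon I) S V)
    (h : Started I (I.n * I.n + 2) σ) :
    Runs S V listGrid σ ((I.n * I.n + 1) * 60) (Listed I (I.n * I.n + 2)) := by
  have hS := hR.S_le
  have htab := hR.table
  have hb := hR.bounds
  have hn := I.n_pos
  have hnn := Nat.le_mul_self I.n
  refine Runs.mono (t := 2 + ((I.n * I.n + 1) * 50)) (Runs.seq ((Runs.of_wp hR.le_V rfl
    (Q := fun σ => Started I (I.n * I.n + 2) σ ∧ σ.reg vx = (0 : ℕ)) ?_).mono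
    (by decide) fun σ' _ h' => Runs.mono (Runs.loop hR.le_V rfl (N := I.n * I.n) (t := 38)
      (fun q σ => Started I (I.n * I.n + 2) σ ∧ σ.reg vx = q ∧
        ∀ x < q, σ.mem (4 + 5 * I.n + 2 + x) = gridTime I x)
      ?_ (fun q hq σ hσ => (Runs.of_wp hR.le_V rfl ?_).mono (by decide) fun _ _ h => h)
      ⟨h'.1, h'.2, fun x hx => by omega⟩)
      ?_ fun σ₂ _ h₂ => ?_)) (by omega) fun _ _ h => h
  · simp only [Cmd.wp, Expr.val, Expr.Safe, true_and, abs_zero, Nat.cast_nonneg]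
    exact ⟨h.set (by norm_num) _, by simp⟩
  · rintro q hq σ ⟨c1, h2, -⟩
    refine ⟨by simp [Expr.Safe], ?_⟩
    simp only [Expr.val, c1.consts.n_eq, h2]
    congr 1
    simp only [eq_iff_iff]
    norm_cast
  · obtain ⟨hs, h2, h6⟩ := hσ
    have h1 := hs.consts
    have hgb := abs_gridTime_le hq
    have e1 : (4 + (q : ℤ)).toNat = 4 + q := by omega
    have e2 : (4 + 5 * (I.n : ℤ) + 2 + q).toNat = 4 + 5 * I.n + 2 + q := by omega
    have hgV : |gridTime I q| ≤ V := by omega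
    have hqq : |(q : ℤ) + 1| ≤ V := by rw [abs_le]; omega
    have fin : Started I (I.n * I.n + 2)
          ((σ.write (4 + 5 * I.n + 2 + q) (gridTime I q)).set vx (q + 1)) ∧
        ((σ.write (4 + 5 * I.n + 2 + q) (gridTime I q)).set vx (q + 1)).reg vx = (q + 1 : ℕ) ∧
        ∀ x < q + 1, ((σ.write (4 + 5 * I.n + 2 + q) (gridTime I q)).set vx (q + 1)).mem
          (4 + 5 * I.n + 2 + x) = gridTime I x := by
      refine ⟨(hs.write (by omega) _).set (by norm_num) _, by simp, fun x hx => ?_⟩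
      simp only [State.set_mem, State.write_mem]
      rcases Nat.lt_succ_iff_lt_or_eq.mp hx with hlt | rfl
      · rw [if_neg (by omega), h6 x hlt]
      · rw [if_pos rfl]
    by_cases hqn : q < I.n
    · have e3 : (if (q : ℤ) + 1 ≤ I.n then (1 : ℤ) else 0) = 1 := if_pos (by omega)
      have e4 : σ.mem (4 + q) = gridTime I q := by rw [hs.other _ (by omega), gridTime_of_lt hqn]
      simp only [Cmd.wp, Expr.val, Expr.Safe, State.set_reg, State.set_mem, State.write_reg,
        true_and, and_true, h1.n_eq, h1.time_eq, h2, e1, e2, e3, e4, ne_eq, one_ne_zero,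
        not_false_eq_true, forall_true_left, false_imp_iff]
      exact ⟨by omega, by omega, hgV, hqq, fin⟩
    · have e3 : (if (q : ℤ) + 1 ≤ I.n then (1 : ℤ) else 0) = 0 := if_neg (by omega)
      have e4 : σ.mem (4 + 5 * (I.n : ℤ) + 2 + (q - I.n)).toNat + I.p = gridTime I q := by
        rw [gridTime_of_le (by omega), ← h6 (q - I.n) (by omega)]
        congr 2
        omega
      simp only [Cmd.wp, Expr.val, Expr.Safe, Expr.val_sub, Expr.safe_sub, State.set_reg,
        State.set_mem, State.write_reg, true_and, and_true, h1.n_eq, h1.time_eq, h1.p_eq, h2, e2,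
        e3, e4, ne_eq, not_true_eq_false, false_imp_iff, forall_true_left]
      exact ⟨by omega, by omega, hgV, hqq, fin⟩
  · refine Nat.mul_le_mul le_rfl ?_
    decide
  · obtain ⟨h1, -, h6⟩ := h₂
    refine ⟨h1, fun x hx => ?_, fun s hs j => ?_⟩
    · rw [h6 x (by omega)]
      exact abs_gridTime_le (by omega)
    · obtain ⟨i, l, hl, he⟩ := hs.exists_release_add j
      have hlt : i + I.n * l < I.n * I.n := by
        have := Nat.mul_le_mul_left I.n (Nat.succ_le_of_lt hl)
        rw [Nat.mul_succ] at this
        omega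
      refine ⟨i + I.n * l, by omega, ?_⟩
      rw [h6 _ hlt, he, gridTime, Nat.add_mul_mod_self_left, Nat.mod_eq_of_lt i.2,
        Nat.add_mul_div_left _ _ I.n_pos, Nat.div_eq_of_lt i.2, zero_add, initialState_release]

/-- The first `j` jobs are parked one after the other, each at the first time after its release at
which no job is parked yet; `u` holds their times. -/
structure Parking (I : BatchInstance) (j : ℕ) (u : ℕ → ℤ) : Prop where
  injOn : ∀ x < j, ∀ y < j, u x = u y → x = y
  le : ∀ x < j, (initialState I).mem (4 + x) ≤ u x
  le_add : ∀ x < j, u x ≤ (initialState I).mem (4 + x) + I.n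
  full : ∀ x < j, ∀ t, (initialState I).mem (4 + x) ≤ t → t ≤ u x → ∃ y < j, u y = t

theorem Parking.succ {j : ℕ} {u u' : ℕ → ℤ} {t : ℤ} (h : Parking I j u)
    (hu : ∀ x < j, u' x = u x) (hj : u' j = t) (hle : (initialState I).mem (4 + j) ≤ t)
    (hadd : t ≤ (initialState I).mem (4 + j) + I.n) (hfree : ∀ x < j, u x ≠ t)
    (hfull : ∀ s, (initialState I).mem (4 + j) ≤ s → s < t → ∃ y < j, u y = s) :
    Parking I (j + 1) u' := by
  have key : ∀ x < j + 1, x < j ∧ u' x = u x ∨ x = j ∧ u' x = t := fun x hx => by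
    rcases Nat.lt_succ_iff_lt_or_eq.mp hx with hx | rfl
    exacts [.inl ⟨hx, hu x hx⟩, .inr ⟨rfl, hj⟩]
  have lift : ∀ {s : ℤ}, (∃ y < j, u y = s) → ∃ y < j + 1, u' y = s := fun ⟨y, hy, he⟩ =>
    ⟨y, by omega, by rw [hu y hy, he]⟩
  refine ⟨fun x hx y hy he => ?_, fun x hx => ?_, fun x hx => ?_, fun x hx s h1 h2 => ?_⟩
  · rcases key x hx with ⟨hx, ex⟩ | ⟨rfl, ex⟩ <;> rcases key y hy with ⟨hy, ey⟩ | ⟨rfl, ey⟩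
    · exact h.injOn x hx y hy (by omega)
    · exact absurd (by omega) (hfree x hx)
    · exact absurd (by omega) (hfree y hy)
    · rfl
  · rcases key x hx with ⟨hx, ex⟩ | ⟨rfl, ex⟩
    · rw [ex]; exact h.le x hx
    · rw [ex]; exact hle
  · rcases key x hx with ⟨hx, ex⟩ | ⟨rfl, ex⟩
    · rw [ex]; exact h.le_add x hx
    · rw [ex]; exact hadd
  · rcases key x hx with ⟨hx, ex⟩ | ⟨rfl, ex⟩
    · exact lift (h.full x hx s h1 (by omega))
    · rcases (h2.trans_eq ex).eq_or_lt with rfl | hlt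
      · exact ⟨x, by omega, ex⟩
      · exact lift (hfull s h1 hlt)

/-- The search for a parking time for job `j` after `y` attempts, the next one being for time
`t`. -/
structure Trying (I : BatchInstance) (j : ℕ) (u : ℕ → ℤ) (y : ℕ) (t : ℤ) : Prop where
  le : (initialState I).mem (4 + j) ≤ t
  le_add : t ≤ (initialState I).mem (4 + j) + y
  full : ∀ s, (initialState I).mem (4 + j) ≤ s → s < t → ∃ x < j, u x = s
  free : (∀ x < j, u x ≠ t) ∨ t = (initialState I).mem (4 + j) + y

theorem Trying.succ {j : ℕ} {u : ℕ → ℤ} {y : ℕ} {t : ℤ} (h : Trying I j u y t) :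
    ((∃ x < j, u x = t) → Trying I j u (y + 1) (t + 1)) ∧
      (¬ (∃ x < j, u x = t) → Trying I j u (y + 1) t) := by
  have h1 := h.le
  have h2 := h.le_add
  refine ⟨fun hx => ⟨by omega, by push_cast; omega, fun s hs hlt => ?_, .inr ?_⟩,
    fun hx => ⟨h1, by push_cast; omega, h.full, .inl fun x hxj he => hx ⟨x, hxj, he⟩⟩⟩
  · rcases (Int.lt_add_one_iff.mp hlt).eq_or_lt with rfl | hlt'
    · exact hx
    · exact h.full s hs hlt'
  · obtain ⟨x, hxj, he⟩ := hx
    rcases h.free with hf | hf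
    · exact absurd he (hf x hxj)
    · push_cast; omega

/-- After as many attempts as there are jobs, a parking time is found: fewer jobs cannot occupy
all the times that were tried. -/
theorem Trying.free_of_lt {j : ℕ} {u : ℕ → ℤ} {t : ℤ} (hj : j < I.n) (h : Trying I j u I.n t) :
    ∀ x < j, u x ≠ t := by
  rcases h.free with hf | hf
  · exact hf
  · exfalso
    have hsub : Finset.Ico ((initialState I).mem (4 + j)) t ⊆ (Finset.range j).image u := by
      intro s hs
      rw [Finset.mem_Ico] at hs
      obtain ⟨x, hx, he⟩ := h.full s hs.1 hs.2
      exact Finset.mem_image.mpr ⟨x, Finset.mem_range.mpr hx, he⟩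
    have h1 := Finset.card_le_card hsub
    have h2 := Finset.card_image_le (s := Finset.range j) (f := u)
    rw [Int.card_Ico] at h1
    rw [Finset.card_range] at h2
    omega

/-- Move on by one time unit if one of the first `j` jobs is parked at the time under
consideration. -/
def tryParking : Cmd :=
  (vv ≔ 0 ;; vx ≔ 0) ;;
  .loop (𝐫 vx + 1 ≼ 𝐫 vj)
    (vv ≔ 𝐫 vv + (𝐦 (𝐫 vtime + 2 + 𝐫 vx) ≼ 𝐫 vtx) * (𝐫 vtx ≼ 𝐦 (𝐫 vtime + 2 + 𝐫 vx)) ;;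
      vx ≔ 𝐫 vx + 1) ;;
  vtx ≔ 𝐫 vtx + (1 ≼ 𝐫 vv) ;; vb ≔ 𝐫 vb + 1

/-- Find the parking time of a job in `n` attempts. -/
def parkJob : Cmd :=
  (vtx ≔ 𝐦 (4 + 𝐫 vj) ;; vb ≔ 0) ;; .loop (𝐫 vb + 1 ≼ 𝐫 vn) tryParking ;;
  .store (𝐫 vtime + 2 + 𝐫 vj) (𝐫 vtx) ;; vj ≔ 𝐫 vj + 1

/-- List the parking times of all jobs. -/
def listParking : Cmd := vj ≔ 0 ;; .loop (𝐫 vj + 1 ≼ 𝐫 vn) parkJob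

theorem runs_tryParking (hR : Room I (I.n + 2) (horizon I) S V) {j y : ℕ} {μ : ℕ → ℤ}
    (hj : j < I.n) (hy : y < I.n)
    (h : Consts I (I.n + 2) (horizon I) σ ∧ σ.mem = μ ∧ σ.reg vj = j ∧ σ.reg vb = y ∧
      Trying I j (fun x => μ (4 + 5 * I.n + 2 + x)) y (σ.reg vtx)) :
    Runs S V tryParking σ ((I.n + 1) * 60) fun σ =>
      Consts I (I.n + 2) (horizon I) σ ∧ σ.mem = μ ∧ σ.reg vj = j ∧ σ.reg vb = (y + 1 : ℕ) ∧
      Trying I j (fun x => μ (4 + 5 * I.n + 2 + x)) (y + 1) (σ.reg vtx) := by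
  have hS := hR.S_le
  have htab := hR.table
  have hb := hR.bounds
  have hp := hR.p_le
  have hn := I.n_pos
  obtain ⟨hc, hμ, hvj, hvb, hT⟩ := h
  generalize htx : σ.reg vtx = t at hT
  have hr := abs_le.mp (le_sub_right_of_add_le (abs_add_le_horizon (I := I) (x := j) (by omega)))
  have hn1 : (I.n : ℤ) * 1 ≤ I.n * horizon I :=
    mul_le_mul_of_nonneg_left (by have := I.p_pos; omega) (by omega)
  refine Runs.mono (t := 6 + ((I.n + 1) * 36 + 12)) (Runs.seq ((Runs.of_wp hR.le_V rfl
    (Q := fun σ' => Consts I (I.n + 2) (horizon I) σ' ∧ σ'.mem = μ ∧ σ'.reg vj = j ∧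
      σ'.reg vb = y ∧ σ'.reg vtx = t ∧ σ'.reg vx = (0 : ℕ) ∧ σ'.reg vv =
      (((Finset.range 0).filter fun x => μ (4 + 5 * I.n + 2 + x) = t).card : ℕ)) ?_).mono
      (by decide) fun σ₁ _ h₁ => Runs.seq (Runs.mono (Runs.loop hR.le_V rfl (N := j) (t := 30)
      (fun q σ' => Consts I (I.n + 2) (horizon I) σ' ∧ σ'.mem = μ ∧ σ'.reg vj = j ∧
        σ'.reg vb = y ∧ σ'.reg vtx = t ∧ σ'.reg vx = q ∧ σ'.reg vv =
        (((Finset.range q).filter fun x => μ (4 + 5 * I.n + 2 + x) = t).card : ℕ)) ?_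
      (fun q hq σ' hσ' => (Runs.of_wp hR.le_V rfl ?_).mono (by decide) fun _ _ h => h) h₁) ?_
      fun σ₂ _ h₂ => (Runs.of_wp hR.le_V rfl ?_).mono (by decide) fun _ _ h => h)))
      (by omega) fun _ _ h => h
  · simp only [Cmd.wp, Expr.val, Expr.Safe, State.set_reg, State.set_mem, Nat.reduceEqDiff,
      if_true, if_false, true_and, and_true, abs_zero, Nat.cast_nonneg, Finset.range_zero,
      Finset.filter_empty, Finset.card_empty, Nat.cast_zero, hvj, hvb, htx, hμ]
    repeat' first | exact hc | refine Consts.set ?_ (by norm_num) _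
  · rintro q hq σ ⟨c1, -, h1, -, -, h2, -⟩
    refine ⟨by simp [Expr.Safe], ?_⟩
    simp only [Expr.val, h1, h2]
    congr 1
    simp only [eq_iff_iff]
    omega
  · obtain ⟨c1, c2, c3, c4, c5, c6, c7⟩ := hσ'
    have e2 : (4 + 5 * (I.n : ℤ) + 2 + q).toNat = 4 + 5 * I.n + 2 + q := by omega
    have hcard : ((((Finset.range (q + 1)).filter fun x => μ (4 + 5 * I.n + 2 + x) = t).card : ℕ) :
        ℤ) = (((Finset.range q).filter fun x => μ (4 + 5 * I.n + 2 + x) = t).card : ℕ) +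
          (if μ (4 + 5 * I.n + 2 + q) ≤ t then 1 else 0) *
            (if t ≤ μ (4 + 5 * I.n + 2 + q) then 1 else 0) := by
      rw [Finset.range_add_one, Finset.filter_insert]
      split_ifs with h1 h2 h3 h2 h3
      · rw [Finset.card_insert_of_notMem (by simp)]; push_cast; ring
      all_goals omega
    have hle : ((Finset.range (q + 1)).filter fun x => μ (4 + 5 * I.n + 2 + x) = t).card ≤ q + 1 :=
      (Finset.card_filter_le _ _).trans (by simp)
    simp only [Cmd.wp, Expr.val, Expr.Safe, State.set_reg, State.set_mem, Nat.reduceEqDiff,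
      if_true, if_false, true_and, and_true, c1.time_eq, c2, c3, c4, c5, c6, c7, e2, ← hcard,
      Nat.abs_cast]
    refine ⟨by omega, by omega, by rw [abs_le]; omega, ?_, by push_cast; rfl⟩
    repeat' first | exact c1 | refine Consts.set ?_ (by norm_num) _
  · refine Nat.mul_le_mul (by omega) ?_
    decide
  · obtain ⟨c1, c2, c3, c4, c5, c6, c7⟩ := h₂
    have hex : (1 : ℤ) ≤ (((Finset.range j).filter fun x => μ (4 + 5 * I.n + 2 + x) = t).card : ℕ) ↔
        ∃ x < j, μ (4 + 5 * I.n + 2 + x) = t := by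
      rw [← Nat.cast_one, Nat.cast_le, Nat.one_le_iff_ne_zero, Finset.card_ne_zero,
        Finset.filter_nonempty_iff]
      simp only [Finset.mem_range]
    have hsucc := hT.succ
    have hle := hT.le
    have hadd := hT.le_add
    have htV : |t + if ∃ x < j, μ (4 + 5 * I.n + 2 + x) = t then (1 : ℤ) else 0| ≤ V := by
      rw [abs_le]
      split_ifs <;> omega
    simp only [Cmd.wp, Expr.val, Expr.Safe, State.set_reg, State.set_mem, Nat.reduceEqDiff,
      if_true, if_false, true_and, and_true, c2, c3, c4, c5, c7, hex]
    refine ⟨htV, by rw [abs_le]; omega, ?_, by push_cast; rfl, ?_⟩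
    · repeat' first | exact c1 | refine Consts.set ?_ (by norm_num) _
    · split_ifs with hx
      · exact hsucc.1 hx
      · rw [add_zero]; exact hsucc.2 hx

theorem runs_parkJob (hR : Room I (I.n + 2) (horizon I) S V) {j : ℕ} (hj : j < I.n)
    (h : Started I (I.n + 2) σ ∧ σ.reg vj = j ∧
      Parking I j fun x => σ.mem (4 + 5 * I.n + 2 + x)) :
    Runs S V parkJob σ ((I.n + 1) * ((I.n + 1) * 80)) fun σ =>
      Started I (I.n + 2) σ ∧ σ.reg vj = (j + 1 : ℕ) ∧
        Parking I (j + 1) fun x => σ.mem (4 + 5 * I.n + 2 + x) := by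
  have hS := hR.S_le
  have htab := hR.table
  have hb := hR.bounds
  have hp := hR.p_le
  have hn := I.n_pos
  obtain ⟨hs, hvj, hP⟩ := h
  have hr := abs_le.mp (le_sub_right_of_add_le (abs_add_le_horizon (I := I) (x := j) (by omega)))
  have hn1 : (I.n : ℤ) * 1 ≤ I.n * horizon I :=
    mul_le_mul_of_nonneg_left (by have := I.p_pos; omega) (by omega)
  have e1 : σ.mem (4 + (j : ℤ)).toNat = (initialState I).mem (4 + j) := by
    rw [← hs.other _ (.inl (by omega))]; congr 1
  refine Runs.mono (t := 8 + ((I.n + 1) * (8 + (I.n + 1) * 60) + 20)) (Runs.seq ((Runs.of_wp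
    hR.le_V rfl (Q := fun σ' => Consts I (I.n + 2) (horizon I) σ' ∧ σ'.mem = σ.mem ∧
      σ'.reg vj = j ∧ σ'.reg vb = (0 : ℕ) ∧
      Trying I j (fun x => σ.mem (4 + 5 * I.n + 2 + x)) 0 (σ'.reg vtx)) ?_).mono
    (by decide) fun σ₁ _ h₁ => Runs.seq (Runs.mono (Runs.loop hR.le_V rfl (N := I.n)
      (fun y σ' => Consts I (I.n + 2) (horizon I) σ' ∧ σ'.mem = σ.mem ∧ σ'.reg vj = j ∧
        σ'.reg vb = y ∧ Trying I j (fun x => σ.mem (4 + 5 * I.n + 2 + x)) y (σ'.reg vtx)) ?_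
      (fun y hy σ' hσ' => runs_tryParking hR hj hy hσ') h₁) ?_
      fun σ₂ _ h₂ => (Runs.of_wp hR.le_V rfl ?_).mono (by decide) fun _ _ h => h)))
      ?_ fun _ _ h => h
  · simp only [Cmd.wp, Expr.val, Expr.Safe, State.set_reg, State.set_mem, Nat.reduceEqDiff,
      if_true, if_false, true_and, and_true, abs_zero, Nat.cast_nonneg, Nat.cast_zero, hvj, e1]
    refine ⟨by omega, by rw [abs_le]; omega, ?_, le_rfl, by simp, fun s h1 h2 => by omega,
      .inr (by simp)⟩
    repeat' first | exact hs.consts | refine Consts.set ?_ (by norm_num) _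
  · rintro q hq σ ⟨c1, -, -, h2, -⟩
    refine ⟨by simp [Expr.Safe], ?_⟩
    simp only [Expr.val, c1.n_eq, h2]
    congr 1
    simp only [eq_iff_iff]
    omega
  · refine Nat.mul_le_mul le_rfl (Nat.add_le_add_right ?_ _)
    decide
  · obtain ⟨c1, c2, c3, c4, c5⟩ := h₂
    have e2 : (4 + 5 * (I.n : ℤ) + 2 + j).toNat = 4 + 5 * I.n + 2 + j := by omega
    have hfree := c5.free_of_lt hj
    have hle := c5.le
    have hadd := c5.le_add
    simp only [Cmd.wp, Expr.val, Expr.Safe, State.write_reg, true_and, c1.time_eq, c3, e2]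
    refine ⟨by omega, by rw [abs_le]; omega, by rw [abs_le]; omega, ?_, by simp, ?_⟩
    · have hs₂ : Started I (I.n + 2) σ₂ :=
        ⟨c1, by rw [c2]; exact hs.first, by rw [c2]; exact hs.second,
          fun a ha => by rw [c2]; exact hs.other a ha⟩
      exact (hs₂.write (by omega) _).set (by norm_num) _
    · refine hP.succ (t := σ₂.reg vtx) (fun x hx => ?_) ?_ hle hadd hfree c5.full
      · simp only [State.set_mem, State.write_mem, c2]
        rw [if_neg (by omega)]
      · simp only [State.set_mem, State.write_mem, if_true]
  · nlinarith [I.n_pos]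

theorem runs_listParking (hp : I.p = 1) (hR : Room I (I.n + 2) (horizon I) S V)
    (h : Started I (I.n + 2) σ) :
    Runs S V listParking σ ((I.n + 1) * ((I.n + 1) * ((I.n + 1) * 90)))
      (Listed I (I.n + 2)) := by
  have hb := hR.bounds
  refine Runs.mono (t := 2 + (I.n + 1) * (6 + (I.n + 1) * ((I.n + 1) * 80))) (Runs.seq
    ((Runs.of_wp hR.le_V rfl (Q := fun σ => Started I (I.n + 2) σ ∧ σ.reg vj = (0 : ℕ)) ?_).mono
      (by decide) fun σ₁ _ h₁ =>
      Runs.mono (Runs.loop hR.le_V rfl (N := I.n) (fun j σ => Started I (I.n + 2) σ ∧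
        σ.reg vj = j ∧ Parking I j fun x => σ.mem (4 + 5 * I.n + 2 + x)) ?_
        (fun q hq σ' hσ' => runs_parkJob hR hq hσ') ⟨h₁.1, h₁.2, ?_⟩) ?_ fun σ₂ _ h₂ => ?_))
      ?_ fun _ _ h => h
  · simp only [Cmd.wp, Expr.val, Expr.Safe, true_and, abs_zero, Nat.cast_nonneg]
    exact ⟨h.set (by norm_num) _, by simp⟩
  · rintro q hq σ ⟨c1, h2, -⟩
    refine ⟨by simp [Expr.Safe], ?_⟩
    simp only [Expr.val, c1.consts.n_eq, h2]
    congr 1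
    simp only [eq_iff_iff]
    omega
  · exact ⟨fun x hx => by omega, fun x hx => by omega, fun x hx => by omega,
      fun x hx => by omega⟩
  · refine Nat.mul_le_mul le_rfl (Nat.add_le_add_right ?_ _)
    decide
  · obtain ⟨h1, -, hP⟩ := h₂
    refine ⟨h1, fun x hx => ?_, fun s hs j => ?_⟩
    · have h2 := hP.le x (by omega)
      have h3 := hP.le_add x (by omega)
      have hr := abs_le.mp
        (le_sub_right_of_add_le (abs_add_le_horizon (I := I) (x := x) (by omega)))
      have hn1 : (I.n : ℤ) * 1 ≤ I.n * horizon I :=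
        mul_le_mul_of_nonneg_left (by have := le_horizon I; omega) (by omega)
      rw [abs_le]
      omega
    · obtain ⟨i, hi⟩ := hs.mem_range_parking hp
        (u := fun i => σ₂.mem (4 + 5 * I.n + 2 + i))
        (fun x y he => Fin.ext (hP.injOn x x.2 y y.2 he))
        (fun i => by rw [← initialState_release]; exact hP.le i i.2)
        (fun i t h1 h2 => by
          rw [← initialState_release] at h1
          obtain ⟨y, hy, he⟩ := hP.full i i.2 t h1 h2
          exact ⟨⟨y, hy⟩, he⟩) j
      exact ⟨i, by omega, hi.symm⟩
  · nlinarith [I.n_pos, Nat.zero_le (I.n * I.n), Nat.zero_le (I.n * I.n * I.n)]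

end BatchScheduling

namespace BatchScheduling

variable {I : BatchInstance} {m : ℕ} {A : ℤ} {S V : ℕ} {μ : ℕ → ℤ} {σ : State}

/-! ### The whole program -/

/-- The whole program, which works with `e` candidate times, which are listed by `cand`. -/
def solver (e : Expr) (cand : Cmd) : Cmd :=
  sumSquares ;; setConsts e ;; cand ;; sortJobs ;; fillTable ;; readOut

/-- Every position in deadline order is taken. -/
theorem exists_sortRank_eq {q : ℕ} (hq : q < I.n) : ∃ j : Fin I.n, sortRank I j = q := by
  have hinj : Function.Injective fun j : Fin I.n => (⟨sortRank I j, sortRank_lt j.2⟩ : Fin I.n) :=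
    fun i j h => Fin.ext (sortRank_injective i.2 j.2 (congrArg Fin.val h))
  obtain ⟨j, hj⟩ := Finite.injective_iff_surjective.mp hinj ⟨q, hq⟩
  exact ⟨j, congrArg Fin.val hj⟩

theorem Sorting.rel_sortRank (hs : Sorting I m μ I.n σ) (j : Fin I.n) :
    (dataOf I m A σ.mem).rel (sortRank I j) = I.release j := by
  simp only [dataOf]
  rw [if_pos (sortRank_lt j.2), hs.rel j j.2, initialState_release]

theorem Sorting.dl_sortRank (hs : Sorting I m μ I.n σ) (j : Fin I.n) :
    (dataOf I m A σ.mem).dl (sortRank I j) = I.deadline j := by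
  simp only [dataOf]
  rw [if_pos (sortRank_lt j.2), hs.dl j j.2, initialState_deadline]

theorem Sorting.time_eq {σ₀ : State} (hs : Sorting I m σ₀.mem I.n σ) {x : ℕ} (hx : x < m) :
    (dataOf I m A σ.mem).time x = σ₀.mem (4 + 5 * I.n + x) := by
  simp only [dataOf]
  rw [if_pos hx, hs.frame _ (.inr (by omega))]

theorem ready_of_sorting {σ₀ : State} (hR : Room I m (horizon I) S V) (hl : Listed I m σ₀)
    (hs : Sorting I m σ₀.mem I.n σ) : Ready I m (horizon I) S V σ.mem := by
  have hb := hR.bounds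
  refine ⟨hR, fun x hx => ?_, fun q hq => ?_⟩
  · rw [hs.time_eq hx]
    obtain rfl | rfl | ⟨y, rfl⟩ : x = 0 ∨ x = 1 ∨ ∃ y, x = y + 2 := by
      rcases x with _ | _ | x
      exacts [.inl rfl, .inr (.inl rfl), .inr (.inr ⟨x, rfl⟩)]
    · rw [add_zero, hl.first, abs_neg, abs_of_nonneg hb.1]; omega
    · rw [hl.second, abs_of_nonneg hb.1]; omega
    · have := hl.bound y hx
      rwa [show 4 + 5 * I.n + (y + 2) = 4 + 5 * I.n + 2 + y by omega]
  · obtain ⟨j, rfl⟩ := exists_sortRank_eq hq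
    rw [hs.rel_sortRank]
    have := abs_release_le j
    omega

theorem solves_of_sorting {σ₀ : State} (hm : 2 ≤ m) (hl : Listed I m σ₀)
    (hs : Sorting I m σ₀.mem I.n σ) :
    (dataOf I m (horizon I) σ.mem).Solves I fun j => sortRank I j := by
  have h0 : (dataOf I m (horizon I) σ.mem).time 0 = - horizon I := by
    rw [hs.time_eq (by omega), add_zero, hl.first]
  have h1 : (dataOf I m (horizon I) σ.mem).time 1 = horizon I := by
    rw [hs.time_eq (by omega), hl.second]
  have hp : (dataOf I m (horizon I) σ.mem).p = I.p := rfl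
  have hB := I.B_pos
  refine ⟨fun i j h => Fin.ext (sortRank_injective i.2 j.2 h), fun j => sortRank_lt j.2, hm,
    ?_, rfl, hp, hs.rel_sortRank, hs.dl_sortRank, fun i hi j hj => ?_, fun j => ?_, fun j => ?_,
    fun j => ?_, ?_, ?_, fun s hopt j => ?_⟩
  · simp only [dataOf]; omega
  · obtain ⟨i', rfl⟩ := exists_sortRank_eq hi
    obtain ⟨j', rfl⟩ := exists_sortRank_eq (hj.trans hi)
    rw [hs.dl_sortRank, hs.dl_sortRank, ← initialState_deadline, ← initialState_deadline]
    refine deadline_le_of_sortKey_le i'.2 (not_lt.mp fun hlt => ?_)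
    have := sortRank_lt_sortRank i'.2 hlt
    omega
  · rw [h0, hp]
    have := abs_release_le j
    have := neg_abs_le (I.release j)
    omega
  · rw [h1]
    have := abs_deadline_le j
    have := le_abs_self (I.deadline j)
    omega
  · rw [h1]
    have := abs_release_le j
    have := le_abs_self (I.release j)
    omega
  · rw [h0, h1, hp]
    have := le_horizon I
    omega
  · rw [h0, h1, sub_neg_eq_add]; rfl
  · obtain ⟨x, hx, he⟩ := hl.candidate s hopt j
    refine ⟨2 + x, by change 2 + x < m; omega, ?_⟩
    rw [hs.time_eq (by omega), he, add_assoc]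

theorem runs_solver (hR : Room I m (horizon I) S V) (hkey : ∀ j < I.n, |sortKey I j| ≤ V)
    {e : Expr} (he : (setConsts e).straight = true) (hsteps : (setConsts e).steps ≤ 100)
    (hsafe : ∀ σ : State, e.Safe S σ)
    (hval : ∀ σ : State, σ.reg vn = (I.n : ℤ) → e.val σ = (m : ℤ)) {cand : Cmd} {t : ℕ}
    (hcand : ∀ σ, Started I m σ → Runs S V cand σ t (Listed I m)) :
    Runs S V (solver e cand) (initialState I)
      ((I.n + 1) * 60 + (100 + (t + ((I.n + 1) * ((I.n + 1) * 120) +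
        (((I.n * (m * m * I.B * (I.k + 1)) + 1) * (700 + (m + 1) * ((I.k + 1) * 400)) + 10) +
          ((I.n + 1) * ((I.n + 1) * 300) + 100)))))) (CorrectOutput I) := by
  refine Runs.seq ((runs_sumSquares hR).mono le_rfl fun σ₁ _ h₁ =>
    Runs.seq ((runs_setConsts hR he hsteps hsafe hval h₁).mono le_rfl fun σ₂ _ h₂ =>
    Runs.seq ((hcand σ₂ h₂).mono le_rfl fun σ₃ _ h₃ =>
    Runs.seq ((runs_sortJobs hR h₃.consts (fun a ha => h₃.other a (.inl (by omega))) hkey).mono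
      le_rfl fun σ₄ _ h₄ =>
    Runs.seq ((runs_fillTable (ready_of_sorting hR h₃ h₄) h₄.consts fun a ha => ?_).mono le_rfl
      fun σ₅ _ h₅ => runs_readOut hR h₅ (fun j => h₄.rank j j.2)
        (solves_of_sorting hR.m_pos h₃ h₄))))))
  rw [h₄.frame a (.inr (by omega)), h₃.other a (.inr ha), initialState_zero (by omega)]

/-! ### Resources -/

theorem abs_initialState_le (I : BatchInstance) (a : ℕ) :
    |(initialState I).mem a| ≤ (I.magnitude : ℤ) := by
  have hsup : ∀ j, max (I.release j).natAbs (I.deadline j).natAbs ≤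
      Finset.univ.sup fun j => max (I.release j).natAbs (I.deadline j).natAbs :=
    fun j => Finset.le_sup (f := fun j => max (I.release j).natAbs (I.deadline j).natAbs)
      (Finset.mem_univ j)
  simp only [initialState, BatchInstance.magnitude]
  split_ifs with h0 h1 h2 h3 h4 h5
  iterate 4 rw [abs_le]; omega
  · have := hsup ⟨a - 4, h4⟩
    rw [abs_le]; omega
  · have := hsup ⟨a - 4 - I.n, h5⟩
    rw [abs_le]; omega
  · rw [abs_le]; omega

theorem horizon_le (I : BatchInstance) : horizon I ≤ 3 * (I.magnitude : ℤ) ^ 3 := by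
  have hn := I.n_pos
  have h1 : (I.n : ℤ) ≤ I.magnitude := by simp only [BatchInstance.magnitude]; omega
  have h2 : (I.p : ℤ) ≤ I.magnitude := by simp only [BatchInstance.magnitude]; omega
  have h3 : ∑ x ∈ Finset.range (I.n + I.n), (initialState I).mem (4 + x) ^ 2 ≤
      (I.n + I.n : ℕ) • (I.magnitude : ℤ) ^ 2 := by
    refine (Finset.sum_le_card_nsmul _ _ _ fun x _ => ?_).trans_eq (by rw [Finset.card_range])
    exact sq_le_sq.mpr ((abs_initialState_le I _).trans (le_abs_self _))
  have h4 : (I.n : ℤ) * (I.magnitude : ℤ) ^ 2 ≤ I.magnitude * (I.magnitude : ℤ) ^ 2 :=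
    mul_le_mul_of_nonneg_right h1 (by positivity)
  have h5 : (I.magnitude : ℤ) ^ 1 ≤ (I.magnitude : ℤ) ^ 3 :=
    pow_le_pow_right₀ (by omega) (by norm_num)
  rw [nsmul_eq_mul] at h3
  push_cast at h3
  simp only [horizon]
  linarith [show (I.magnitude : ℤ) * (I.magnitude : ℤ) ^ 2 = (I.magnitude : ℤ) ^ 3 by ring]

theorem four_le_magnitude (I : BatchInstance) : 4 ≤ I.magnitude := by
  have := I.n_pos
  have := I.k_pos
  have := I.B_pos
  have := I.p_pos
  simp only [BatchInstance.magnitude]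
  omega

theorem abs_sortKey_le {j : ℕ} (hj : j < I.n) : |sortKey I j| ≤ 2 * (I.magnitude : ℤ) ^ 2 := by
  have h1 := abs_initialState_le I (4 + I.n + j)
  have h2 : (I.n : ℤ) ≤ I.magnitude := by simp only [BatchInstance.magnitude]; omega
  have h3 := four_le_magnitude I
  have h4 : |(initialState I).mem (4 + I.n + j)| * |(I.n : ℤ)| ≤ I.magnitude * I.magnitude :=
    mul_le_mul h1 (by rwa [Nat.abs_cast]) (abs_nonneg _) (by omega)
  simp only [sortKey]
  refine (abs_add_le _ _).trans ?_
  rw [abs_mul, Nat.abs_cast j]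
  nlinarith

theorem table_le {a m : ℕ} (ha : 1 ≤ a) (hm : m ≤ 3 * I.n ^ a) :
    4 + 5 * I.n + m + 4 * ((((I.n + 1) * m) * m * I.B) * (I.k + 1)) ≤
      2 ^ 64 * (I.B * I.k * I.n ^ (2 * a + 1)) := by
  have hn := I.n_pos
  have hk := I.k_pos
  have hB := I.B_pos
  have h1 : (((I.n + 1) * m) * m * I.B) * (I.k + 1) ≤
      (((2 * I.n) * (3 * I.n ^ a)) * (3 * I.n ^ a) * I.B) * (2 * I.k) := by gcongr <;> omega
  have h2 : (((2 * I.n) * (3 * I.n ^ a)) * (3 * I.n ^ a) * I.B) * (2 * I.k) =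
      36 * (I.B * I.k * I.n ^ (2 * a + 1)) := by ring
  have h3 : I.n ^ (2 * a + 1) ≤ I.B * I.k * I.n ^ (2 * a + 1) :=
    Nat.le_mul_of_pos_left _ (by positivity)
  have h4 : I.n ≤ I.n ^ (2 * a + 1) := Nat.le_self_pow (by omega) _
  have h5 : I.n ^ a ≤ I.n ^ (2 * a + 1) := Nat.pow_le_pow_right hn (by omega)
  omega

theorem time_le {a m t : ℕ} (ha : 1 ≤ a) (hm : m ≤ 3 * I.n ^ a)
    (ht : t ≤ 1000 * I.n ^ (3 * a + 1)) :
    (I.n + 1) * 60 + (100 + (t + ((I.n + 1) * ((I.n + 1) * 120) +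
      (((I.n * (m * m * I.B * (I.k + 1)) + 1) * (700 + (m + 1) * ((I.k + 1) * 400)) + 10) +
        ((I.n + 1) * ((I.n + 1) * 300) + 100))))) ≤
      2 ^ 64 * (I.B * I.k ^ 2 * I.n ^ (3 * a + 1)) := by
  have hn := I.n_pos
  have hk := I.k_pos
  have hB := I.B_pos
  have hna : 0 < I.n ^ a := by positivity
  have h1 : I.n * (m * m * I.B * (I.k + 1)) ≤
      I.n * ((3 * I.n ^ a) * (3 * I.n ^ a) * I.B * (2 * I.k)) := by gcongr; omega
  have h2 : I.n * ((3 * I.n ^ a) * (3 * I.n ^ a) * I.B * (2 * I.k)) + 1 ≤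
      19 * (I.B * I.k * I.n ^ (2 * a + 1)) := by
    have h : 1 ≤ I.B * I.k * I.n ^ (2 * a + 1) := Nat.one_le_iff_ne_zero.mpr (by positivity)
    have h' : I.n * ((3 * I.n ^ a) * (3 * I.n ^ a) * I.B * (2 * I.k)) =
      18 * (I.B * I.k * I.n ^ (2 * a + 1)) := by ring
    omega
  have h3 : 700 + (m + 1) * ((I.k + 1) * 400) ≤ 3900 * (I.k * I.n ^ a) := by
    have h : (m + 1) * ((I.k + 1) * 400) ≤ (4 * I.n ^ a) * ((2 * I.k) * 400) := by
      gcongr <;> omega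
    have h' : 1 ≤ I.k * I.n ^ a := Nat.one_le_iff_ne_zero.mpr (by positivity)
    have h'' : (4 * I.n ^ a) * ((2 * I.k) * 400) = 3200 * (I.k * I.n ^ a) := by ring
    omega
  have h4 : (I.n * (m * m * I.B * (I.k + 1)) + 1) * (700 + (m + 1) * ((I.k + 1) * 400)) ≤
      74100 * (I.B * I.k ^ 2 * I.n ^ (3 * a + 1)) :=
    (Nat.mul_le_mul ((Nat.add_le_add_right h1 1).trans h2) h3).trans_eq (by ring)
  have h5 : I.n ^ (3 * a + 1) ≤ I.B * I.k ^ 2 * I.n ^ (3 * a + 1) :=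
    Nat.le_mul_of_pos_left _ (by positivity)
  have h6 : I.n ^ 2 ≤ I.n ^ (3 * a + 1) := Nat.pow_le_pow_right hn (by omega)
  have h7 : I.n ≤ I.n ^ 2 := Nat.le_self_pow (by norm_num) _
  have h8 : (I.n + 1) * (I.n + 1) ≤ 4 * I.n ^ 2 :=
    (Nat.mul_le_mul (by omega : I.n + 1 ≤ 2 * I.n) (by omega : I.n + 1 ≤ 2 * I.n)).trans_eq
      (by ring)
  rw [← mul_assoc (I.n + 1), ← mul_assoc (I.n + 1)]
  omega

theorem space_le {a : ℕ} (ha : a ≤ 2) :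
    2 ^ 64 * (I.B * I.k * I.n ^ (2 * a + 1)) ≤ 2 * I.magnitude ^ 40 := by
  have h4 := four_le_magnitude I
  have hn : I.n ≤ I.magnitude := by simp only [BatchInstance.magnitude]; omega
  have hk : I.k ≤ I.magnitude := by simp only [BatchInstance.magnitude]; omega
  have hB : I.B ≤ I.magnitude := by simp only [BatchInstance.magnitude]; omega
  calc 2 ^ 64 * (I.B * I.k * I.n ^ (2 * a + 1))
      ≤ 4 ^ 32 * (I.magnitude * I.magnitude * I.magnitude ^ (2 * 2 + 1)) := by
        refine Nat.mul_le_mul (by norm_num) (Nat.mul_le_mul (Nat.mul_le_mul hB hk) ?_)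
        exact (Nat.pow_le_pow_left hn _).trans (Nat.pow_le_pow_right (by omega) (by omega))
    _ ≤ I.magnitude ^ 32 * (I.magnitude * I.magnitude * I.magnitude ^ (2 * 2 + 1)) :=
        Nat.mul_le_mul_right _ (Nat.pow_le_pow_left h4 _)
    _ = I.magnitude ^ 39 := by ring
    _ ≤ I.magnitude ^ 40 := Nat.pow_le_pow_right (by omega) (by norm_num)
    _ ≤ 2 * I.magnitude ^ 40 := by omega

/-- The resources of the program with at most `3 n ^ a` candidate times. All numbers stay below
`V = 2 * magnitude ^ 40`, and the words that `Runs` requires are those up to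
`V ^ 64 = 2 ^ 64 * magnitude ^ 2560`. The generous exponent `40` leaves room for a memory of
`2 ^ 64 * (B * k * n ^ 5)` cells, since `magnitude` is at least `4`; the factor `2 ^ 64` thus serves
for time, space and word size alike. -/
theorem solver_solvesWithin {a m : ℕ} (ha : 1 ≤ a) (ha' : a ≤ 2) (hm2 : 2 ≤ m)
    (hm : m ≤ 3 * I.n ^ a) {e : Expr} (he : (setConsts e).straight = true)
    (hsteps : (setConsts e).steps ≤ 100) (hsafe : ∀ (S : ℕ) (σ : State), e.Safe S σ)
    (hval : ∀ σ : State, σ.reg vn = (I.n : ℤ) → e.val σ = (m : ℤ)) {cand : Cmd} {t : ℕ}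
    (ht : t ≤ 1000 * I.n ^ (3 * a + 1))
    (hcand : ∀ (S V : ℕ), Room I m (horizon I) S V → ∀ σ, Started I m σ →
      Runs S V cand σ t (Listed I m)) :
    SolvesWithin (solver e cand) I (2 ^ 64 * (I.B * I.k ^ 2 * I.n ^ (3 * a + 1)))
      (2 ^ 64 * (I.B * I.k * I.n ^ (2 * a + 1))) (2 ^ 64 * I.magnitude ^ 2560) := by
  have htab := table_le (I := I) ha hm
  have hspace := space_le (I := I) ha'
  have hW : 2 ^ 64 * I.magnitude ^ 2560 = (2 * I.magnitude ^ 40) ^ 64 := by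
    rw [mul_pow, ← pow_mul]
  have h4 := four_le_magnitude I
  have hhor := horizon_le I
  have hpow : ∀ d, d ≤ 40 → I.magnitude ^ d ≤ I.magnitude ^ 40 := fun d hd =>
    Nat.pow_le_pow_right (by omega) hd
  have hpow' : ∀ d, d ≤ 40 → (I.magnitude : ℤ) ^ d ≤ (I.magnitude : ℤ) ^ 40 := fun d hd => by
    exact_mod_cast hpow d hd
  have hV : ((2 * I.magnitude ^ 40 : ℕ) : ℤ) = 2 * (I.magnitude : ℤ) ^ 40 := by push_cast; rfl
  have hR : Room I m (horizon I) (2 ^ 64 * (I.B * I.k * I.n ^ (2 * a + 1)))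
      (2 * I.magnitude ^ 40) := by
    refine ⟨hm2, hspace, ?_, ?_, le_horizon I, htab, ?_⟩
    · have := hpow 2 (by norm_num)
      nlinarith
    · have h1 : I.magnitude ≤ I.magnitude ^ 40 := Nat.le_self_pow (by norm_num) _
      have h : I.k + I.B + 1 ≤ I.magnitude := by
        have := I.n_pos
        simp only [BatchInstance.magnitude]; omega
      omega
    · have h1 : (I.n : ℤ) + 1 ≤ I.magnitude := by
        have := I.k_pos
        simp only [BatchInstance.magnitude]; omega
      have h2 : (I.n + 1) * horizon I ≤ I.magnitude * (3 * (I.magnitude : ℤ) ^ 3) :=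
        mul_le_mul h1 hhor (by have := le_horizon I; omega) (by omega)
      have h3 : (4 : ℤ) ^ 4 * (I.magnitude : ℤ) ^ 4 ≤ (I.magnitude : ℤ) ^ 4 * I.magnitude ^ 4 :=
        mul_le_mul_of_nonneg_right (pow_le_pow_left₀ (by norm_num) (by exact_mod_cast h4) _)
          (by positivity)
      have h5 := hpow' 8 (by norm_num)
      have h6 : (1 : ℤ) ≤ (I.magnitude : ℤ) ^ 4 := one_le_pow₀ (by omega)
      rw [hV]
      ring_nf at h2 h3 h5 ⊢
      linarith
  have hkey : ∀ j < I.n, |sortKey I j| ≤ ((2 * I.magnitude ^ 40 : ℕ) : ℤ) := fun j hj => by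
    rw [hV]
    exact (abs_sortKey_le hj).trans
      (mul_le_mul_of_nonneg_left (hpow' 2 (by norm_num)) (by norm_num))
  refine ⟨by omega, ?_⟩
  have hbd : Bounded (2 * I.magnitude ^ 40) (initialState I) := by
    refine ⟨fun x => by simp [initialState], fun x => ?_⟩
    have := abs_initialState_le I x
    have := hpow' 1 (by norm_num)
    rw [pow_one] at this
    rw [hV]
    omega
  obtain ⟨t', ht', σ, h1, -, h2⟩ := runs_solver hR hkey he hsteps (hsafe _) hval
    (hcand _ _ hR) hbd
  exact ⟨t', σ, ht'.trans (time_le ha hm ht), by rwa [hW], h2⟩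

/-- With all release times plus multiples of `p` up to `(n - 1) p` as candidate times. -/
theorem solvesWithin_grid (I : BatchInstance) :
    SolvesWithin (solver (𝐫 vn * 𝐫 vn + 2) listGrid) I (2 ^ 64 * (I.B * I.k ^ 2 * I.n ^ 7))
      (2 ^ 64 * (I.B * I.k * I.n ^ 5)) (2 ^ 64 * I.magnitude ^ 2560) := by
  have hn := I.n_pos
  have h2 : 1 ≤ I.n * I.n := Nat.one_le_iff_ne_zero.mpr (by positivity)
  refine solver_solvesWithin (a := 2) (m := I.n * I.n + 2) (t := (I.n * I.n + 1) * 60)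
    (by norm_num) le_rfl (by omega) (by rw [sq]; omega) rfl (by decide)
    (fun S σ => by simp [Expr.Safe]) (fun σ h => ?_) ?_ fun S V hR σ h => runs_listGrid hR h
  · simp only [Expr.val, h]; push_cast; rfl
  · have : I.n ^ 2 ≤ I.n ^ (3 * 2 + 1) := Nat.pow_le_pow_right hn (by norm_num)
    rw [sq] at this
    omega

/-- With the parking times as candidate times. -/
theorem solvesWithin_parking (I : BatchInstance) (hp : I.p = 1) :
    SolvesWithin (solver (𝐫 vn + 2) listParking) I (2 ^ 64 * (I.B * I.k ^ 2 * I.n ^ 4))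
      (2 ^ 64 * (I.B * I.k * I.n ^ 3)) (2 ^ 64 * I.magnitude ^ 2560) := by
  have hn := I.n_pos
  refine solver_solvesWithin (a := 1) (m := I.n + 2)
    (t := (I.n + 1) * ((I.n + 1) * ((I.n + 1) * 90)))
    le_rfl (by norm_num) (by omega) (by rw [pow_one]; omega) rfl (by decide)
    (fun S σ => by simp [Expr.Safe]) (fun σ h => ?_) ?_ fun S V hR σ h => runs_listParking hp hR h
  · simp only [Expr.val, h]; push_cast; rfl
  · have h1 : I.n + 1 ≤ 2 * I.n := by omega
    have h2 : (I.n + 1) * ((I.n + 1) * ((I.n + 1) * 90)) ≤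
        (2 * I.n) * ((2 * I.n) * ((2 * I.n) * 90)) := by gcongr
    have h3 : I.n ^ 3 ≤ I.n ^ (3 * 1 + 1) := Nat.pow_le_pow_right hn (by norm_num)
    have h4 : (2 * I.n) * ((2 * I.n) * ((2 * I.n) * 90)) = 720 * I.n ^ 3 := by ring
    omega

end BatchScheduling

theorem theorem3 :
    (∃ (P : BatchScheduling.Cmd) (C c : ℕ), ∀ I : BatchScheduling.BatchInstance,
      BatchScheduling.SolvesWithin P I
        (C * (I.B * I.k ^ 2 * I.n ^ 7))
        (C * (I.B * I.k * I.n ^ 5))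
        (C * I.magnitude ^ c)) ∧
    (∃ (P : BatchScheduling.Cmd) (C c : ℕ), ∀ I : BatchScheduling.BatchInstance, I.p = 1 →
      BatchScheduling.SolvesWithin P I
        (C * (I.B * I.k ^ 2 * I.n ^ 4))
        (C * (I.B * I.k * I.n ^ 3))
        (C * I.magnitude ^ c)) :=
  ⟨⟨_, 2 ^ 64, 2560, BatchScheduling.solvesWithin_grid⟩,
    ⟨_, 2 ^ 64, 2560, BatchScheduling.solvesWithin_parking⟩⟩
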